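/- **Setting.** Let $S$ be a quantum system with a nonzero finite-dimensional Hilbert space $\mathcal H_S$, let $A_S\ge 0$ be a positive semidefinite operator (the conserved quantity on $S$) and $B_S$ a Hermitian operator (the quantity to be measured) on $\mathcal H_S$; $\|\cdot\|$ is the operator norm. A *covariant implementation* $\mathcal K=(\mathcal H_E,A_E,\rho_E,M_E,\mathcal E_{SE})$ consists of a Hilbert space $\mathcal H_E$ of any dimension, a possibly unbounded self-adjoint operator $A_E$, a density operator $\rho_E$, a bounded self-adjoint probe observable $M_E$ on $\mathcal H_E$ with $[M_E,A_E]=0$ (that is, $M_E$ commutes with every $e^{-igA_E}$), and a quantum channel $\mathcal E_{SE}$ on $\mathcal H_S\otimes\mathcal H_E$ that is covariant with respect to $U_g=e^{-ig(A_S+A_E)}$: $$\mathcal E_{SE}(U_g\,\omega\,U_g^\dagger)=U_g\,\mathcal E_{SE}(\omega)\,U_g^\dagger\qquad\text{for all } g\in\mathbb R \text{ and all states }\omega .$$ (If $A_S+A_E$ has integer spectrum, this is covariance under $U(1)$ in the strict sense.) **Error.** Let $\mathcal E^\dagger$ be the Heisenberg dual of $\mathcal E_{SE}$ and write $B=B_S\otimes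 1$, $M=1\otimes M_E$. For a state $\rho_S$ let the error $\epsilon_{\mathcal K}(\rho_S)\ge 0$ be given by either one of the following (the theorem holds for each of the two definitions, which agree for unitary channels): $$\epsilon_{\mathcal K}(\rho_S)^2=\mathrm{Tr}\big[(\rho_S\otimes\rho_E)\,(B-\mathcal E^\dagger(M))^2\big],$$ $$\epsilon_{\mathcal K}(\rho_S)^2=\mathrm{Tr}\big[(\rho_S\otimes\rho_E)\,\big(B^2-B\,\mathcal E^\dagger(M)-\mathcal E^\dagger(M)\,B+\mathcal E^\dagger(M^2)\big)\big];$$ the second is the mean square of the noise operator $B-V^\dagger MV$ for a unitary dilation $V$ of the channel. Put $\epsilon_{\mathcal K}=\sup_{\rho_S}\epsilon_{\mathcal K}(\rho_S)$. **Cost.** Let $f:[0,\infty)\to[0,\infty)$ satisfy: $0\le X\le Y$ implies $f(X)\le f(Y)$ for Hermitian matrices of every size; $f(x)=xf(1/x)$ for $x>0$; $f(1)=1$. For a state $\rho=\sum_i p_i|i\rangle\langle i|$, with $\{|i\rangle\}$ an orthonormal eigenbasis, and a self-adjoint $A$, the metric adjusted skew information is $$I^f_\rho(A)=\frac{f(0)}2\sum_{i,j}\frac{(p_i-p_j)^2}{p_jf(p_i/p_j)}\,|\langle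 i|A|j\rangle|^2\in[0,\infty],$$ where $p_jf(p_i/p_j)$ is read as $p_if(0)$ if $p_j=0$, terms with $p_i=p_j=0$ are $0$, the value is $0$ if $f(0)=0$, and, in all cases, the value is $\infty$ if an eigenvector $|i\rangle$ with $p_i>0$ is not in the domain of $A$. Let $$I'^f_\epsilon=\inf\{\,I^f_{\rho_E}(A_E):\ \mathcal K \text{ a covariant implementation with } \epsilon_{\mathcal K}\le\epsilon\,\}.$$ **Theorem.** 1. For every such $f$ and every $\epsilon>0$, $$\sqrt{\frac{f(0)}2}\,\frac{\|[A_S,B_S]\|}{\epsilon}-\frac{\|A_S\|}2\ \le\ \sqrt{I'^f_\epsilon},$$ and if moreover $8\,\|A_S\|\,\epsilon\le\|[A_S,B_S]\|$, then $$\sqrt{I'^f_\epsilon}\ \le\ \frac{\|[A_S,B_S]\|}{2\epsilon}+\|A_S\| .$$ 2. For every such $f$ with $f(0)=1/2$, $$\sqrt{I'^f_\epsilon}=\frac{\|[A_S,B_S]\|}{2\epsilon}+O(\|A_S\|)\qquad(\epsilon\to0^+),$$ with an absolute implied constant; precisely, for all sufficiently small $\epsilon>0$ the cost $I'^f_\epsilon$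 is finite and $\big|\sqrt{I'^f_\epsilon}-\|[A_S,B_S]\|/(2\epsilon)\big|\le\|A_S\|$. 3. (Improved Wigner–Araki–Yanase–Ozawa inequality.) With $f_{SLD}(x)=(1+x)/2$, for every covariant implementation $\mathcal K$ and every state $\rho_S$, $$\epsilon_{\mathcal K}(\rho_S)^2\ \ge\ \frac{|\mathrm{Tr}(\rho_S[A_S,B_S])|^2}{4\,\big(I^{f_{SLD}}_{\rho_S}(A_S)+I^{f_{SLD}}_{\rho_E}(A_E)\big)} .$$ (If the denominator is $0$, then so is the numerator, and the right-hand side is read as $0$; if the denominator is $\infty$, the right-hand side is $0$.) -/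

import Mathlib

open scoped ENNReal Topology ComplexOrder

noncomputable section

namespace SkewCost

/-- A normal state (density operator) `ρ = ∑ k, prob k • |basis k⟩⟨basis k|` of a Hilbert space,
presented by its eigenvalues `prob k` and an orthonormal basis of eigenvectors. -/
structure State (H : Type) [NormedAddCommGroup H] [InnerProductSpace ℂ H] where
  idx : Type
  basis : HilbertBasis idx ℂ H
  prob : idx → ℝ
  prob_nonneg : ∀ k, 0 ≤ prob k
  prob_sum : HasSum prob 1

/-- `Tr[ρ X]` for a bounded operator `X`. -/
def State.expect {H : Type} [NormedAddCommGroup H] [InnerProductSpace ℂ H]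
    (ρ : State H) (X : H →L[ℂ] H) : ℂ :=
  ∑' k, (ρ.prob k : ℂ) * inner ℂ (ρ.basis k) (X (ρ.basis k))

/-- A normalized symmetric operator monotone function `[0, ∞) → [0, ∞)`: `0 ≤ X ≤ Y` implies `f X ≤ f Y` for
Hermitian matrices of every size, `f x = x * f (1 / x)` and `f 1 = 1`.
Only the values of `f` on `[0, ∞)` matter. -/
structure IsStandardMonotone (f : ℝ → ℝ) : Prop where
  mono : ∀ (n : ℕ) (X Y : Matrix (Fin n) (Fin n) ℂ), X.PosSemidef → (Y - X).PosSemidef →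
    (cfc f Y - cfc f X).PosSemidef
  symm : ∀ x : ℝ, 0 < x → f x = x * f (1 / x)
  one : f 1 = 1
  nonneg : ∀ x : ℝ, 0 ≤ x → 0 ≤ f x

/-- The function of the symmetric-logarithmic-derivative (SLD) skew information. -/
def fSLD (x : ℝ) : ℝ := (1 + x) / 2

/-- The mean `q * f (p / q)`; for `q = 0` it is given by the symmetry `q f(p/q) = p f(q/p)`. -/
def fMean (f : ℝ → ℝ) (p q : ℝ) : ℝ := if q = 0 then p * f 0 else q * f (p / q)

open Classical in
/-- The matrix element `⟨x, A y⟩` of a self-adjoint, possibly unbounded operator, for `y` in the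
domain of `A`, or else for `x` in the domain (as `⟨A x, y⟩`). -/
def matrixElement {H : Type} [NormedAddCommGroup H] [InnerProductSpace ℂ H]
    (A : H →ₗ.[ℂ] H) (x y : H) : ℂ :=
  if hy : y ∈ A.domain then inner ℂ x (A ⟨y, hy⟩)
  else if hx : x ∈ A.domain then inner ℂ (A ⟨x, hx⟩) y
  else 0

open Classical in
/-- The metric adjusted skew information
`I^f_ρ(A) = (f(0)/2) ∑_{i,j} (p_i - p_j)² / (p_j f(p_i/p_j)) |⟨i|A|j⟩|²`, with values in `[0, ∞]`.
Terms with `p_i = p_j = 0` are zero, so only matrix elements are used in which one of the two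
eigenvectors has a positive eigenvalue. The value is `∞` if such an eigenvector is outside
the domain of `A`. -/
def skewInfo {H : Type} [NormedAddCommGroup H] [InnerProductSpace ℂ H]
    (f : ℝ → ℝ) (ρ : State H) (A : H →ₗ.[ℂ] H) : ℝ≥0∞ :=
  if ∀ k, ρ.prob k ≠ 0 → ρ.basis k ∈ A.domain then
    ENNReal.ofReal (f 0 / 2) * ∑' i, ∑' j,
      ENNReal.ofReal ((ρ.prob i - ρ.prob j) ^ 2 / fMean f (ρ.prob i) (ρ.prob j)
        * ‖matrixElement A (ρ.basis i) (ρ.basis j)‖ ^ 2)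
  else ⊤

/-- `U t = e^{-itA}` for a (possibly unbounded) self-adjoint operator `A`: the unitary group
with derivative `-i A` at `t = 0` on the domain of `A`. -/
structure IsExpGroup {H : Type} [NormedAddCommGroup H] [InnerProductSpace ℂ H] [CompleteSpace H]
    (A : H →ₗ.[ℂ] H) (U : ℝ → H →L[ℂ] H) : Prop where
  unitary : ∀ t, U t ∈ unitary (H →L[ℂ] H)
  add : ∀ s t, U (s + t) = U s * U t
  deriv : ∀ ψ : A.domain, HasDerivAt (fun t => U t ψ) (-(Complex.I • A ψ)) 0

/-- A quantum channel on `H` in the Heisenberg picture: `Φ` is the dual of the completely positive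
trace-preserving map `ρ ↦ ∑ a, K a ρ (K a)†`, that is, `Φ X = ∑ a, (K a)† X (K a)` (weakly),
and trace preservation is `Φ 1 = 1`. -/
def IsChannelDual {H : Type} [NormedAddCommGroup H] [InnerProductSpace ℂ H]
    (Φ : (H →L[ℂ] H) →ₗ[ℂ] (H →L[ℂ] H)) : Prop :=
  Φ 1 = 1 ∧ ∃ (κ : Type) (K : κ → H →L[ℂ] H), ∀ (X : H →L[ℂ] H) (φ ψ : H),
    HasSum (fun a => inner ℂ (K a φ) (X (K a ψ))) (inner ℂ φ (Φ X ψ))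

/-- The Hilbert space of the finite-dimensional system `S` with orthonormal basis `ι`. -/
abbrev Sys (ι : Type) : Type := EuclideanSpace ℂ ι

/-- `ℂ^ι ⊗ E`, as the Hilbert direct sum of copies of `E` indexed by `ι`. -/
abbrev Joint (ι E : Type) : Type := PiLp 2 (fun _ : ι => E)

/-- The product vector `s ⊗ e`. -/
def tmul {ι E : Type} [NormedAddCommGroup E] [InnerProductSpace ℂ E]
    (s : Sys ι) (e : E) : Joint ι E :=
  WithLp.toLp 2 (fun i => s i • e)

/-- The product operator `B ⊗ M`, `((B ⊗ M) ψ)_i = ∑ j, B i j • M ψ_j`. -/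
def tensorOp {ι E : Type} [Fintype ι] [NormedAddCommGroup E] [InnerProductSpace ℂ E]
    (B : Matrix ι ι ℂ) (M : E →L[ℂ] E) : Joint ι E →L[ℂ] Joint ι E :=
  (PiLp.continuousLinearEquiv 2 ℂ (fun _ : ι => E)).symm.toContinuousLinearMap ∘L
    (ContinuousLinearMap.pi fun i => ∑ j, B i j • (M ∘L ContinuousLinearMap.proj j)) ∘L
    (PiLp.continuousLinearEquiv 2 ℂ (fun _ : ι => E)).toContinuousLinearMap

theorem tensorOp_apply {ι E : Type} [Fintype ι] [NormedAddCommGroup E] [InnerProductSpace ℂ E]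
    (B : Matrix ι ι ℂ) (M : E →L[ℂ] E) (ψ : Joint ι E) (i : ι) :
    tensorOp B M ψ i = ∑ j, B i j • M (ψ j) := by
  simp [tensorOp]

/-- `Tr[(ρ ⊗ σ) X]` for a bounded operator `X` on `ℂ^ι ⊗ E`. -/
def expectProd {ι E : Type} [Fintype ι] [NormedAddCommGroup E] [InnerProductSpace ℂ E]
    (ρ : State (Sys ι)) (σ : State E) (X : Joint ι E →L[ℂ] Joint ι E) : ℂ :=
  ∑' x : ρ.idx × σ.idx, ((ρ.prob x.1 * σ.prob x.2 : ℝ) : ℂ) *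
    inner ℂ (tmul (ρ.basis x.1) (σ.basis x.2)) (X (tmul (ρ.basis x.1) (σ.basis x.2)))

/-- `e^{-ig(A_S + A_E)} = e^{-igA_S} ⊗ e^{-igA_E}`, where `U g = e^{-igA_E}`. -/
def jointGroup {ι E : Type} [Fintype ι] [DecidableEq ι] [NormedAddCommGroup E]
    [InnerProductSpace ℂ E] (AS : Matrix ι ι ℂ) (U : ℝ → E →L[ℂ] E) (g : ℝ) :
    Joint ι E →L[ℂ] Joint ι E :=
  tensorOp (NormedSpace.exp ((-(Complex.I * (g : ℂ))) • AS)) (U g)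

/-- An implementation set `(H_E, A_E, ρ_E, M_E, ℰ_SE)`: an environment with Hilbert space `E`, a
(possibly unbounded) self-adjoint operator `A`, a state `ρ`, a bounded probe observable `M` that
commutes with `A`, and a channel on the joint system, with Heisenberg dual `Φ`, that is
covariant with respect to `V g = e^{-ig(A_S + A_E)}`: since `Tr[ℰ(ω) X] = Tr[ω Φ(X)]`, the identity
`ℰ(V g ω (V g)†) = V g ℰ(ω) (V g)†` for all states `ω` is
`(V g)† Φ(X) V g = Φ((V g)† X V g)` for all `X`. -/
structure Implementation {ι : Type} [Fintype ι] [DecidableEq ι] (AS : Matrix ι ι ℂ) where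
  E : Type
  [normed : NormedAddCommGroup E]
  [innerProd : InnerProductSpace ℂ E]
  [complete : CompleteSpace E]
  A : E →ₗ.[ℂ] E
  A_selfAdjoint : IsSelfAdjoint A
  U : ℝ → E →L[ℂ] E
  U_exp : IsExpGroup A U
  ρ : State E
  M : E →L[ℂ] E
  M_selfAdjoint : IsSelfAdjoint M
  M_comm : ∀ t, M * U t = U t * M
  Φ : (Joint ι E →L[ℂ] Joint ι E) →ₗ[ℂ] (Joint ι E →L[ℂ] Joint ι E)
  Φ_channel : IsChannelDual Φ
  Φ_covariant : ∀ (g : ℝ) (X : Joint ι E →L[ℂ] Joint ι E),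
    star (jointGroup AS U g) * Φ X * jointGroup AS U g
      = Φ (star (jointGroup AS U g) * X * jointGroup AS U g)

attribute [instance] Implementation.normed Implementation.innerProd Implementation.complete

/-- The two usual meanings of the second moment of the noise operator for a channel that need not be
unitary. With `N = B_S ⊗ 1 - ℰ†(1 ⊗ M_E)` on the joint system, `effective` is `Tr[ω N²]`.
With `N = B_S ⊗ 1 - V† (1 ⊗ M_E) V` on the joint system and the ancilla of a dilation of the
channel to a unitary `V`, the second moment `dilated` is
`Tr[ω (B_S² - B_S ℰ†(M_E) - ℰ†(M_E) B_S + ℰ†(M_E²))]`. They agree for unitary channels. -/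
inductive NoiseMoment where
  | effective
  | dilated

namespace Implementation

variable {ι : Type} [Fintype ι] [DecidableEq ι] {AS : Matrix ι ι ℂ}

/-- The operator on the joint system whose expectation is the squared error. -/
def noiseSq (K : Implementation AS) (B : Matrix ι ι ℂ) :
    NoiseMoment → (Joint ι K.E →L[ℂ] Joint ι K.E)
  | .effective => (tensorOp B 1 - K.Φ (tensorOp 1 K.M)) * (tensorOp B 1 - K.Φ (tensorOp 1 K.M))
  | .dilated => tensorOp B 1 * tensorOp B 1 - tensorOp B 1 * K.Φ (tensorOp 1 K.M)
      - K.Φ (tensorOp 1 K.M) * tensorOp B 1 + K.Φ (tensorOp 1 K.M * tensorOp 1 K.M)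

/-- The squared error `ε(ρ_S)²`. -/
def errorSq (K : Implementation AS) (B : Matrix ι ι ℂ) (m : NoiseMoment)
    (ρS : State (Sys ι)) : ℝ :=
  (expectProd ρS K.ρ (K.noiseSq B m)).re

/-- The worst-case error: the supremum over all states of `S` of the error `ε(ρ_S)`. -/
def worstError (K : Implementation AS) (B : Matrix ι ι ℂ) (m : NoiseMoment) : ℝ≥0∞ :=
  ⨆ ρS : State (Sys ι), ENNReal.ofReal (Real.sqrt (K.errorSq B m ρS))

end Implementation

/-- The coherence cost: the infimum of `I^f_{ρ_E}(A_E)` over all covariant implementations with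
worst-case error at most `ε`. -/
def cost {ι : Type} [Fintype ι] [DecidableEq ι] (f : ℝ → ℝ) (AS B : Matrix ι ι ℂ)
    (m : NoiseMoment) (ε : ℝ) : ℝ≥0∞ :=
  ⨅ (K : Implementation AS) (_ : K.worstError B m ≤ ENNReal.ofReal ε), skewInfo f K.ρ K.A

/-- The operator norm of a matrix acting on the Euclidean space. -/
def opNorm {ι : Type} [Fintype ι] [DecidableEq ι] (A : Matrix ι ι ℂ) : ℝ :=
  ‖Matrix.toEuclideanCLM (𝕜 := ℂ) A‖

/-- A matrix as an (everywhere defined) operator on the Euclidean space. -/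
def sysOp {ι : Type} [Fintype ι] [DecidableEq ι] (A : Matrix ι ι ℂ) : Sys ι →ₗ.[ℂ] Sys ι :=
  (Matrix.toEuclideanCLM (𝕜 := ℂ) A).toLinearMap.toPMap ⊤

end SkewCost

end

/-! Lower bounds. Let R be the Heisenberg dual of the probe observable and N = B ⊗ 1 - R. Covariance
and [M_E, A_E] = 0 make R invariant under the joint group, so on product vectors in the domain the
commutator of the total charge with N has the same expectation as [A_S, B_S]
(`inner_dual_probe_im`). In a product eigenbasis of ω = ρ_S ⊗ ρ_E this expectation is a sum of terms
(p_x - p_y) α n, with α and n matrix elements of charge and noise. Cauchy–Schwarz with the weight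
(p_x + p_y)/2, which is the mean belonging to `fSLD`, bounds its square by 4 I(A_S + A_E) Tr[ω N²]
(`ofReal_sq_tsum_le`). The skew information is subadditive on product states (`tsum_sumElement_le`),
and by Kadison's inequality Tr[ω N²] is the smaller of the two second moments. This is part 3.

For a pure system state the system term is at most a variance, hence at most ‖A_S‖²/4 because A_S ≥
0; this yields ‖[A_S, B_S]‖ ≤ ε √(‖A_S‖² + 4 I) with I the SLD skew information of the environment.
Every standard monotone f lies below `fSLD`, so I^f ≥ 2 f(0) I, and the lower bound of part 1
follows.

Upper bound. The environment is a chargeless copy of the system together with a line L²(ℝ) whose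
coordinate is the charge. Let W translate the line so that its charge drops by the eigenvalue of
A_S. Then W† (total charge) W is the coordinate alone, so the swap of system and copy, conjugated by
W, conserves the charge (`frameSwap_mul_jointGroup`). Reading B on the copy afterwards measures W (B
⊗ 1) W† (`conjDual_frameSwap`). Along the path of partial translations, the derivative of this
operator on s ⊗ φ is the conjugate of [A_S, B_S] applied to s ⊗ φ', where φ' is the derivative of
the translated frame vector φ (`norm_tensorOp_sub_conj_le`). For a Gaussian of standard deviation r
the norm of φ' is 1/(2r), so the error is at most ‖[A_S, B_S]‖/(2r) at a cost of at most the
variance r². Hence √cost ≤ ‖[A_S, B_S]‖/(2ε), and for f(0) = 1/2 the lower bound has the same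
leading term, which is part 2. -/

noncomputable section

namespace SkewCost

/-! ### Product vectors and product operators. -/

section Tensor

variable {ι E : Type} [NormedAddCommGroup E] [InnerProductSpace ℂ E]

theorem tmul_apply (s : Sys ι) (e : E) (i : ι) : tmul s e i = s i • e := rfl

theorem tmul_smul_left (c : ℂ) (s : Sys ι) (e : E) : tmul (c • s) e = c • tmul s e := by
  ext i; simp [tmul_apply, smul_smul]

variable [Fintype ι]

theorem inner_tmul (s t : Sys ι) (e f : E) :
    inner ℂ (tmul s e) (tmul t f) = inner ℂ s t * inner ℂ e f := by
  simp only [PiLp.inner_apply, tmul_apply, inner_smul_left, inner_smul_right, Finset.sum_mul]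
  refine Finset.sum_congr rfl fun i _ => ?_
  simp only [RCLike.inner_apply]
  ring

theorem norm_tmul (s : Sys ι) (e : E) : ‖tmul s e‖ = ‖s‖ * ‖e‖ := by
  have h := inner_tmul s s e e
  simp only [inner_self_eq_norm_sq_to_K] at h
  have h' : ‖tmul s e‖ ^ 2 = (‖s‖ * ‖e‖) ^ 2 := by
    rw [mul_pow]; exact_mod_cast h
  exact (sq_eq_sq₀ (norm_nonneg _) (by positivity)).1 h'

/-- `e ↦ s ⊗ e` as a bounded operator. -/
def tmulL (s : Sys ι) : E →L[ℂ] Joint ι E :=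
  LinearMap.mkContinuous
    { toFun := fun e => tmul s e
      map_add' := fun e f => by ext i; simp [tmul_apply]
      map_smul' := fun c e => by ext i; simp [tmul_apply, smul_smul, mul_comm] }
    ‖s‖ (fun e => (norm_tmul s e).le)

theorem tmulL_apply (s : Sys ι) (e : E) : tmulL s e = tmul s e := rfl

theorem tmul_smul_right (s : Sys ι) (c : ℂ) (e : E) : tmul s (c • e) = c • tmul s e :=
  (tmulL s).map_smul c e

theorem tensorOp_tmul [DecidableEq ι] (B : Matrix ι ι ℂ) (M : E →L[ℂ] E) (s : Sys ι) (e : E) :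
    tensorOp B M (tmul s e) = tmul (Matrix.toEuclideanCLM (𝕜 := ℂ) B s) (M e) := by
  ext i
  rw [tensorOp_apply, tmul_apply]
  simp only [tmul_apply, map_smul, smul_smul, ← Finset.sum_smul]
  rfl

theorem tensorOp_mul (B C : Matrix ι ι ℂ) (M N : E →L[ℂ] E) :
    tensorOp B M * tensorOp C N = tensorOp (B * C) (M * N) := by
  ext ψ i
  simp only [mul_apply_eq_comp, tensorOp_apply, map_sum, map_smul, Finset.smul_sum,
    Matrix.mul_apply, Finset.sum_smul, smul_smul]
  exact Finset.sum_comm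

theorem tensorOp_one [DecidableEq ι] :
    tensorOp (1 : Matrix ι ι ℂ) (1 : E →L[ℂ] E) = 1 := by
  ext ψ i
  simp [tensorOp_apply, Matrix.one_apply]

theorem tensorOp_add_left (B C : Matrix ι ι ℂ) (M : E →L[ℂ] E) :
    tensorOp (B + C) M = tensorOp B M + tensorOp C M := by
  ext ψ i
  simp [tensorOp_apply, add_smul, Finset.sum_add_distrib]

theorem tensorOp_smul_left (c : ℂ) (B : Matrix ι ι ℂ) (M : E →L[ℂ] E) :
    tensorOp (c • B) M = c • tensorOp B M := by
  ext ψ i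
  simp [tensorOp_apply, Finset.smul_sum, smul_smul]

theorem tensorOp_smul_right (c : ℂ) (B : Matrix ι ι ℂ) (M : E →L[ℂ] E) :
    tensorOp B (c • M) = c • tensorOp B M := by
  ext ψ i
  simp only [tensorOp_apply, _root_.smul_apply, PiLp.smul_apply, Finset.smul_sum]
  exact Finset.sum_congr rfl fun j _ => smul_comm _ _ _

theorem tensorOp_zero_left (M : E →L[ℂ] E) : tensorOp (0 : Matrix ι ι ℂ) M = 0 := by
  ext ψ i
  simp [tensorOp_apply]

theorem tensorOp_sum_left {κ : Type} (s : Finset κ) (B : κ → Matrix ι ι ℂ) (M : E →L[ℂ] E) :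
    tensorOp (∑ k ∈ s, B k) M = ∑ k ∈ s, tensorOp (B k) M := by
  classical
  induction s using Finset.induction_on with
  | empty => simp [tensorOp_zero_left]
  | insert a s ha ih => rw [Finset.sum_insert ha, Finset.sum_insert ha, tensorOp_add_left, ih]

variable [CompleteSpace E]

theorem tensorOp_star (B : Matrix ι ι ℂ) (M : E →L[ℂ] E) :
    star (tensorOp B M) = tensorOp (star B) (star M) := by
  rw [ContinuousLinearMap.star_eq_adjoint]
  symm
  rw [ContinuousLinearMap.eq_adjoint_iff]
  intro φ ψ
  simp only [PiLp.inner_apply, tensorOp_apply, sum_inner, inner_sum, inner_smul_left,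
    inner_smul_right, ContinuousLinearMap.star_eq_adjoint, ContinuousLinearMap.adjoint_inner_left,
    Matrix.star_apply, RCLike.star_def, RCLike.conj_conj]
  exact Finset.sum_comm

/-- `B ↦ B ⊗ 1` as a homomorphism of C⋆-algebras. -/
def ampliation [DecidableEq ι] : (Sys ι →L[ℂ] Sys ι) →⋆ₙₐ[ℂ] (Joint ι E →L[ℂ] Joint ι E) where
  toFun T := tensorOp ((Matrix.toEuclideanCLM (n := ι) (𝕜 := ℂ)).symm T) 1
  map_smul' c T := by simp [tensorOp_smul_left]
  map_zero' := by simp [tensorOp_zero_left]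
  map_add' S T := by simp [tensorOp_add_left]
  map_mul' S T := by rw [map_mul, tensorOp_mul, one_mul]
  map_star' T := by
    have h := (Matrix.toEuclideanCLM (n := ι) (𝕜 := ℂ)).symm.map_star' T
    change tensorOp _ 1 = star (tensorOp _ 1)
    rw [tensorOp_star, star_one]
    exact congrArg (fun X => tensorOp X 1) h

/-- A ⋆-homomorphism between C⋆-algebras is contractive, so no norm estimate on the tensor product
is needed. -/
theorem norm_tensorOp_one_le [DecidableEq ι] (B : Matrix ι ι ℂ) :
    ‖tensorOp B (1 : E →L[ℂ] E)‖ ≤ opNorm B := by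
  have h := NonUnitalStarAlgHom.norm_apply_le (ampliation (ι := ι) (E := E))
    (Matrix.toEuclideanCLM (n := ι) (𝕜 := ℂ) B)
  simpa [ampliation] using! h

end Tensor

/-! ### Spectral decomposition of a Hermitian matrix. -/

section SpectralProjections

variable {ι : Type} [Fintype ι] [DecidableEq ι]

/-- The rank-one projection onto the `i`-th eigenvector of a Hermitian matrix. -/
def eigProj {A : Matrix ι ι ℂ} (hA : A.IsHermitian) (i : ι) : Matrix ι ι ℂ :=
  (hA.eigenvectorUnitary : Matrix ι ι ℂ) * Matrix.single i i 1
    * star (hA.eigenvectorUnitary : Matrix ι ι ℂ)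

variable {A : Matrix ι ι ℂ} (hA : A.IsHermitian)

theorem eigProj_mul (i j : ι) :
    eigProj hA i * eigProj hA j = if i = j then eigProj hA i else 0 := by
  have h : star (hA.eigenvectorUnitary : Matrix ι ι ℂ) * (hA.eigenvectorUnitary : Matrix ι ι ℂ) = 1 :=
    Unitary.coe_star_mul_self _
  have : eigProj hA i * eigProj hA j = (hA.eigenvectorUnitary : Matrix ι ι ℂ)
      * (Matrix.single i i 1 * Matrix.single j j 1)
      * star (hA.eigenvectorUnitary : Matrix ι ι ℂ) := by
    simp only [eigProj]
    calc _ = (hA.eigenvectorUnitary : Matrix ι ι ℂ) * Matrix.single i i 1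
          * (star (hA.eigenvectorUnitary : Matrix ι ι ℂ) * (hA.eigenvectorUnitary : Matrix ι ι ℂ))
          * Matrix.single j j 1 * star (hA.eigenvectorUnitary : Matrix ι ι ℂ) := by
            simp only [mul_assoc]
      _ = _ := by rw [h, mul_one]; simp only [mul_assoc]
  rw [this]
  split_ifs with hij
  · subst hij; simp [eigProj]
  · rw [Matrix.single_mul_single_of_ne (h := hij)]; simp

theorem star_eigProj (i : ι) : star (eigProj hA i) = eigProj hA i := by
  simp [eigProj, Matrix.star_eq_conjTranspose, mul_assoc]

theorem sum_smul_eigProj (c : ι → ℂ) :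
    ∑ i, c i • eigProj hA i = (hA.eigenvectorUnitary : Matrix ι ι ℂ) * Matrix.diagonal c
      * star (hA.eigenvectorUnitary : Matrix ι ι ℂ) := by
  have : Matrix.diagonal c = ∑ i, c i • Matrix.single i i (1 : ℂ) := by
    rw [← Matrix.sum_single_eq_diagonal]
    simp [Matrix.smul_single]
  rw [this, Finset.mul_sum, Finset.sum_mul]
  refine Finset.sum_congr rfl fun i _ => ?_
  rw [mul_smul_comm, smul_mul_assoc, eigProj]

theorem sum_eigProj : ∑ i, eigProj hA i = 1 := by
  have h := sum_smul_eigProj hA (fun _ => 1)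
  simpa using h

theorem sum_eigenvalue_smul_eigProj :
    ∑ i, ((hA.eigenvalues i : ℝ) : ℂ) • eigProj hA i = A := by
  rw [sum_smul_eigProj]
  conv_rhs => rw [hA.spectral_theorem]
  rw [Unitary.conjStarAlgAut_apply]
  rfl

theorem exp_smul_eq_sum_eigProj (c : ℂ) :
    NormedSpace.exp (c • A)
      = ∑ i, NormedSpace.exp (c * ((hA.eigenvalues i : ℝ) : ℂ)) • eigProj hA i := by
  have h1 : star (hA.eigenvectorUnitary : Matrix ι ι ℂ)
      = (hA.eigenvectorUnitary : Matrix ι ι ℂ)⁻¹ :=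
    (Matrix.inv_eq_left_inv (Unitary.coe_star_mul_self _)).symm
  have hu : IsUnit (hA.eigenvectorUnitary : Matrix ι ι ℂ) :=
    (Unitary.toUnits hA.eigenvectorUnitary).isUnit
  conv_lhs => rw [← sum_eigenvalue_smul_eigProj hA, Finset.smul_sum]
  simp only [smul_smul]
  rw [sum_smul_eigProj, sum_smul_eigProj, h1, Matrix.exp_conj _ _ hu, Matrix.exp_diagonal]
  congr 3
  ext i
  simp [Pi.coe_exp]

theorem eigProj_mul_self (i : ι) :
    eigProj hA i * A = ((hA.eigenvalues i : ℝ) : ℂ) • eigProj hA i := by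
  calc _ = eigProj hA i * ∑ j, ((hA.eigenvalues j : ℝ) : ℂ) • eigProj hA j := by
        rw [sum_eigenvalue_smul_eigProj]
    _ = _ := by simp [Finset.mul_sum, eigProj_mul]

theorem self_mul_eigProj (i : ι) :
    A * eigProj hA i = ((hA.eigenvalues i : ℝ) : ℂ) • eigProj hA i := by
  calc _ = (∑ j, ((hA.eigenvalues j : ℝ) : ℂ) • eigProj hA j) * eigProj hA i := by
        rw [sum_eigenvalue_smul_eigProj]
    _ = _ := by simp [Finset.sum_mul, eigProj_mul]

end SpectralProjections

theorem clm_star_sum {H κ : Type} [NormedAddCommGroup H] [InnerProductSpace ℂ H] [CompleteSpace H]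
    (s : Finset κ) (X : κ → H →L[ℂ] H) : star (∑ k ∈ s, X k) = ∑ k ∈ s, star (X k) :=
  map_sum ContinuousLinearMap.adjoint X s

theorem clm_star_sub {H : Type} [NormedAddCommGroup H] [InnerProductSpace ℂ H] [CompleteSpace H]
    (X Y : H →L[ℂ] H) : star (X - Y) = star X - star Y :=
  map_sub ContinuousLinearMap.adjoint X Y

/-! ### Operators controlled by the eigenvalues of the system. -/

section ControlledOperators

variable {ι E : Type} [Fintype ι] [DecidableEq ι] [NormedAddCommGroup E] [InnerProductSpace ℂ E]

/-- The operator `∑ i, P i ⊗ u i`, where the `P i` are the eigenprojections of a Hermitian matrix. -/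
def controlled {A : Matrix ι ι ℂ} (hA : A.IsHermitian) (u : ι → E →L[ℂ] E) :
    Joint ι E →L[ℂ] Joint ι E :=
  ∑ i, tensorOp (eigProj hA i) (u i)

variable {A : Matrix ι ι ℂ} (hA : A.IsHermitian)

theorem controlled_mul (u v : ι → E →L[ℂ] E) :
    controlled hA u * controlled hA v = controlled hA (fun i => u i * v i) := by
  simp only [controlled, Finset.sum_mul, Finset.mul_sum, tensorOp_mul, eigProj_mul]
  refine Finset.sum_congr rfl fun i _ => ?_
  rw [Finset.sum_eq_single i]
  · simp
  · intro j _ hj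
    rw [if_neg hj, tensorOp_zero_left]
  · simp

theorem controlled_const (u : E →L[ℂ] E) : controlled hA (fun _ => u) = tensorOp 1 u := by
  rw [controlled, ← tensorOp_sum_left, sum_eigProj]

theorem controlled_mul_tensorOp_mul (u v : ι → E →L[ℂ] E) (B : Matrix ι ι ℂ) :
    controlled hA u * tensorOp B 1 * controlled hA v
      = ∑ i, ∑ j, tensorOp (eigProj hA i * B * eigProj hA j) (u i * v j) := by
  simp only [controlled, Finset.sum_mul, Finset.mul_sum, tensorOp_mul, mul_one]
  exact Finset.sum_comm

/-- In each eigensector of the system the joint group is a phase times `U g`, so its products with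
controlled shifts can be computed sector by sector. -/
theorem jointGroup_eq_controlled (U : ℝ → E →L[ℂ] E) (g : ℝ) :
    jointGroup A U g
      = controlled hA (fun i => Complex.exp (-(Complex.I * g) * (hA.eigenvalues i : ℝ)) • U g) := by
  rw [jointGroup, exp_smul_eq_sum_eigProj hA, tensorOp_sum_left, controlled]
  refine Finset.sum_congr rfl fun i _ => ?_
  rw [tensorOp_smul_left, tensorOp_smul_right, Complex.exp_eq_exp_ℂ]

/-- Source of the commutator in the error bound: differentiating a conjugation by controlled shifts
produces the factor a_i - a_j, which turns a block of B into the same block of [A, B]. -/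
theorem eigProj_commutator_eigProj (B : Matrix ι ι ℂ) (i j : ι) :
    eigProj hA i * (A * B - B * A) * eigProj hA j
      = ((hA.eigenvalues i - hA.eigenvalues j : ℝ) : ℂ) • (eigProj hA i * B * eigProj hA j) := by
  rw [mul_sub, sub_mul, ← mul_assoc, eigProj_mul_self, mul_assoc _ (B * A), mul_assoc B,
    self_mul_eigProj]
  simp only [mul_smul_comm, smul_mul_assoc, Complex.ofReal_sub, sub_smul, mul_assoc]

variable [CompleteSpace E]

theorem controlled_star (u : ι → E →L[ℂ] E) :
    star (controlled hA u) = controlled hA (fun i => star (u i)) := by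
  simp only [controlled, clm_star_sum, tensorOp_star, star_eigProj]

theorem star_controlled_mul_self {u : ι → E →L[ℂ] E} (hu : ∀ i, u i ∈ unitary (E →L[ℂ] E)) :
    star (controlled hA u) * controlled hA u = 1 := by
  rw [controlled_star, controlled_mul]
  simp only [Unitary.star_mul_self_of_mem (hu _), controlled_const, tensorOp_one]

theorem controlled_mul_star_self {u : ι → E →L[ℂ] E} (hu : ∀ i, u i ∈ unitary (E →L[ℂ] E)) :
    controlled hA u * star (controlled hA u) = 1 := by
  rw [controlled_star, controlled_mul]
  simp only [Unitary.mul_star_self_of_mem (hu _), controlled_const, tensorOp_one]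

/-- A unitary representation of the additive group `ℝ`. -/
structure IsUnitaryRep (T : ℝ → E →L[ℂ] E) : Prop where
  unitary : ∀ t, T t ∈ unitary (E →L[ℂ] E)
  add : ∀ s t, T (s + t) = T s * T t

theorem IsUnitaryRep.zero {T : ℝ → E →L[ℂ] E} (hT : IsUnitaryRep T) : T 0 = 1 := by
  have h := hT.add 0 0
  rw [add_zero] at h
  calc T 0 = star (T 0) * T 0 * T 0 := by
        rw [Unitary.star_mul_self_of_mem (hT.unitary 0), one_mul]
    _ = star (T 0) * T 0 := by rw [mul_assoc, ← h]
    _ = 1 := Unitary.star_mul_self_of_mem (hT.unitary 0)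

theorem IsUnitaryRep.star_eq {T : ℝ → E →L[ℂ] E} (hT : IsUnitaryRep T) (t : ℝ) :
    star (T t) = T (-t) := by
  calc star (T t) = star (T t) * (T t * T (-t)) := by
        rw [← hT.add, add_neg_cancel, hT.zero, mul_one]
    _ = T (-t) := by rw [← mul_assoc, Unitary.star_mul_self_of_mem (hT.unitary t), one_mul]

/-- The group law carries differentiability of a single orbit from time 0 to all times. -/
theorem IsUnitaryRep.hasDerivAt {T : ℝ → E →L[ℂ] E} (hT : IsUnitaryRep T) {φ φ' : E}
    (h : HasDerivAt (fun t => T t φ) φ' 0) (c t : ℝ) :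
    HasDerivAt (fun t => T (t * c) φ) ((c : ℂ) • T (t * c) φ') t := by
  have h0 : HasDerivAt (fun r : ℝ => T r φ) φ' ((t - t) * c) := by simpa using h
  have h1 : HasDerivAt (fun r : ℝ => (r - t) * c) (1 * c) t :=
    ((hasDerivAt_id t).sub_const t).mul_const c
  have h2 := h0.scomp t h1
  have h3 := ((T (t * c)).restrictScalars ℝ).hasFDerivAt.comp_hasDerivAt t h2
  have e1 : (fun t => T (t * c) φ)
      = ((T (t * c)).restrictScalars ℝ) ∘ ((fun r : ℝ => T r φ) ∘ fun r : ℝ => (r - t) * c) := by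
    funext r
    simp only [Function.comp, ContinuousLinearMap.coe_restrictScalars']
    rw [← mul_apply_eq_comp, ← hT.add]
    congr 2
    ring
  rw [e1]
  convert! h3 using 1
  simp

/-- The conjugate of `B ⊗ 1` by a controlled shift is close to `B ⊗ 1` on product vectors. -/
theorem norm_tensorOp_sub_conj_le (B : Matrix ι ι ℂ) {T : ℝ → E →L[ℂ] E} (hT : IsUnitaryRep T)
    {φ φ' : E} (h : HasDerivAt (fun t => T t φ) φ' 0) (s : Sys ι) :
    ‖(tensorOp B (1 : E →L[ℂ] E) - controlled hA (fun i => T (hA.eigenvalues i)) * tensorOp B 1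
        * star (controlled hA (fun i => T (hA.eigenvalues i))) : Joint ι E →L[ℂ] Joint ι E) (tmul s φ)‖
      ≤ opNorm (A * B - B * A) * (‖s‖ * ‖φ'‖) := by
  set a := hA.eigenvalues with ha
  let W : ℝ → Joint ι E →L[ℂ] Joint ι E := fun t => controlled hA (fun i => T (t * a i))
  have hWu : ∀ t, W t ∈ unitary (Joint ι E →L[ℂ] Joint ι E) := fun t =>
    ⟨star_controlled_mul_self hA fun i => hT.unitary _,
      controlled_mul_star_self hA fun i => hT.unitary _⟩
  -- `G C t` is C ⊗ 1 conjugated by the controlled shift scaled by t. It joins C ⊗ 1 at t = 0 to the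
  -- full conjugate at t = 1. The derivative of `G B` on s ⊗ φ is `G [A, B]` on s ⊗ φ', which has a
  -- bound uniform in t, and the mean value inequality on [0, 1] finishes.
  let G : Matrix ι ι ℂ → ℝ → Joint ι E →L[ℂ] Joint ι E :=
    fun C t => W t * tensorOp C 1 * star (W t)
  have hconj : ∀ (C : Matrix ι ι ℂ) (t : ℝ) (χ : E), G C t (tmul s χ)
      = ∑ i, ∑ j, tmulL (Matrix.toEuclideanCLM (𝕜 := ℂ) (eigProj hA i * C * eigProj hA j) s)
          (T (t * (a i - a j)) χ) := by
    intro C t χ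
    simp only [G, W]
    rw [controlled_star, controlled_mul_tensorOp_mul]
    simp only [_root_.sum_apply, tensorOp_tmul, tmulL_apply]
    refine Finset.sum_congr rfl fun i _ => Finset.sum_congr rfl fun j _ => ?_
    rw [hT.star_eq, ← hT.add]
    congr 3
    ring
  have hderiv : ∀ t : ℝ, HasDerivAt (fun t => G B t (tmul s φ))
      (G (A * B - B * A) t (tmul s φ')) t := by
    intro t
    simp only [hconj]
    refine HasDerivAt.fun_sum fun i _ => HasDerivAt.fun_sum fun j _ => ?_
    have h1 := ((tmulL (E := E) (Matrix.toEuclideanCLM (𝕜 := ℂ)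
      (eigProj hA i * B * eigProj hA j) s)).restrictScalars ℝ).hasFDerivAt.comp_hasDerivAt t
        (hT.hasDerivAt h (a i - a j) t)
    convert! h1 using 1
    rw [eigProj_commutator_eigProj, map_smul, ← ha]
    simp only [tmulL_apply, ContinuousLinearMap.coe_restrictScalars', _root_.smul_apply]
    rw [tmul_smul_left, tmul_smul_right]
  have hbound : ∀ t ∈ Set.Ico (0 : ℝ) 1,
      ‖G (A * B - B * A) t (tmul s φ')‖
        ≤ opNorm (A * B - B * A) * (‖s‖ * ‖φ'‖) := by
    intro t _
    simp only [G]
    rw [mul_assoc, mul_apply_eq_comp, ContinuousLinearMap.norm_map_of_mem_unitary (hWu t),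
      mul_apply_eq_comp]
    refine (ContinuousLinearMap.le_opNorm _ _).trans ?_
    rw [ContinuousLinearMap.norm_map_of_mem_unitary (Unitary.star_mem (hWu t)), norm_tmul]
    exact mul_le_mul_of_nonneg_right (norm_tensorOp_one_le _) (by positivity)
  have key := norm_image_sub_le_of_norm_deriv_le_segment_01'
    (fun t _ => (hderiv t).hasDerivWithinAt) hbound
  have h0 : W 0 = 1 := by
    simp only [W, zero_mul, hT.zero, controlled_const, tensorOp_one]
  have h1 : W 1 = controlled hA (fun i => T (a i)) := by simp only [W, one_mul]
  simp only [G] at key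
  rw [h0, h1, star_one, one_mul, mul_one, ← norm_neg, neg_sub, ← sub_apply] at key
  exact key

end ControlledOperators

/-! ### The swap of two copies of the system. -/

section Swap

variable {ι L : Type} [Fintype ι] [DecidableEq ι] [NormedAddCommGroup L] [InnerProductSpace ℂ L]

/-- The swap of the two copies of `ℂ^ι` in `ℂ^ι ⊗ (ℂ^ι ⊗ L)`. -/
def swap (ι L : Type) [Fintype ι] [DecidableEq ι] [NormedAddCommGroup L] [InnerProductSpace ℂ L] :
    Joint ι (Joint ι L) →L[ℂ] Joint ι (Joint ι L) :=
  ∑ i, ∑ j, tensorOp (Matrix.single i j 1) (tensorOp (Matrix.single j i 1) 1)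

theorem swap_apply (ψ : Joint ι (Joint ι L)) (i j : ι) : swap ι L ψ i j = ψ j i := by
  simp [swap, tensorOp_apply, Matrix.single_apply, _root_.sum_apply, ite_and]

theorem swap_mul_swap : swap ι L * swap ι L = 1 := by
  ext ψ i j
  simp [mul_apply_eq_comp, swap_apply]

theorem swap_conj_tensorOp (B : Matrix ι ι ℂ) :
    swap ι L * tensorOp 1 (tensorOp B 1) * swap ι L = tensorOp B 1 := by
  ext ψ i j
  simp [mul_apply_eq_comp, swap_apply, tensorOp_apply, Matrix.one_apply]

theorem swap_mul_tensorOp_one (X : L →L[ℂ] L) :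
    swap ι L * tensorOp 1 (tensorOp 1 X) = tensorOp 1 (tensorOp 1 X) * swap ι L := by
  ext ψ i j
  simp [mul_apply_eq_comp, swap_apply, tensorOp_apply, Matrix.one_apply]

theorem star_swap [CompleteSpace L] : star (swap ι L) = swap ι L := by
  simp only [swap, clm_star_sum, tensorOp_star, star_one]
  rw [Finset.sum_comm]
  simp [Matrix.star_eq_conjTranspose]

end Swap

/-! ### Self-adjointness of unbounded operators and ampliation. -/

section Unbounded

variable {H : Type} [NormedAddCommGroup H] [InnerProductSpace ℂ H]

theorem inner_self_im_eq_zero_of_symmetric {A : H →ₗ.[ℂ] H}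
    (hsymm : ∀ x y : A.domain, inner ℂ (A x) (y : H) = inner ℂ (x : H) (A y)) (x : A.domain) :
    (inner ℂ (x : H) (A x)).im = 0 := by
  rw [← Complex.conj_eq_iff_im, inner_conj_symm, hsymm]

/-- The basic criterion for self-adjointness. -/
theorem isSelfAdjoint_of_symmetric_of_surjective [CompleteSpace H] {A : H →ₗ.[ℂ] H}
    (hsymm : ∀ x y : A.domain, inner ℂ (A x) (y : H) = inner ℂ (x : H) (A y))
    (hadd : ∀ φ : H, ∃ x : A.domain, A x + Complex.I • (x : H) = φ)
    (hsub : ∀ φ : H, ∃ x : A.domain, A x - Complex.I • (x : H) = φ) : IsSelfAdjoint A := by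
  have hdense : Dense (A.domain : Set H) := by
    rw [Submodule.dense_iff_topologicalClosure_eq_top,
      Submodule.topologicalClosure_eq_top_iff, Submodule.eq_bot_iff]
    intro φ hφ
    -- A vector orthogonal to the domain has the form (A - i) x. Pairing it with x gives ⟨x, A x⟩ -
    -- i‖x‖² = 0 with ⟨x, A x⟩ real, so x = 0.
    obtain ⟨x, rfl⟩ := hsub φ
    have h0 := (Submodule.mem_orthogonal _ _).1 hφ x x.2
    rw [inner_sub_right, inner_smul_right, inner_self_eq_norm_sq_to_K] at h0
    have h1 := congrArg Complex.im h0
    have h2 := inner_self_im_eq_zero_of_symmetric hsymm x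
    have h3 : ‖(x : H)‖ ^ 2 = 0 := by
      have h4 : (Complex.I * ((‖(x : H)‖ : ℂ) ^ 2)).im = ‖(x : H)‖ ^ 2 := by
        rw [Complex.I_mul_im, ← Complex.ofReal_pow, Complex.ofReal_re]
      simp only [Complex.sub_im, Complex.coe_algebraMap, h2, h4, Complex.zero_im] at h1
      linarith
    have h5 : x = 0 := by
      ext; simpa using h3
    simp [h5]
  rw [LinearPMap.isSelfAdjoint_def]
  have hle : A ≤ A.adjoint :=
    LinearPMap.IsFormalAdjoint.le_adjoint hdense (fun x y => hsymm x y)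
  refine (LinearPMap.eq_of_le_of_domain_eq hle (le_antisymm hle.1 fun φ hφ => ?_)).symm
  -- With (A - i) x = (A† - i) φ, the vector φ - x lies in the kernel of A† - i, which is orthogonal
  -- to the range of A + i, that is, to everything.
  obtain ⟨x, hx⟩ := hsub (A.adjoint ⟨φ, hφ⟩ - Complex.I • φ)
  have key : φ - x = 0 := by
    obtain ⟨y, hy⟩ := hadd (φ - x)
    have h1 : inner ℂ (A.adjoint ⟨φ, hφ⟩) (y : H) = inner ℂ φ (A y) :=
      LinearPMap.adjoint_isFormalAdjoint hdense ⟨φ, hφ⟩ y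
    have h2 := hsymm x y
    have h3 : inner ℂ (A x - Complex.I • (x : H)) (y : H)
        = inner ℂ (A.adjoint ⟨φ, hφ⟩ - Complex.I • φ) (y : H) := by rw [hx]
    rw [inner_sub_left, inner_sub_left, inner_smul_left, inner_smul_left, h1, h2] at h3
    rw [← inner_self_eq_zero (𝕜 := ℂ)]
    nth_rewrite 2 [← hy]
    rw [inner_add_right, inner_sub_left, inner_sub_left, inner_smul_right, inner_smul_right]
    simp only [Complex.conj_I] at h3
    linear_combination -h3
  rw [sub_eq_zero.1 key]
  exact x.2

variable {ι : Type}

/-- The operator `1 ⊗ A` for a partially defined operator `A`. -/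
def ampliatePMap (ι : Type) (A : H →ₗ.[ℂ] H) : Joint ι H →ₗ.[ℂ] Joint ι H where
  domain :=
    { carrier := {ψ | ∀ i, ψ i ∈ A.domain}
      add_mem' := fun hφ hψ i => A.domain.add_mem (hφ i) (hψ i)
      zero_mem' := fun _ => A.domain.zero_mem
      smul_mem' := fun c _ hψ i => A.domain.smul_mem c (hψ i) }
  toFun :=
    { toFun := fun ψ => WithLp.toLp 2 fun i => A ⟨ψ.1 i, ψ.2 i⟩
      map_add' := fun φ ψ => by
        ext i
        exact A.map_add ⟨φ.1 i, φ.2 i⟩ ⟨ψ.1 i, ψ.2 i⟩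
      map_smul' := fun c ψ => by
        ext i
        exact A.map_smul c ⟨ψ.1 i, ψ.2 i⟩ }

theorem tmul_mem_ampliatePMap_domain {A : H →ₗ.[ℂ] H} (s : Sys ι) (x : A.domain) :
    tmul s (x : H) ∈ (ampliatePMap ι A).domain := fun i => A.domain.smul_mem (s i) x.2

theorem ampliatePMap_tmul {A : H →ₗ.[ℂ] H} (s : Sys ι) (x : A.domain) :
    ampliatePMap ι A ⟨tmul s (x : H), tmul_mem_ampliatePMap_domain s x⟩ = tmul s (A x) := by
  ext i
  exact A.map_smul (s i) x

theorem isSelfAdjoint_ampliatePMap [Fintype ι] [CompleteSpace H] {A : H →ₗ.[ℂ] H}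
    (hsymm : ∀ x y : A.domain, inner ℂ (A x) (y : H) = inner ℂ (x : H) (A y))
    (hadd : ∀ φ : H, ∃ x : A.domain, A x + Complex.I • (x : H) = φ)
    (hsub : ∀ φ : H, ∃ x : A.domain, A x - Complex.I • (x : H) = φ) :
    IsSelfAdjoint (ampliatePMap ι A) := by
  refine isSelfAdjoint_of_symmetric_of_surjective (fun x y => ?_) (fun φ => ?_) (fun φ => ?_)
  · rw [PiLp.inner_apply, PiLp.inner_apply]
    exact Finset.sum_congr rfl fun i _ => hsymm ⟨x.1 i, x.2 i⟩ ⟨y.1 i, y.2 i⟩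
  · choose x hx using fun i => hadd (φ i)
    refine ⟨⟨WithLp.toLp 2 fun i => (x i : H), fun i => (x i).2⟩, ?_⟩
    ext i
    exact hx i
  · choose x hx using fun i => hsub (φ i)
    refine ⟨⟨WithLp.toLp 2 fun i => (x i : H), fun i => (x i).2⟩, ?_⟩
    ext i
    exact hx i

theorem IsUnitaryRep.ampliate [Fintype ι] [DecidableEq ι] [CompleteSpace H] {T : ℝ → H →L[ℂ] H}
    (hT : IsUnitaryRep T) : IsUnitaryRep fun t => tensorOp (1 : Matrix ι ι ℂ) (T t) where
  unitary t := by
    constructor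
    · rw [tensorOp_star, tensorOp_mul, star_one, mul_one,
        Unitary.star_mul_self_of_mem (hT.unitary t), tensorOp_one]
    · rw [tensorOp_star, tensorOp_mul, star_one, mul_one,
        Unitary.mul_star_self_of_mem (hT.unitary t), tensorOp_one]
  add s t := by rw [tensorOp_mul, mul_one, hT.add]

theorem hasDerivAt_joint [Fintype ι] {F : ℝ → Joint ι H} {F' : Joint ι H} {t : ℝ}
    (h : ∀ i, HasDerivAt (fun t => F t i) (F' i) t) : HasDerivAt F F' t :=
  (((PiLp.continuousLinearEquiv 2 ℂ (fun _ : ι => H)).symm.toContinuousLinearMap.restrictScalars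
    ℝ).hasFDerivAt.comp_hasDerivAt t (hasDerivAt_pi.2 h) :)

theorem IsExpGroup.ampliate [Fintype ι] [DecidableEq ι] [CompleteSpace H] {A : H →ₗ.[ℂ] H}
    {U : ℝ → H →L[ℂ] H} (hU : IsExpGroup A U) :
    IsExpGroup (ampliatePMap ι A) fun t => tensorOp (1 : Matrix ι ι ℂ) (U t) where
  unitary := (IsUnitaryRep.ampliate ⟨hU.unitary, hU.add⟩).unitary
  add := (IsUnitaryRep.ampliate ⟨hU.unitary, hU.add⟩).add
  deriv ψ := by
    refine hasDerivAt_joint fun i => ?_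
    simp only [tensorOp_apply, Matrix.one_apply, ite_smul, one_smul, zero_smul,
      Finset.sum_ite_eq, Finset.mem_univ, if_true]
    exact hU.deriv ⟨ψ.1 i, ψ.2 i⟩

end Unbounded

/-! ### Multiplication and translation on the line. -/

section Line

open MeasureTheory

/-- The Hilbert space `L²(ℝ)`. -/
abbrev LineSpace : Type := Lp ℂ 2 (volume : Measure ℝ)

theorem LineSpace.norm_sq (f : LineSpace) : ‖f‖ ^ 2 = ∫ k, ‖f k‖ ^ 2 := by
  have h := L2.inner_def (𝕜 := ℂ) f f
  simp only [inner_self_eq_norm_sq_to_K] at h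
  have h2 : ((‖f‖ ^ 2 : ℝ) : ℂ) = ((∫ k, ‖f k‖ ^ 2 : ℝ) : ℂ) := by
    rw [← integral_complex_ofReal]
    simpa using h
  exact_mod_cast h2

theorem memLp_mul_of_norm_le_one {u : ℝ → ℂ} (hu : Measurable u) (h : ∀ k, ‖u k‖ ≤ 1)
    (f : LineSpace) : MemLp (fun k => u k * f k) 2 volume := by
  refine (Lp.memLp f).of_le (hu.aestronglyMeasurable.mul (Lp.aestronglyMeasurable f))
    (ae_of_all _ fun k => ?_)
  rw [norm_mul]
  exact mul_le_of_le_one_left (norm_nonneg _) (h k)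

/-- Multiplication by a measurable function bounded by one. -/
def mulOp (u : ℝ → ℂ) (hu : Measurable u) (h : ∀ k, ‖u k‖ ≤ 1) : LineSpace →L[ℂ] LineSpace :=
  LinearMap.mkContinuous
    { toFun := fun f => (memLp_mul_of_norm_le_one hu h f).toLp _
      map_add' := fun f g => by
        rw [← MemLp.toLp_add, MemLp.toLp_eq_toLp_iff]
        filter_upwards [Lp.coeFn_add f g] with k hk
        rw [hk, Pi.add_apply, Pi.add_apply, mul_add]
      map_smul' := fun c f => by
        rw [RingHom.id_apply, ← MemLp.toLp_const_smul, MemLp.toLp_eq_toLp_iff]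
        filter_upwards [Lp.coeFn_smul c f] with k hk
        simp only [hk, Pi.smul_apply, smul_eq_mul]
        ring } 1
    (fun f => by
      rw [one_mul]
      refine Lp.norm_le_norm_of_ae_le ?_
      filter_upwards [MemLp.coeFn_toLp (memLp_mul_of_norm_le_one hu h f)] with k hk
      refine (congrArg norm hk).trans_le ?_
      rw [norm_mul]
      exact mul_le_of_le_one_left (norm_nonneg _) (h k))

theorem coeFn_mulOp (u : ℝ → ℂ) (hu : Measurable u) (h : ∀ k, ‖u k‖ ≤ 1) (f : LineSpace) :
    mulOp u hu h f =ᵐ[volume] fun k => u k * f k :=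
  MemLp.coeFn_toLp (memLp_mul_of_norm_le_one hu h f)

theorem measurable_phase (t : ℝ) : Measurable fun k : ℝ => Complex.exp (-(Complex.I * t) * k) := by
  fun_prop

theorem norm_phase (t k : ℝ) : ‖Complex.exp (-(Complex.I * t) * k)‖ = 1 := by
  rw [Complex.norm_exp]
  simp

/-- Multiplication by `e^{-itk}`. -/
def phaseOp (t : ℝ) : LineSpace →L[ℂ] LineSpace :=
  mulOp _ (measurable_phase t) fun k => (norm_phase t k).le

theorem coeFn_phaseOp (t : ℝ) (f : LineSpace) :
    phaseOp t f =ᵐ[volume] fun k => Complex.exp (-(Complex.I * t) * k) * f k :=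
  coeFn_mulOp _ _ _ f

/-- An isometry satisfies X† X = 1, which forces any right inverse to be X†. -/
theorem mem_unitary_of_norm_map_of_inverse {H : Type} [NormedAddCommGroup H]
    [InnerProductSpace ℂ H] [CompleteSpace H] {X Y : H →L[ℂ] H} (hX : ∀ x, ‖X x‖ = ‖x‖)
    (hXY : X * Y = 1) : X ∈ unitary (H →L[ℂ] H) := by
  have h1 : star X * X = 1 := (ContinuousLinearMap.norm_map_iff_adjoint_comp_self X).1 hX
  have h2 : star X = Y := by
    calc star X = star X * (X * Y) := by rw [hXY, mul_one]
      _ = Y := by rw [← mul_assoc, h1, one_mul]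
  exact ⟨h1, by rw [h2, hXY]⟩

theorem isUnitaryRep_of_norm_map {H : Type} [NormedAddCommGroup H]
    [InnerProductSpace ℂ H] [CompleteSpace H] {T : ℝ → H →L[ℂ] H} (h0 : T 0 = 1)
    (hadd : ∀ s t, T (s + t) = T s * T t) (hnorm : ∀ t x, ‖T t x‖ = ‖x‖) : IsUnitaryRep T where
  unitary t := mem_unitary_of_norm_map_of_inverse (Y := T (-t)) (hnorm t)
    (by rw [← hadd, add_neg_cancel, h0])
  add := hadd

theorem isUnitaryRep_phaseOp : IsUnitaryRep phaseOp := by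
  refine isUnitaryRep_of_norm_map ?_ (fun s t => ?_) (fun t f => ?_)
  · ext f
    filter_upwards [coeFn_phaseOp 0 f] with k hk
    simp [hk]
  · ext f
    filter_upwards [coeFn_phaseOp (s + t) f, coeFn_phaseOp s (phaseOp t f), coeFn_phaseOp t f]
      with k h1 h2 h3
    rw [mul_apply_eq_comp, h1, h2, h3, ← mul_assoc, ← Complex.exp_add]
    congr 2
    push_cast
    ring
  · refine le_antisymm (Lp.norm_le_norm_of_ae_le ?_) (Lp.norm_le_norm_of_ae_le ?_) <;>
    · filter_upwards [coeFn_phaseOp t f] with k hk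
      rw [hk, norm_mul, norm_phase, one_mul]

/-- Translation by `a`. -/
def shiftOp (a : ℝ) : LineSpace →L[ℂ] LineSpace :=
  (Lp.compMeasurePreservingₗᵢ ℂ (fun k : ℝ => k + a)
    (measurePreserving_add_right volume a)).toContinuousLinearMap

theorem coeFn_shiftOp (a : ℝ) (f : LineSpace) : shiftOp a f =ᵐ[volume] fun k => f (k + a) :=
  Lp.coeFn_compMeasurePreserving f (measurePreserving_add_right volume a)

theorem ae_shift {p : ℝ → Prop} (h : ∀ᵐ k, p k) (a : ℝ) : ∀ᵐ k, p (k + a) :=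
  (measurePreserving_add_right volume a).quasiMeasurePreserving.ae h

theorem isUnitaryRep_shiftOp : IsUnitaryRep shiftOp := by
  refine isUnitaryRep_of_norm_map ?_ (fun s t => ?_) (fun t f => LinearIsometry.norm_map _ f)
  · ext f
    filter_upwards [coeFn_shiftOp 0 f] with k hk
    simp [hk]
  · ext f
    filter_upwards [coeFn_shiftOp (s + t) f, coeFn_shiftOp s (shiftOp t f),
      ae_shift (coeFn_shiftOp t f) s] with k h1 h2 h3
    rw [mul_apply_eq_comp, h1, h2, h3, add_assoc]

/-- The Weyl relation. Since the shift sends f(k) to f(k + a), it lowers the charge k by a, and the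
phase records this. -/
theorem phaseOp_mul_shiftOp (g a : ℝ) :
    phaseOp g * shiftOp a = Complex.exp (Complex.I * g * a) • (shiftOp a * phaseOp g) := by
  ext f
  rw [_root_.smul_apply, mul_apply_eq_comp, mul_apply_eq_comp]
  filter_upwards [coeFn_phaseOp g (shiftOp a f), coeFn_shiftOp a f,
    coeFn_shiftOp a (phaseOp g f), ae_shift (coeFn_phaseOp g f) a,
    Lp.coeFn_smul (Complex.exp (Complex.I * g * a)) (shiftOp a (phaseOp g f))] with k h1 h2 h3 h4 h5
  rw [h1, h2, h5, Pi.smul_apply, h3, h4, smul_eq_mul, ← mul_assoc, ← Complex.exp_add]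
  congr 2
  push_cast
  ring

/-- Multiplication by the coordinate, with its maximal domain. -/
def coordOp : LineSpace →ₗ.[ℂ] LineSpace where
  domain :=
    { carrier := {f | MemLp (fun k : ℝ => (k : ℂ) * f k) 2 volume}
      add_mem' := fun {f g} hf hg => (memLp_congr_ae (by
        filter_upwards [Lp.coeFn_add f g] with k hk
        rw [hk, Pi.add_apply, Pi.add_apply, mul_add])).1 (hf.add hg)
      zero_mem' := (memLp_congr_ae (by
        filter_upwards [Lp.coeFn_zero ℂ 2 (volume : Measure ℝ)] with k hk
        rw [hk]
        simp)).1 (MemLp.zero (μ := volume) (p := 2) (ε := ℂ) (α := ℝ))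
      smul_mem' := fun c f hf => (memLp_congr_ae (by
        filter_upwards [Lp.coeFn_smul c f] with k hk
        simp only [hk, Pi.smul_apply, smul_eq_mul]
        ring)).1 (hf.const_smul c) }
  toFun :=
    { toFun := fun f => MemLp.toLp _ f.2
      map_add' := fun f g => by
        rw [← MemLp.toLp_add, MemLp.toLp_eq_toLp_iff]
        filter_upwards [Lp.coeFn_add (f : LineSpace) g] with k hk
        rw [Submodule.coe_add, hk, Pi.add_apply, Pi.add_apply, mul_add]
      map_smul' := fun c f => by
        rw [RingHom.id_apply, ← MemLp.toLp_const_smul, MemLp.toLp_eq_toLp_iff]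
        filter_upwards [Lp.coeFn_smul c (f : LineSpace)] with k hk
        simp only [Submodule.coe_smul, hk, Pi.smul_apply, smul_eq_mul]
        ring }

theorem mem_coordOp_domain {f : LineSpace} :
    f ∈ coordOp.domain ↔ MemLp (fun k : ℝ => (k : ℂ) * f k) 2 volume := Iff.rfl

theorem coeFn_coordOp (f : coordOp.domain) :
    coordOp f =ᵐ[volume] fun k => (k : ℂ) * (f : LineSpace) k :=
  MemLp.coeFn_toLp (mem_coordOp_domain.1 f.2)

theorem coordOp_symmetric (f g : coordOp.domain) :
    inner ℂ (coordOp f) (g : LineSpace) = inner ℂ (f : LineSpace) (coordOp g) := by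
  rw [L2.inner_def, L2.inner_def]
  refine integral_congr_ae ?_
  filter_upwards [coeFn_coordOp f, coeFn_coordOp g] with k h1 h2
  rw [h1, h2]
  simp only [RCLike.inner_apply, map_mul, Complex.conj_ofReal]
  ring

/-- The resolvent equation for the coordinate operator at `±i`. -/
theorem coordOp_add_smul_surjective {c : ℂ} (hre : c.re = 0) (him : |c.im| = 1) (φ : LineSpace) :
    ∃ f : coordOp.domain, coordOp f + c • (f : LineSpace) = φ := by
  have hn : ∀ k : ℝ, ‖(k : ℂ) + c‖ ^ 2 = k ^ 2 + 1 := by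
    intro k
    rw [← Complex.normSq_eq_norm_sq, Complex.normSq_apply, Complex.add_re, Complex.add_im, hre,
      Complex.ofReal_re, Complex.ofReal_im, zero_add, add_zero, ← sq, ← sq, ← sq_abs c.im, him,
      one_pow]
  have hpos : ∀ k : ℝ, 0 < ‖(k : ℂ) + c‖ := fun k => by
    have h := hn k
    by_contra h0
    have h1 : ‖(k : ℂ) + c‖ = 0 := le_antisymm (not_lt.1 h0) (norm_nonneg _)
    rw [h1] at h
    nlinarith [sq_nonneg k]
  have hu : Measurable fun k : ℝ => ((k : ℂ) + c)⁻¹ := by fun_prop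
  have hv : Measurable fun k : ℝ => (k : ℂ) * ((k : ℂ) + c)⁻¹ := by fun_prop
  have hu1 : ∀ k : ℝ, ‖((k : ℂ) + c)⁻¹‖ ≤ 1 := by
    intro k
    rw [norm_inv]
    refine inv_le_one_of_one_le₀ ?_
    exact (one_le_sq_iff₀ (norm_nonneg _)).1 (by rw [hn]; nlinarith [sq_nonneg k])
  have hv1 : ∀ k : ℝ, ‖(k : ℂ) * ((k : ℂ) + c)⁻¹‖ ≤ 1 := by
    intro k
    rw [norm_mul, norm_inv, ← div_eq_mul_inv, div_le_one (hpos k), Complex.norm_real]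
    refine (sq_le_sq₀ (norm_nonneg _) (norm_nonneg _)).1 ?_
    rw [hn, Real.norm_eq_abs, sq_abs]
    linarith
  have hf : mulOp _ hu hu1 φ ∈ coordOp.domain := by
    rw [mem_coordOp_domain]
    refine (memLp_congr_ae ?_).1 (memLp_mul_of_norm_le_one hv hv1 φ)
    filter_upwards [coeFn_mulOp _ hu hu1 φ] with k hk
    rw [hk, mul_assoc]
  refine ⟨⟨_, hf⟩, ?_⟩
  ext
  filter_upwards [Lp.coeFn_add (coordOp ⟨_, hf⟩) (c • mulOp _ hu hu1 φ),
    coeFn_coordOp ⟨_, hf⟩, Lp.coeFn_smul c (mulOp _ hu hu1 φ), coeFn_mulOp _ hu hu1 φ]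
    with k h1 h2 h3 h4
  have hne : (k : ℂ) + c ≠ 0 := norm_pos_iff.1 (hpos k)
  rw [h1, Pi.add_apply, h2, h3, Pi.smul_apply]
  simp only [h4, smul_eq_mul]
  field_simp

/-- Dominated convergence: (e^{-itk} - 1)/t + ik is bounded by 2|k| for all t ≠ 0, and k f(k) is
square integrable exactly because f is in the domain. The squared norm is treated first and the root
taken at the end. -/
theorem isExpGroup_coordOp : IsExpGroup coordOp phaseOp where
  unitary := isUnitaryRep_phaseOp.unitary
  add := isUnitaryRep_phaseOp.add
  deriv f := by
    refine hasDerivAt_iff_tendsto_slope_zero.2 (tendsto_iff_norm_sub_tendsto_zero.2 ?_)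
    have hsq : Filter.Tendsto (fun t : ℝ => ‖t⁻¹ • (phaseOp (0 + t) (f : LineSpace)
        - phaseOp 0 (f : LineSpace)) - -(Complex.I • coordOp f)‖ ^ 2) (𝓝[≠] 0) (𝓝 0) := by
      have hform : ∀ t : ℝ, ‖t⁻¹ • (phaseOp (0 + t) (f : LineSpace)
          - phaseOp 0 (f : LineSpace)) - -(Complex.I • coordOp f)‖ ^ 2
          = ∫ k : ℝ, ‖((t : ℂ)⁻¹ * (Complex.exp (-(Complex.I * t) * k) - 1) + Complex.I * k)
            * (f : LineSpace) k‖ ^ 2 := by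
        intro t
        rw [LineSpace.norm_sq]
        refine integral_congr_ae ?_
        rw [zero_add, isUnitaryRep_phaseOp.zero, one_apply_eq_self, sub_neg_eq_add]
        filter_upwards [Lp.coeFn_add (t⁻¹ • (phaseOp t (f : LineSpace) - (f : LineSpace)))
          (Complex.I • coordOp f), Lp.coeFn_smul t⁻¹ (phaseOp t (f : LineSpace) - (f : LineSpace)),
          Lp.coeFn_sub (phaseOp t (f : LineSpace)) (f : LineSpace), coeFn_phaseOp t f,
          Lp.coeFn_smul Complex.I (coordOp f), coeFn_coordOp f] with k h1 h2 h3 h4 h5 h6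
        rw [h1, Pi.add_apply, h2, Pi.smul_apply, h3, Pi.sub_apply, h4, h5, Pi.smul_apply, h6]
        congr 2
        rw [Complex.real_smul, smul_eq_mul]
        push_cast
        ring
      simp only [hform]
      have hint : Integrable (fun k : ℝ => (2 * ‖(k : ℂ) * (f : LineSpace) k‖) ^ 2) := by
        have h := ((memLp_two_iff_integrable_sq_norm (mem_coordOp_domain.1 f.2).1).1
          (mem_coordOp_domain.1 f.2)).const_mul 4
        refine h.congr (ae_of_all _ fun k => ?_)
        simp only
        ring
      have hbound : ∀ (t k : ℝ), t ≠ 0 →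
          ‖(t : ℂ)⁻¹ * (Complex.exp (-(Complex.I * t) * k) - 1) + Complex.I * k‖ ≤ 2 * |k| := by
        intro t k ht
        have h1 : ‖Complex.exp (-(Complex.I * t) * k) - 1‖ ≤ |t| * |k| := by
          have h := Real.norm_exp_I_mul_ofReal_sub_one_le (x := -(t * k))
          rw [norm_neg, Real.norm_eq_abs, abs_mul] at h
          convert! h using 4
          push_cast
          ring
        refine (norm_add_le _ _).trans ?_
        rw [norm_mul, norm_mul, norm_inv, Complex.norm_real, Complex.norm_real, Complex.norm_I,
          one_mul, Real.norm_eq_abs, Real.norm_eq_abs]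
        have h2 : |t|⁻¹ * ‖Complex.exp (-(Complex.I * t) * k) - 1‖ ≤ |k| := by
          rw [inv_mul_le_iff₀ (abs_pos.2 ht)]
          exact h1
        linarith
      have key := tendsto_integral_filter_of_dominated_convergence (l := 𝓝[≠] (0 : ℝ))
        (μ := (volume : Measure ℝ)) (f := fun _ => (0 : ℝ))
        (F := fun (t k : ℝ) => ‖((t : ℂ)⁻¹ * (Complex.exp (-(Complex.I * t) * k) - 1)
          + Complex.I * k) * (f : LineSpace) k‖ ^ 2) _ ?_ ?_ hint ?_
      · simpa using key
      · refine Filter.Eventually.of_forall fun t => ?_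
        have hm : Measurable fun k : ℝ =>
          (t : ℂ)⁻¹ * (Complex.exp (-(Complex.I * t) * k) - 1) + Complex.I * k := by fun_prop
        exact ((hm.aestronglyMeasurable.mul (Lp.aestronglyMeasurable _)).norm.pow 2)
      · filter_upwards [self_mem_nhdsWithin] with t ht
        refine ae_of_all _ fun k => ?_
        rw [Real.norm_eq_abs, abs_of_nonneg (by positivity), norm_mul, norm_mul,
          Complex.norm_real, Real.norm_eq_abs, ← mul_assoc]
        gcongr
        exact hbound t k ht
      · refine ae_of_all _ fun k => ?_
        have hd : HasDerivAt (fun t : ℝ => Complex.exp (-(Complex.I * t) * k))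
            (-(Complex.I * k)) 0 := by
          have h1 : HasDerivAt (fun t : ℝ => -(Complex.I * t) * k) (-(Complex.I * k)) 0 := by
            have h2 := ((Complex.ofRealCLM.hasDerivAt (x := 0)).const_mul (-(Complex.I * k)))
            convert! h2 using 1
            · ext t
              simp only [Complex.ofRealCLM_apply]
              ring
            · simp
          simpa using h1.cexp
        rw [hasDerivAt_iff_tendsto_slope_zero] at hd
        have h3 := (((hd.add_const (Complex.I * k)).mul_const ((f : LineSpace) k)).norm.pow 2)
        simp only [neg_add_cancel, zero_mul, norm_zero, ne_eq, OfNat.ofNat_ne_zero,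
          not_false_eq_true, zero_pow] at h3
        refine h3.congr fun t => ?_
        simp [Complex.real_smul]
    have h := (Real.continuous_sqrt.tendsto 0).comp hsq
    simpa [Function.comp_def, Real.sqrt_sq] using h

end Line

/-! ### Gaussian frame vectors. -/

section Gaussian

open MeasureTheory ProbabilityTheory
open scoped NNReal

theorem integral_gaussianPDFReal_mul_id (m : ℝ) {v : ℝ≥0} (hv : v ≠ 0) :
    ∫ k, gaussianPDFReal m v k * k = m := by
  have h := integral_gaussianReal_eq_integral_smul (μ := m) (f := fun x : ℝ => x) hv
  rw [integral_id_gaussianReal] at h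
  exact h.symm

theorem integral_gaussianPDFReal_mul_sq {v : ℝ≥0} (hv : v ≠ 0) :
    ∫ k, gaussianPDFReal 0 v k * k ^ 2 = v := by
  have h := integral_gaussianReal_eq_integral_smul (μ := 0) (f := fun x : ℝ => x ^ 2) hv
  have h2 := variance_id_gaussianReal (μ := 0) (v := v)
  rw [variance_eq_integral aemeasurable_id] at h2
  simp only [id_eq, integral_id_gaussianReal, sub_zero] at h2
  rw [h2] at h
  exact h.symm

theorem integrable_gaussianPDFReal_mul_sq {v : ℝ≥0} (hv : v ≠ 0) :
    Integrable fun k => gaussianPDFReal 0 v k * k ^ 2 := by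
  have h := (memLp_id_gaussianReal (μ := 0) (v := v) 2).integrable_sq
  rw [gaussianReal_of_var_ne_zero _ hv, integrable_withDensity_iff (measurable_gaussianPDF 0 v)
    (ae_of_all _ fun _ => gaussianPDF_lt_top)] at h
  refine h.congr (ae_of_all _ fun k => ?_)
  simp only [toReal_gaussianPDF, id_eq]
  ring

/-- The square root of the centred Gaussian density of variance `v`. -/
def gaussFun (v : ℝ≥0) (k : ℝ) : ℝ := Real.sqrt (gaussianPDFReal 0 v k)

/-- Completing the square, (k + h)² + k² = 2 (k + h/2)² + h²/2. Overlaps of a Gaussian vector with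
its translates thus become moments of a Gaussian density centred at -h/2. -/
theorem gaussFun_shift_mul (v : ℝ≥0) (h k : ℝ) :
    gaussFun v (k + h) * gaussFun v k
      = Real.exp (-(h ^ 2 / (8 * v))) * gaussianPDFReal (-(h / 2)) v k := by
  rw [gaussFun, gaussFun, ← Real.sqrt_mul (gaussianPDFReal_nonneg _ _ _)]
  rw [Real.sqrt_eq_iff_mul_self_eq
    (mul_nonneg (gaussianPDFReal_nonneg _ _ _) (gaussianPDFReal_nonneg _ _ _))
    (mul_nonneg (Real.exp_pos _).le (gaussianPDFReal_nonneg _ _ _))]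
  simp only [gaussianPDFReal]
  set c := (√(2 * Real.pi * v))⁻¹
  have key : Real.exp (-(k + h - 0) ^ 2 / (2 * v)) * Real.exp (-(k - 0) ^ 2 / (2 * v))
      = (Real.exp (-(h ^ 2 / (8 * v))) * Real.exp (-(k - -(h / 2)) ^ 2 / (2 * v)))
        * (Real.exp (-(h ^ 2 / (8 * v))) * Real.exp (-(k - -(h / 2)) ^ 2 / (2 * v))) := by
    simp only [← Real.exp_add]
    congr 1
    ring
  linear_combination c ^ 2 * key

theorem memLp_gaussFun (v : ℝ≥0) : MemLp (fun k => (gaussFun v k : ℂ)) 2 volume := by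
  have hm : AEStronglyMeasurable (fun k => (gaussFun v k : ℂ)) volume :=
    (Complex.measurable_ofReal.comp
      (measurable_gaussianPDFReal 0 v).sqrt).aestronglyMeasurable
  refine (memLp_two_iff_integrable_sq_norm hm).2 ?_
  refine (integrable_gaussianPDFReal 0 v).congr (ae_of_all _ fun k => ?_)
  simp only [Complex.norm_real, Real.norm_eq_abs, sq_abs, gaussFun]
  exact (Real.sq_sqrt (gaussianPDFReal_nonneg _ _ _)).symm

/-- The minimal uncertainty state with momentum variance `v`. -/
def gaussVec (v : ℝ≥0) : LineSpace := (memLp_gaussFun v).toLp _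

theorem coeFn_gaussVec (v : ℝ≥0) : gaussVec v =ᵐ[volume] fun k => (gaussFun v k : ℂ) :=
  MemLp.coeFn_toLp _

theorem inner_shiftOp_gaussVec {v : ℝ≥0} (hv : v ≠ 0) (h : ℝ) :
    inner ℂ (shiftOp h (gaussVec v)) (gaussVec v) = (Real.exp (-(h ^ 2 / (8 * v))) : ℂ) := by
  rw [L2.inner_def]
  calc _ = ∫ k, ((Real.exp (-(h ^ 2 / (8 * v))) * gaussianPDFReal (-(h / 2)) v k : ℝ) : ℂ) := by
        refine integral_congr_ae ?_
        filter_upwards [coeFn_shiftOp h (gaussVec v), coeFn_gaussVec v,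
          ae_shift (coeFn_gaussVec v) h] with k h1 h2 h3
        rw [h1, h2, h3, ← gaussFun_shift_mul, RCLike.inner_apply, Complex.conj_ofReal, mul_comm]
        push_cast
        rfl
    _ = _ := by
        rw [integral_complex_ofReal, integral_const_mul, integral_gaussianPDFReal_eq_one _ hv,
          mul_one]

theorem gaussVec_mem_domain {v : ℝ≥0} (hv : v ≠ 0) : gaussVec v ∈ coordOp.domain := by
  rw [mem_coordOp_domain]
  have hm : AEStronglyMeasurable (fun k : ℝ => (k : ℂ) * gaussVec v k) volume :=
    Complex.measurable_ofReal.aestronglyMeasurable.mul (Lp.aestronglyMeasurable _)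
  refine (memLp_two_iff_integrable_sq_norm hm).2 ?_
  refine (integrable_gaussianPDFReal_mul_sq hv).congr ?_
  filter_upwards [coeFn_gaussVec v] with k hk
  rw [hk, norm_mul, Complex.norm_real, Complex.norm_real, mul_pow, Real.norm_eq_abs,
    Real.norm_eq_abs, sq_abs, sq_abs, gaussFun, Real.sq_sqrt (gaussianPDFReal_nonneg _ _ _),
    mul_comm]

theorem inner_shiftOp_coordOp_gaussVec {v : ℝ≥0} (hv : v ≠ 0) (h : ℝ) :
    inner ℂ (shiftOp h (gaussVec v)) (coordOp ⟨gaussVec v, gaussVec_mem_domain hv⟩)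
      = (Real.exp (-(h ^ 2 / (8 * v))) * (-(h / 2)) : ℝ) := by
  rw [L2.inner_def]
  calc _ = ∫ k, ((Real.exp (-(h ^ 2 / (8 * v))) * (gaussianPDFReal (-(h / 2)) v k * k) : ℝ) : ℂ) := by
        refine integral_congr_ae ?_
        filter_upwards [coeFn_shiftOp h (gaussVec v), coeFn_gaussVec v,
          ae_shift (coeFn_gaussVec v) h, coeFn_coordOp ⟨gaussVec v, gaussVec_mem_domain hv⟩]
          with k h1 h2 h3 h4
        rw [h1, h4, h3, ← mul_assoc, ← gaussFun_shift_mul, RCLike.inner_apply, Complex.conj_ofReal]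
        simp only [h2]
        push_cast
        ring
    _ = _ := by
        rw [integral_complex_ofReal, integral_const_mul, integral_gaussianPDFReal_mul_id _ hv]

theorem norm_gaussVec {v : ℝ≥0} (hv : v ≠ 0) : ‖gaussVec v‖ = 1 := by
  have h := inner_shiftOp_gaussVec hv 0
  rw [isUnitaryRep_shiftOp.zero, one_apply_eq_self, inner_self_eq_norm_sq_to_K] at h
  have h2 : ‖gaussVec v‖ ^ 2 = 1 := by
    simp only [ne_eq, OfNat.ofNat_ne_zero, not_false_eq_true, zero_pow, zero_div, neg_zero,
      Real.exp_zero] at h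
    exact Complex.ofReal_injective (by simpa using h)
  nlinarith [norm_nonneg (gaussVec v)]

theorem norm_sq_coordOp_gaussVec {v : ℝ≥0} (hv : v ≠ 0) :
    ‖coordOp ⟨gaussVec v, gaussVec_mem_domain hv⟩‖ ^ 2 = v := by
  rw [LineSpace.norm_sq, ← integral_gaussianPDFReal_mul_sq hv]
  refine integral_congr_ae ?_
  filter_upwards [coeFn_gaussVec v, coeFn_coordOp ⟨gaussVec v, gaussVec_mem_domain hv⟩] with k h1 h2
  rw [h2]
  simp only [h1]
  rw [norm_mul, Complex.norm_real, Complex.norm_real, mul_pow, Real.norm_eq_abs,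
    Real.norm_eq_abs, sq_abs, sq_abs, gaussFun, Real.sq_sqrt (gaussianPDFReal_nonneg _ _ _),
    mul_comm]

/-- The square root of the density has derivative -k/(2v) times itself. The remainder is controlled
without any pointwise Taylor expansion: its squared norm is expanded into inner products of the
vector, its translate and its image under the coordinate, all of which are known in closed form. -/
theorem norm_shiftOp_gaussVec_sub_le {v : ℝ≥0} (hv : v ≠ 0) (h : ℝ) :
    ‖shiftOp h (gaussVec v) - gaussVec v - h • (-((1 / (2 * v : ℝ)) •
      coordOp ⟨gaussVec v, gaussVec_mem_domain hv⟩))‖ ≤ h ^ 2 / (4 * v) := by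
  set x := shiftOp h (gaussVec v)
  set y := gaussVec v with hy
  set z := coordOp ⟨gaussVec v, gaussVec_mem_domain hv⟩
  have hv0 : (0 : ℝ) < v := by positivity
  set e := Real.exp (-(h ^ 2 / (8 * v))) with he
  have hx1 : ‖x‖ ^ 2 = 1 := by
    rw [ContinuousLinearMap.norm_map_of_mem_unitary (isUnitaryRep_shiftOp.unitary h),
      norm_gaussVec hv, one_pow]
  have hy1 : ‖y‖ ^ 2 = 1 := by rw [norm_gaussVec hv, one_pow]
  have hz1 : ‖z‖ ^ 2 = v := norm_sq_coordOp_gaussVec hv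
  have hxy : (inner ℂ x y).re = e := by
    rw [inner_shiftOp_gaussVec hv h, Complex.ofReal_re]
  have hxz : (inner ℂ x z).re = e * (-(h / 2)) := by
    rw [inner_shiftOp_coordOp_gaussVec hv h, Complex.ofReal_re]
  have hyz : (inner ℂ y z).re = 0 := by
    have h0 := inner_shiftOp_coordOp_gaussVec hv 0
    rw [isUnitaryRep_shiftOp.zero, one_apply_eq_self] at h0
    rw [h0, Complex.ofReal_re]
    simp
  have hsq : ‖x - y - h • (-((1 / (2 * v : ℝ)) • z))‖ ^ 2
      = 2 + 2 * (h ^ 2 / (8 * v)) - 2 * e - 4 * (h ^ 2 / (8 * v)) * e := by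
    have e1 : x - y - h • (-((1 / (2 * v : ℝ)) • z)) = (x - y) + ((h / (2 * v) : ℝ) : ℂ) • z := by
      rw [smul_neg, sub_neg_eq_add, smul_smul, mul_one_div]
      rfl
    have e2 := norm_add_sq (𝕜 := ℂ) (x - y) (((h / (2 * v) : ℝ) : ℂ) • z)
    have e3 := norm_sub_sq (𝕜 := ℂ) x y
    rw [e1, e2, e3, norm_smul, mul_pow, hx1, hy1, hz1, inner_smul_right, inner_sub_left]
    simp only [RCLike.re_to_complex, Complex.re_ofReal_mul, Complex.sub_re, hxy, hxz, hyz,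
      Complex.norm_real, Real.norm_eq_abs, sq_abs]
    field_simp
    ring
  refine (sq_le_sq₀ (norm_nonneg _) (by positivity)).1 ?_
  -- With u = h²/(8v) and e ≥ 1 - u, the squared norm is at most 2 + 2u - (2 + 4u)(1 - u) = (2u)².
  rw [hsq]
  have hu : 0 ≤ h ^ 2 / (8 * v) := by positivity
  have hle : 1 - h ^ 2 / (8 * v) ≤ e := by
    have := Real.add_one_le_exp (-(h ^ 2 / (8 * v)))
    linarith
  have hu2 : h ^ 2 / (4 * v) = 2 * (h ^ 2 / (8 * v)) := by field_simp; ring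
  rw [hu2]
  nlinarith [mul_le_mul_of_nonneg_left hle hu]

theorem hasDerivAt_shiftOp_gaussVec {v : ℝ≥0} (hv : v ≠ 0) :
    HasDerivAt (fun h => shiftOp h (gaussVec v))
      (-((1 / (2 * v : ℝ)) • coordOp ⟨gaussVec v, gaussVec_mem_domain hv⟩)) 0 := by
  refine hasDerivAt_iff_isLittleO_nhds_zero.2 ?_
  have hO : (fun h : ℝ => shiftOp (0 + h) (gaussVec v) - shiftOp 0 (gaussVec v)
      - h • (-((1 / (2 * v : ℝ)) • coordOp ⟨gaussVec v, gaussVec_mem_domain hv⟩)))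
      =O[𝓝 0] fun h : ℝ => h ^ 2 := by
    refine Asymptotics.IsBigO.of_bound (1 / (4 * v)) (Filter.Eventually.of_forall fun h => ?_)
    rw [zero_add, isUnitaryRep_shiftOp.zero, one_apply_eq_self]
    refine (norm_shiftOp_gaussVec_sub_le hv h).trans (le_of_eq ?_)
    rw [Real.norm_eq_abs, abs_of_nonneg (sq_nonneg h)]
    ring
  refine hO.trans_isLittleO ?_
  simpa using Asymptotics.isLittleO_pow_pow (𝕜 := ℝ) (m := 1) (n := 2) (by norm_num)

/-- Minimal uncertainty: the product of this norm with the standard deviation √v of the charge is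
1/2, which is what makes the constant in the upper bound on the cost match the lower one. -/
theorem norm_deriv_shiftOp_gaussVec {v : ℝ≥0} (hv : v ≠ 0) :
    ‖-((1 / (2 * v : ℝ)) • coordOp ⟨gaussVec v, gaussVec_mem_domain hv⟩)‖
      = 1 / (2 * Real.sqrt v) := by
  have hv0 : (0 : ℝ) < v := by positivity
  have h1 : ‖coordOp ⟨gaussVec v, gaussVec_mem_domain hv⟩‖ = Real.sqrt v := by
    rw [← norm_sq_coordOp_gaussVec hv, Real.sqrt_sq (norm_nonneg _)]
  rw [norm_neg, norm_smul, h1, Real.norm_of_nonneg (by positivity)]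
  have h2 := Real.mul_self_sqrt hv0.le
  have h3 : 0 < Real.sqrt v := Real.sqrt_pos.2 hv0
  rw [div_mul_eq_mul_div, one_mul, div_eq_div_iff (by positivity) (by positivity)]
  linear_combination 2 * h2

end Gaussian

/-! ### Pure states and their skew information. -/

section States

variable {H : Type} [NormedAddCommGroup H] [InnerProductSpace ℂ H]

theorem hasSum_norm_sq_inner {κ : Type} (b : HilbertBasis κ ℂ H) (x : H) :
    HasSum (fun j => ‖inner ℂ (b j) x‖ ^ 2) (‖x‖ ^ 2) := by
  have h := (b.hasSum_inner_mul_inner x x).mapL Complex.reCLM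
  convert! h using 1
  · ext j
    rw [← inner_conj_symm x (b j), Complex.reCLM_apply, mul_comm, Complex.mul_conj,
      Complex.ofReal_re, Complex.normSq_eq_norm_sq]
  · rw [Complex.reCLM_apply]
    exact (inner_self_eq_norm_sq (𝕜 := ℂ) x).symm

theorem tsum_ofReal_norm_sq_inner {κ : Type} (b : HilbertBasis κ ℂ H) (x : H) :
    ∑' j, ENNReal.ofReal (‖inner ℂ (b j) x‖ ^ 2) = ENNReal.ofReal (‖x‖ ^ 2) := by
  rw [← (hasSum_norm_sq_inner b x).tsum_eq,
    ENNReal.ofReal_tsum_of_nonneg (fun _ => sq_nonneg _) (hasSum_norm_sq_inner b x).summable]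

/-- The state `ρ` is the projection onto its `k`-th eigenvector. -/
structure State.IsPureAt (ρ : State H) (k : ρ.idx) : Prop where
  one : ρ.prob k = 1
  zero : ∀ j, j ≠ k → ρ.prob j = 0

/-- A state is presented by a full orthonormal eigenbasis, so the unit vector has to be completed to
a Hilbert basis. -/
theorem exists_isPureAt [CompleteSpace H] {φ : H} (hφ : ‖φ‖ = 1) :
    ∃ (ρ : State H) (k : ρ.idx), ρ.basis k = φ ∧ ρ.IsPureAt k := by
  classical
  have ho : Orthonormal ℂ ((↑) : ({φ} : Set H) → H) := by
    constructor
    · rintro ⟨x, hx⟩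
      change ‖x‖ = 1
      rw [Set.mem_singleton_iff.1 hx, hφ]
    · rintro ⟨x, hx⟩ ⟨y, hy⟩ hxy
      exact absurd (Subtype.ext ((Set.mem_singleton_iff.1 hx).trans
        (Set.mem_singleton_iff.1 hy).symm)) hxy
  obtain ⟨w, b, hw, hb⟩ := ho.exists_hilbertBasis_extension
  let k : w := ⟨φ, hw rfl⟩
  refine ⟨⟨w, b, Pi.single k 1, fun j => ?_, ?_⟩, k, ?_, ?_, fun j hj => ?_⟩
  · by_cases h : j = k
    · subst h; simp
    · simp [h]
  · exact hasSum_pi_single k 1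
  · simp [hb, k]
  · simp
  · simp [hj]

theorem matrixElement_of_right_mem {A : H →ₗ.[ℂ] H} (x : H) (y : A.domain) :
    matrixElement A x (y : H) = inner ℂ x (A y) := by
  simp [matrixElement]

theorem matrixElement_of_left_mem {A : H →ₗ.[ℂ] H}
    (hsymm : ∀ x y : A.domain, inner ℂ (A x) (y : H) = inner ℂ (x : H) (A y)) (x : A.domain)
    (y : H) : matrixElement A (x : H) y = inner ℂ (A x) y := by
  by_cases hy : y ∈ A.domain
  · rw [matrixElement_of_right_mem (x : H) (⟨y, hy⟩ : A.domain), ← hsymm]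
  · simp [matrixElement, hy]

/-- For a pure state the skew information is at most the variance. -/
theorem skewInfo_le_of_isPureAt {f : ℝ → ℝ} (hf : 0 ≤ f 0) {ρ : State H} {k : ρ.idx}
    (hρ : ρ.IsPureAt k) {A : H →ₗ.[ℂ] H}
    (hsymm : ∀ x y : A.domain, inner ℂ (A x) (y : H) = inner ℂ (x : H) (A y))
    (x : A.domain) (hx : ρ.basis k = x) :
    skewInfo f ρ A ≤ ENNReal.ofReal (‖A x‖ ^ 2 - ‖inner ℂ (x : H) (A x)‖ ^ 2) := by
  classical
  rw [skewInfo, if_pos]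
  swap
  · intro j hj
    have : j = k := by
      by_contra h
      exact hj (hρ.zero j h)
    rw [this, hx]
    exact x.2
  rcases hf.eq_or_lt with h0 | h0
  · simp [← h0]
  set g : ρ.idx → ℝ≥0∞ := fun j =>
    if j = k then 0 else ENNReal.ofReal (‖inner ℂ (ρ.basis j) (A x)‖ ^ 2) with hg
  -- Only pairs with exactly one index equal to k survive; for them (p_i - p_j)² = 1 and the mean is
  -- f 0 in either order. The two orders give the factor 2 that cancels the 1/2 in f(0)/2.
  have hterm : ∀ i j, ENNReal.ofReal ((ρ.prob i - ρ.prob j) ^ 2 / fMean f (ρ.prob i) (ρ.prob j)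
      * ‖matrixElement A (ρ.basis i) (ρ.basis j)‖ ^ 2)
      = ENNReal.ofReal (1 / f 0) * ((if i = k then g j else 0) + if j = k then g i else 0) := by
    intro i j
    by_cases hi : i = k <;> by_cases hj : j = k
    · simp [hi, hj, hg]
    · rw [hi, hx, matrixElement_of_left_mem hsymm, norm_inner_symm, hρ.one, hρ.zero j hj]
      simp [hg, hj, fMean, ENNReal.ofReal_mul (inv_nonneg.2 h0.le)]
    · rw [hj, hx, matrixElement_of_right_mem, hρ.one, hρ.zero i hi]
      simp [hg, hi, fMean, ENNReal.ofReal_mul (inv_nonneg.2 h0.le)]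
    · simp [hi, hj, hρ.zero i hi, hρ.zero j hj]
  have hsum : ∑' j, g j = ENNReal.ofReal (‖A x‖ ^ 2 - ‖inner ℂ (x : H) (A x)‖ ^ 2) := by
    have h1 := tsum_ofReal_norm_sq_inner ρ.basis (A x)
    rw [ENNReal.tsum_eq_add_tsum_ite k, hx] at h1
    rw [ENNReal.ofReal_sub _ (sq_nonneg _), ← h1,
      ENNReal.add_sub_cancel_left ENNReal.ofReal_ne_top]
  simp only [hterm, ENNReal.tsum_mul_left, ENNReal.tsum_add, tsum_ite_eq]
  have h2 : ∑' i, ∑' j, (if i = k then g j else 0) = ∑' j, g j := by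
    rw [tsum_eq_single k]
    · simp
    · intro i hi
      simp [hi]
  rw [h2, hsum, ← two_mul, ← mul_assoc, ← mul_assoc]
  have h3 : ENNReal.ofReal (f 0 / 2) * ENNReal.ofReal (1 / f 0) * 2 = 1 := by
    rw [← ENNReal.ofReal_mul (by positivity), ← ENNReal.ofReal_ofNat,
      ← ENNReal.ofReal_mul (by positivity), ← ENNReal.ofReal_one]
    congr 1
    field_simp
  rw [h3, one_mul]

end States

/-! ### Expectations in product states. -/

section Expectation

variable {ι E : Type} [Fintype ι] [NormedAddCommGroup E] [InnerProductSpace ℂ E]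

theorem hasSum_prob_mul (ρ : State (Sys ι)) (σ : State E) :
    HasSum (fun x : ρ.idx × σ.idx => ρ.prob x.1 * σ.prob x.2) 1 := by
  have h := ρ.prob_sum.mul σ.prob_sum
    (ρ.prob_sum.summable.mul_of_nonneg σ.prob_sum.summable ρ.prob_nonneg σ.prob_nonneg)
  simpa using h

theorem norm_tmul_basis (ρ : State (Sys ι)) (σ : State E) (x : ρ.idx × σ.idx) :
    ‖tmul (ρ.basis x.1) (σ.basis x.2)‖ = 1 := by
  rw [norm_tmul, ρ.basis.orthonormal.1, σ.basis.orthonormal.1, one_mul]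

theorem norm_inner_tmul_basis_le (ρ : State (Sys ι)) (σ : State E)
    (X : Joint ι E →L[ℂ] Joint ι E) (x : ρ.idx × σ.idx) :
    ‖inner ℂ (tmul (ρ.basis x.1) (σ.basis x.2)) (X (tmul (ρ.basis x.1) (σ.basis x.2)))‖
      ≤ ‖X‖ := by
  refine (norm_inner_le_norm _ _).trans ?_
  rw [norm_tmul_basis, one_mul]
  refine (X.le_opNorm _).trans ?_
  rw [norm_tmul_basis, mul_one]

theorem hasSum_expectProd (ρ : State (Sys ι)) (σ : State E) (X : Joint ι E →L[ℂ] Joint ι E) :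
    HasSum (fun x : ρ.idx × σ.idx => ((ρ.prob x.1 * σ.prob x.2 : ℝ) : ℂ) *
      inner ℂ (tmul (ρ.basis x.1) (σ.basis x.2)) (X (tmul (ρ.basis x.1) (σ.basis x.2))))
      (expectProd ρ σ X) := by
  refine Summable.hasSum (Summable.of_norm_bounded
    ((hasSum_prob_mul ρ σ).summable.mul_right ‖X‖) fun x => ?_)
  rw [norm_mul, Complex.norm_real, Real.norm_of_nonneg
    (mul_nonneg (ρ.prob_nonneg _) (σ.prob_nonneg _))]
  exact mul_le_mul_of_nonneg_left (norm_inner_tmul_basis_le ρ σ X x)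
    (mul_nonneg (ρ.prob_nonneg _) (σ.prob_nonneg _))

theorem hasSum_expectProd_re (ρ : State (Sys ι)) (σ : State E) (X : Joint ι E →L[ℂ] Joint ι E) :
    HasSum (fun x : ρ.idx × σ.idx => (ρ.prob x.1 * σ.prob x.2) *
      (inner ℂ (tmul (ρ.basis x.1) (σ.basis x.2)) (X (tmul (ρ.basis x.1) (σ.basis x.2)))).re)
      (expectProd ρ σ X).re := by
  have h := (hasSum_expectProd ρ σ X).mapL Complex.reCLM
  simpa only [Complex.reCLM_apply, Complex.re_ofReal_mul] using h

theorem re_expectProd_le_of_forall (ρ : State (Sys ι)) (σ : State E)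
    (X : Joint ι E →L[ℂ] Joint ι E) {c : ℝ}
    (h : ∀ i k, σ.prob k ≠ 0 →
      (inner ℂ (tmul (ρ.basis i) (σ.basis k)) (X (tmul (ρ.basis i) (σ.basis k)))).re ≤ c) :
    (expectProd ρ σ X).re ≤ c := by
  have h1 := (hasSum_prob_mul ρ σ).mul_right c
  rw [one_mul] at h1
  refine hasSum_le (fun x => ?_) (hasSum_expectProd_re ρ σ X) h1
  by_cases hx : σ.prob x.2 = 0
  · simp [hx]
  · exact mul_le_mul_of_nonneg_left (h _ _ hx)
      (mul_nonneg (ρ.prob_nonneg _) (σ.prob_nonneg _))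

end Expectation

/-! ### Channels in the Heisenberg picture. -/

section Channels

variable {H : Type} [NormedAddCommGroup H] [InnerProductSpace ℂ H] [CompleteSpace H]
  {Φ : (H →L[ℂ] H) →ₗ[ℂ] (H →L[ℂ] H)}

theorem re_inner_mul_self_of_isSelfAdjoint {N : H →L[ℂ] H} (hN : IsSelfAdjoint N) (ψ : H) :
    (inner ℂ ψ ((N * N) ψ)).re = ‖N ψ‖ ^ 2 := by
  rw [mul_apply_eq_comp, ← ContinuousLinearMap.adjoint_inner_left,
    ← ContinuousLinearMap.star_eq_adjoint, hN.star_eq]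
  exact inner_self_eq_norm_sq (𝕜 := ℂ) (N ψ)

theorem IsChannelDual.isSelfAdjoint (hΦ : IsChannelDual Φ) {X : H →L[ℂ] H}
    (hX : IsSelfAdjoint X) : IsSelfAdjoint (Φ X) := by
  obtain ⟨-, κ, K, hK⟩ := hΦ
  rw [ContinuousLinearMap.isSelfAdjoint_iff_isSymmetric] at hX ⊢
  intro φ ψ
  have h1 := (hK X ψ φ).mapL (Complex.conjCLE : ℂ ≃L[ℝ] ℂ).toContinuousLinearMap
  have h2 := hK X φ ψ
  rw [ContinuousLinearMap.coe_coe, ← inner_conj_symm]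
  refine h1.unique ?_
  convert! h2 using 2 with a
  simp only [ContinuousLinearEquiv.coe_coe, Complex.conjCLE_apply]
  exact (inner_conj_symm _ _).trans (hX _ _)

/-- Kadison's inequality `Φ(X)² ≤ Φ(X²)`. -/
theorem IsChannelDual.norm_sq_le (hΦ : IsChannelDual Φ) {X : H →L[ℂ] H}
    (hX : IsSelfAdjoint X) (ψ : H) : ‖Φ X ψ‖ ^ 2 ≤ (inner ℂ ψ (Φ (X * X) ψ)).re := by
  obtain ⟨h1, κ, K, hK⟩ := hΦ
  -- Testing against χ = Φ(X) ψ itself: for each Kraus operator, Re⟨Kχ, X K ψ⟩ ≤ (‖Kχ‖² + ‖X K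
  -- ψ‖²)/2. Summing with Φ(1) = 1 gives ‖χ‖² ≤ (‖χ‖² + ⟨ψ, Φ(X²) ψ⟩)/2.
  set χ := Φ X ψ with hχ
  have e1 := (hK X χ ψ).mapL Complex.reCLM
  have e2 := (hK 1 χ χ).mapL Complex.reCLM
  have e3 := (hK (X * X) ψ ψ).mapL Complex.reCLM
  have e4 := hasSum_le (fun a => ?_) e1 ((e2.add e3).mul_right (1 / 2 : ℝ))
  · rw [h1, ← hχ] at e4
    simp only [Complex.reCLM_apply, one_apply_eq_self] at e4
    have e5 : (inner ℂ χ χ).re = ‖χ‖ ^ 2 := inner_self_eq_norm_sq (𝕜 := ℂ) χ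
    rw [e5] at e4
    linarith
  · simp only [Complex.reCLM_apply, one_apply_eq_self]
    rw [re_inner_mul_self_of_isSelfAdjoint hX]
    have e5 : (inner ℂ (K a χ) (K a χ)).re = ‖K a χ‖ ^ 2 := inner_self_eq_norm_sq (𝕜 := ℂ) _
    have e6 : (inner ℂ (K a χ) (X (K a ψ))).re ≤ ‖K a χ‖ * ‖X (K a ψ)‖ :=
      re_inner_le_norm (𝕜 := ℂ) _ _
    rw [e5]
    nlinarith [sq_nonneg (‖K a χ‖ - ‖X (K a ψ)‖)]

end Channels

theorem sub_mul_sub_self_eq {R : Type*} [Ring R] (a b : R) :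
    a * a - a * b - b * a + b * b = (a - b) * (a - b) := by
  noncomm_ring

section UnitaryChannel

variable {H : Type} [NormedAddCommGroup H] [InnerProductSpace ℂ H] [CompleteSpace H]

/-- The Heisenberg dual `X ↦ V† X V`. -/
def conjDual (V : H →L[ℂ] H) : (H →L[ℂ] H) →ₗ[ℂ] (H →L[ℂ] H) where
  toFun X := star V * X * V
  map_add' X Y := by rw [mul_add, add_mul]
  map_smul' c X := by rw [RingHom.id_apply, mul_smul_comm, smul_mul_assoc]

theorem isChannelDual_conjDual {V : H →L[ℂ] H} (hV : star V * V = 1) :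
    IsChannelDual (conjDual V) := by
  refine ⟨by simp [conjDual, hV], Unit, fun _ => V, fun X φ ψ => ?_⟩
  convert! hasSum_unique (fun _ : Unit => inner ℂ (V φ) (X (V ψ))) using 1
  change inner ℂ φ ((star V * X * V) ψ) = _
  rw [mul_assoc, mul_apply_eq_comp, ContinuousLinearMap.star_eq_adjoint,
    ContinuousLinearMap.adjoint_inner_right, mul_apply_eq_comp]

theorem conjDual_mul {V : H →L[ℂ] H} (hV : V * star V = 1) (X Y : H →L[ℂ] H) :
    conjDual V (X * Y) = conjDual V X * conjDual V Y := by
  change star V * (X * Y) * V = star V * X * V * (star V * Y * V)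
  calc _ = star V * X * (V * star V) * Y * V := by rw [hV, mul_one]; simp only [mul_assoc]
    _ = _ := by simp only [mul_assoc]

theorem conjDual_covariant {V J : H →L[ℂ] H} (hJ : V * J = J * V) (X : H →L[ℂ] H) :
    star J * conjDual V X * J = conjDual V (star J * X * J) := by
  change star J * (star V * X * V) * J = star V * (star J * X * J) * V
  have h2 : star J * star V = star V * star J := by
    rw [← star_mul, ← star_mul, hJ]
  calc _ = (star J * star V) * X * (V * J) := by simp only [mul_assoc]
    _ = _ := by rw [h2, hJ]; simp only [mul_assoc]

end UnitaryChannel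

/-! ### The conserving measurement relative to a frame. -/

section GaussianFrame

open scoped NNReal

variable {ι : Type} [Fintype ι] [DecidableEq ι] {A : Matrix ι ι ℂ} (hA : A.IsHermitian)

/-- The unitary that shifts the momentum of the frame by the eigenvalue of the system. -/
def frameShift : Joint ι (Joint ι LineSpace) →L[ℂ] Joint ι (Joint ι LineSpace) :=
  controlled hA fun i => tensorOp 1 (shiftOp (hA.eigenvalues i))

theorem star_frameShift_mul_self : star (frameShift hA) * frameShift hA = 1 :=
  star_controlled_mul_self hA fun i => isUnitaryRep_shiftOp.ampliate.unitary (hA.eigenvalues i)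

theorem frameShift_mul_star_self : frameShift hA * star (frameShift hA) = 1 :=
  controlled_mul_star_self hA fun i => isUnitaryRep_shiftOp.ampliate.unitary (hA.eigenvalues i)

/-- The shift takes from the line the charge that the system holds, so the phases of the system
cancel by the Weyl relation and only the line still feels the group. -/
theorem jointGroup_mul_frameShift (g : ℝ) :
    jointGroup A (fun t => tensorOp (1 : Matrix ι ι ℂ) (phaseOp t)) g * frameShift hA
      = frameShift hA * tensorOp 1 (tensorOp 1 (phaseOp g)) := by
  rw [jointGroup_eq_controlled hA, frameShift, ← controlled_const (E := Joint ι LineSpace) hA (tensorOp 1 (phaseOp g)),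
    controlled_mul, controlled_mul]
  congr 1
  ext1 i
  rw [smul_mul_assoc, tensorOp_mul, tensorOp_mul, phaseOp_mul_shiftOp, tensorOp_smul_right,
    smul_smul, ← Complex.exp_add]
  have h : -(Complex.I * (g : ℂ)) * (hA.eigenvalues i : ℝ)
      + Complex.I * g * (hA.eigenvalues i : ℝ) = 0 := by ring
  rw [h, Complex.exp_zero, one_smul]

theorem tensorOp_one_mul_frameShift (B : Matrix ι ι ℂ) :
    tensorOp 1 (tensorOp B 1) * frameShift hA = frameShift hA * tensorOp 1 (tensorOp B 1) := by
  rw [frameShift, ← controlled_const (E := Joint ι LineSpace) hA (tensorOp B 1), controlled_mul, controlled_mul]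
  simp only [tensorOp_mul, mul_one, one_mul]

/-- The conserving unitary that swaps the system with its copy relative to the frame. -/
def frameSwap : Joint ι (Joint ι LineSpace) →L[ℂ] Joint ι (Joint ι LineSpace) :=
  frameShift hA * swap ι LineSpace * star (frameShift hA)

theorem star_frameSwap : star (frameSwap hA) = frameSwap hA := by
  simp only [frameSwap, star_mul, star_star, star_swap, mul_assoc]

theorem frameSwap_mul_self : frameSwap hA * frameSwap hA = 1 := by
  calc _ = frameShift hA * swap ι LineSpace * (star (frameShift hA) * frameShift hA)
          * swap ι LineSpace * star (frameShift hA) := by simp only [frameSwap, mul_assoc]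
    _ = frameShift hA * (swap ι LineSpace * swap ι LineSpace) * star (frameShift hA) := by
        rw [star_frameShift_mul_self, mul_one]; simp only [mul_assoc]
    _ = 1 := by rw [swap_mul_swap, mul_one, frameShift_mul_star_self]

/-- Conjugated by the frame shift, the joint group acts on the line alone, where the swap does
nothing. -/
theorem frameSwap_mul_jointGroup (g : ℝ) :
    frameSwap hA * jointGroup A (fun t => tensorOp (1 : Matrix ι ι ℂ) (phaseOp t)) g
      = jointGroup A (fun t => tensorOp (1 : Matrix ι ι ℂ) (phaseOp t)) g * frameSwap hA := by
  set J := jointGroup A (fun t => tensorOp (1 : Matrix ι ι ℂ) (phaseOp t)) g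
  set W := frameShift hA
  set U : Joint ι (Joint ι LineSpace) →L[ℂ] Joint ι (Joint ι LineSpace) :=
    tensorOp 1 (tensorOp 1 (phaseOp g))
  have h1 : J * W = W * U := jointGroup_mul_frameShift hA g
  have h2 : star W * J = U * star W := by
    calc star W * J = star W * J * (W * star W) := by
          rw [frameShift_mul_star_self, mul_one]
      _ = star W * (J * W) * star W := by simp only [mul_assoc]
      _ = (star W * W) * U * star W := by rw [h1]; simp only [mul_assoc]
      _ = U * star W := by rw [star_frameShift_mul_self, one_mul]
  have h3 : swap ι LineSpace * U = U * swap ι LineSpace := swap_mul_tensorOp_one _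
  calc frameSwap hA * J = W * swap ι LineSpace * (star W * J) := by
        simp only [frameSwap, mul_assoc, W]
    _ = W * (swap ι LineSpace * U) * star W := by rw [h2]; simp only [mul_assoc]
    _ = (W * U) * swap ι LineSpace * star W := by rw [h3]; simp only [mul_assoc]
    _ = J * frameSwap hA := by rw [← h1]; simp only [frameSwap, mul_assoc, W]

/-- The frame shift does not touch the copy, so B on the copy passes through the inner pair of
shifts, which cancel. The swap carries B to the system and the outer pair of shifts remains. -/
theorem conjDual_frameSwap (B : Matrix ι ι ℂ) :
    conjDual (frameSwap hA) (tensorOp 1 (tensorOp B 1))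
      = frameShift hA * tensorOp B 1 * star (frameShift hA) := by
  change star (frameSwap hA) * _ * frameSwap hA = _
  rw [star_frameSwap]
  set W := frameShift hA
  have h1 : tensorOp 1 (tensorOp B 1) * W = W * tensorOp 1 (tensorOp B 1) :=
    tensorOp_one_mul_frameShift hA B
  calc frameSwap hA * tensorOp 1 (tensorOp B 1) * frameSwap hA
      = W * swap ι LineSpace * star W * (tensorOp 1 (tensorOp B 1) * W) * swap ι LineSpace
          * star W := by simp only [frameSwap, mul_assoc, W]
    _ = W * swap ι LineSpace * (star W * W) * tensorOp 1 (tensorOp B 1) * swap ι LineSpace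
          * star W := by rw [h1]; simp only [mul_assoc]
    _ = W * (swap ι LineSpace * tensorOp 1 (tensorOp B 1) * swap ι LineSpace) * star W := by
        rw [star_frameShift_mul_self, mul_one]; simp only [mul_assoc]
    _ = W * tensorOp B 1 * star W := by rw [swap_conj_tensorOp]

/-- The covariant implementation by a quantum reference frame on the line. -/
def gaussianImplementation {B : Matrix ι ι ℂ} (hB : B.IsHermitian) (ρ : State (Joint ι LineSpace)) :
    Implementation A where
  E := Joint ι LineSpace
  A := ampliatePMap ι coordOp
  A_selfAdjoint := isSelfAdjoint_ampliatePMap coordOp_symmetric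
    (coordOp_add_smul_surjective (by simp) (by simp)) fun φ => by
      obtain ⟨f, hf⟩ := coordOp_add_smul_surjective (c := -Complex.I) (by simp) (by simp) φ
      exact ⟨f, by rw [← hf, neg_smul, sub_eq_add_neg]⟩
  U t := tensorOp 1 (phaseOp t)
  U_exp := isExpGroup_coordOp.ampliate
  ρ := ρ
  M := tensorOp B 1
  M_selfAdjoint := by
    rw [isSelfAdjoint_iff, tensorOp_star, star_one, Matrix.star_eq_conjTranspose, hB.eq]
  M_comm t := by rw [tensorOp_mul, tensorOp_mul, mul_one, one_mul, mul_one, one_mul]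
  Φ := conjDual (frameSwap hA)
  Φ_channel := isChannelDual_conjDual (by rw [star_frameSwap, frameSwap_mul_self])
  Φ_covariant g X := conjDual_covariant (frameSwap_mul_jointGroup hA g) X

variable {B : Matrix ι ι ℂ} (hB : B.IsHermitian)

/-- Conjugation by a unitary is multiplicative, so both second moments reduce to the square of one
operator. -/
theorem gaussianImplementation_noiseSq (ρ : State (Joint ι LineSpace)) (m : NoiseMoment) :
    (gaussianImplementation hA hB ρ).noiseSq B m
      = (tensorOp B 1 - frameShift hA * tensorOp B 1 * star (frameShift hA))
        * (tensorOp B 1 - frameShift hA * tensorOp B 1 * star (frameShift hA)) := by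
  have h : (gaussianImplementation hA hB ρ).Φ (tensorOp 1 (gaussianImplementation hA hB ρ).M)
      = frameShift hA * tensorOp B 1 * star (frameShift hA) := conjDual_frameSwap hA B
  have h2 : (gaussianImplementation hA hB ρ).Φ (tensorOp 1 (gaussianImplementation hA hB ρ).M
      * tensorOp 1 (gaussianImplementation hA hB ρ).M)
      = (frameShift hA * tensorOp B 1 * star (frameShift hA))
        * (frameShift hA * tensorOp B 1 * star (frameShift hA)) := by
    rw [← conjDual_frameSwap]
    exact conjDual_mul (by rw [star_frameSwap, frameSwap_mul_self]) _ _
  cases m with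
  | effective =>
    change (tensorOp B 1 - (gaussianImplementation hA hB ρ).Φ _)
      * (tensorOp B 1 - (gaussianImplementation hA hB ρ).Φ _) = _
    rw [h]
    rfl
  | dilated =>
    change tensorOp B 1 * tensorOp B 1
      - tensorOp B 1 * (gaussianImplementation hA hB ρ).Φ _
      - (gaussianImplementation hA hB ρ).Φ _ * tensorOp B 1
      + (gaussianImplementation hA hB ρ).Φ _ = _
    rw [h, h2]
    exact sub_mul_sub_self_eq (R := Joint ι (Joint ι LineSpace) →L[ℂ] Joint ι (Joint ι LineSpace))
      _ _

end GaussianFrame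

/-! ### Upper bound on the cost. -/

section Cost

open scoped NNReal

variable {ι : Type} [Fintype ι] [DecidableEq ι]

theorem opNorm_nonneg (C : Matrix ι ι ℂ) : 0 ≤ opNorm C := norm_nonneg _

/-- A frame of standard deviation `r` measures with error at most `‖[A, B]‖ / (2 r)`. -/
theorem cost_le [Nonempty ι] {A B : Matrix ι ι ℂ} (hA : A.IsHermitian) (hB : B.IsHermitian) {f : ℝ → ℝ} (hf : 0 ≤ f 0) (m : NoiseMoment) {ε r : ℝ} (hr : 0 < r)
    (hε : opNorm (A * B - B * A) ≤ 2 * r * ε) : cost f A B m ε ≤ ENNReal.ofReal (r ^ 2) := by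
  obtain ⟨i₀⟩ := ‹Nonempty ι›
  let v : ℝ≥0 := ⟨r ^ 2, sq_nonneg r⟩
  have hvr : (v : ℝ) = r ^ 2 := rfl
  have hv : v ≠ 0 := by
    intro h
    have : (v : ℝ) = 0 := by rw [h]; rfl
    rw [hvr] at this
    exact (pow_pos hr 2).ne' this
  -- The copy of the system in the environment carries no charge, so any unit vector may serve as
  -- its initial state.
  let s₀ : Sys ι := EuclideanSpace.single i₀ 1
  have hs₀ : ‖s₀‖ = 1 := by simp [s₀]
  let x : coordOp.domain := ⟨gaussVec v, gaussVec_mem_domain hv⟩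
  have hφ : ‖tmul s₀ (gaussVec v)‖ = 1 := by rw [norm_tmul, hs₀, norm_gaussVec hv, one_mul]
  obtain ⟨ρ, k, hk, hρ⟩ := exists_isPureAt hφ
  let K := gaussianImplementation hA hB ρ
  have hcost : skewInfo f K.ρ K.A ≤ ENNReal.ofReal (r ^ 2) := by
    have hsymm : ∀ x y : (ampliatePMap ι coordOp).domain,
        inner ℂ (ampliatePMap ι coordOp x) (y : Joint ι LineSpace)
          = inner ℂ (x : Joint ι LineSpace) (ampliatePMap ι coordOp y) := by
      intro x y
      rw [PiLp.inner_apply, PiLp.inner_apply]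
      exact Finset.sum_congr rfl fun i _ => coordOp_symmetric ⟨x.1 i, x.2 i⟩ ⟨y.1 i, y.2 i⟩
    have h := skewInfo_le_of_isPureAt hf hρ hsymm ⟨_, tmul_mem_ampliatePMap_domain s₀ x⟩ hk
    refine h.trans (ENNReal.ofReal_le_ofReal ?_)
    rw [ampliatePMap_tmul, norm_tmul, hs₀, one_mul, norm_sq_coordOp_gaussVec hv, hvr]
    exact sub_le_self _ (sq_nonneg _)
  have hD : HasDerivAt (fun t => tensorOp (1 : Matrix ι ι ℂ) (shiftOp t) (tmul s₀ (gaussVec v)))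
      (tmul s₀ (-((1 / (2 * v : ℝ)) • coordOp x))) 0 := by
    have h := ((tmulL (E := LineSpace) s₀).restrictScalars ℝ).hasFDerivAt.comp_hasDerivAt 0
      (hasDerivAt_shiftOp_gaussVec hv)
    convert! h using 1
    ext1 t
    rw [tensorOp_tmul, map_one]
    rfl
  have hε0 : 0 ≤ ε := by
    by_contra h
    have := opNorm_nonneg (A * B - B * A)
    nlinarith [mul_pos hr (neg_pos.2 (not_le.1 h))]
  have herr : K.worstError B m ≤ ENNReal.ofReal ε := by
    refine iSup_le fun ρS => ENNReal.ofReal_le_ofReal ?_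
    rw [Real.sqrt_le_left hε0]
    refine re_expectProd_le_of_forall ρS K.ρ _ fun i j hj => ?_
    have hjk : j = k := by
      by_contra h
      exact hj (hρ.zero j h)
    have hbasis : K.ρ.basis j = tmul s₀ (gaussVec v) := by rw [hjk]; exact hk
    have hN := gaussianImplementation_noiseSq hA hB ρ m
    have hsa : IsSelfAdjoint (tensorOp B 1 - frameShift hA * tensorOp B 1 * star (frameShift hA)) := by
      rw [isSelfAdjoint_iff, clm_star_sub, star_mul, star_mul, star_star, tensorOp_star, star_one,
        Matrix.star_eq_conjTranspose, hB.eq, mul_assoc]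
    rw [hbasis]
    change (inner ℂ _ ((gaussianImplementation hA hB ρ).noiseSq B m _)).re ≤ _
    rw [hN]
    refine (re_inner_mul_self_of_isSelfAdjoint hsa _).trans_le ?_
    refine pow_le_pow_left₀ (norm_nonneg _) ?_ 2
    refine (norm_tensorOp_sub_conj_le hA B (isUnitaryRep_shiftOp.ampliate) hD _).trans ?_
    rw [ρS.basis.orthonormal.1, norm_tmul, hs₀, one_mul, one_mul, norm_deriv_shiftOp_gaussVec hv,
      hvr, Real.sqrt_sq hr.le, mul_one_div, div_le_iff₀ (by positivity)]
    linarith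
  exact (iInf₂_le K herr).trans hcost

end Cost

/-! ### Standard monotone functions lie below `fSLD`. -/

section Monotone

/-- A real symmetric `2 × 2` matrix with complex entries. -/
def symMatrix (p q r : ℝ) : Matrix (Fin 2) (Fin 2) ℂ := !![(p : ℂ), q; q, r]

/-- Schur complement: the matrix is the rank-one projection of (p, q) scaled by 1/p, plus a diagonal
matrix with the single entry (pr - q²)/p. -/
theorem posSemidef_symMatrix {p q r : ℝ} (hp : 0 < p) (h : q ^ 2 ≤ p * r) :
    (symMatrix p q r).PosSemidef := by
  have h1 : (Matrix.vecMulVec (![(p : ℂ), q] : Fin 2 → ℂ) (star ![(p : ℂ), q])).PosSemidef :=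
    Matrix.posSemidef_vecMulVec_self_star _
  have h2 : (Matrix.diagonal (![0, (((p * r - q ^ 2) / p : ℝ) : ℂ)] : Fin 2 → ℂ)).PosSemidef := by
    rw [Matrix.posSemidef_diagonal_iff]
    intro i
    fin_cases i
    · simp
    · simp only [Fin.mk_one, Matrix.cons_val_one, Matrix.cons_val_fin_one]
      exact Complex.zero_le_real.2 (div_nonneg (by linarith) hp.le)
  have h3 : (0 : ℂ) ≤ ((p⁻¹ : ℝ) : ℂ) := Complex.zero_le_real.2 (inv_nonneg.2 hp.le)
  convert! (h1.smul h3).add h2 using 1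
  have hp' : (p : ℂ) ≠ 0 := by exact_mod_cast hp.ne'
  ext i j
  rw [Matrix.add_apply, Matrix.smul_apply, Matrix.vecMulVec_apply]
  fin_cases i <;> fin_cases j <;> simp [symMatrix] <;> field_simp
  ring

theorem isSelfAdjoint_symMatrix (p q r : ℝ) : IsSelfAdjoint (symMatrix p q r) := by
  rw [isSelfAdjoint_iff, Matrix.star_eq_conjTranspose]
  ext i j
  fin_cases i <;> fin_cases j <;> simp [symMatrix]

/-- The trace and determinant fix the eigenvalues a and b, and on these two points f agrees with its
affine interpolant. -/
theorem cfc_symMatrix_zero_zero (f : ℝ → ℝ) {p q r a b : ℝ} (hab : a ≠ b) (htr : p + r = a + b)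
    (hdet : p * r - q ^ 2 = a * b) :
    cfc f (symMatrix p q r) 0 0 = (((f a - f b) / (a - b) * (p - a) + f a : ℝ) : ℂ) := by
  set α := (f a - f b) / (a - b) with hα
  have hsa := isSelfAdjoint_symMatrix p q r
  have hspec : ∀ t ∈ spectrum ℝ (symMatrix p q r), t = a ∨ t = b := by
    intro t ht
    rw [spectrum.mem_iff, Matrix.isUnit_iff_isUnit_det, isUnit_iff_ne_zero, not_not] at ht
    rw [Matrix.det_fin_two] at ht
    simp only [Matrix.sub_apply, Matrix.algebraMap_matrix_apply, symMatrix] at ht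
    simp at ht
    have h2 : (t - p) * (t - r) - q * q = 0 := by exact_mod_cast ht
    have h3 : (t - a) * (t - b) = 0 := by linear_combination h2 + t * htr - hdet
    rcases mul_eq_zero.1 h3 with h | h
    · exact Or.inl (by linarith)
    · exact Or.inr (by linarith)
  have hcongr : cfc f (symMatrix p q r)
      = cfc (fun t => α * t + (f a - α * a)) (symMatrix p q r) := by
    refine cfc_congr fun t ht => ?_
    rcases hspec t ht with h | h
    · rw [h]; ring
    · have h1 : a - b ≠ 0 := sub_ne_zero.2 hab
      rw [h, hα]
      field_simp
      ring
  rw [hcongr, cfc_add_const _ _ _ (by fun_prop) hsa, cfc_const_mul_id α _ hsa]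
  rw [Matrix.add_apply, Matrix.smul_apply, Matrix.algebraMap_matrix_apply, if_pos rfl]
  simp [symMatrix]
  ring

namespace IsStandardMonotone

variable {f : ℝ → ℝ}

theorem mono_of_le (hf : IsStandardMonotone f) {x y : ℝ} (hx : 0 ≤ x) (hxy : x ≤ y) : f x ≤ f y := by
  have h := hf.mono 1 (algebraMap ℝ _ x) (algebraMap ℝ _ y) ?_ ?_
  · rw [cfc_algebraMap, cfc_algebraMap] at h
    have h2 := h.diag_nonneg (i := 0)
    simp [Matrix.algebraMap_matrix_apply] at h2
    exact_mod_cast h2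
  · rw [Matrix.algebraMap_eq_diagonal, Matrix.posSemidef_diagonal_iff]
    intro i
    exact Complex.zero_le_real.2 hx
  · rw [← map_sub, Matrix.algebraMap_eq_diagonal, Matrix.posSemidef_diagonal_iff]
    intro i
    exact Complex.zero_le_real.2 (sub_nonneg.2 hxy)

theorem le_self (hf : IsStandardMonotone f) {y : ℝ} (hy : 1 ≤ y) : f y ≤ y := by
  rw [hf.symm y (by linarith)]
  have h : f (1 / y) ≤ 1 := by
    exact (hf.mono_of_le (by positivity) ((div_le_one (by linarith)).2 hy)).trans_eq hf.one
  nlinarith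

/-- Take the matrix with eigenvalues x and 1/x whose upper left entry is 1. The spectral weights of
that entry are 1/(1 + x) and x/(1 + x), so by f(1/x) = f(x)/x the corresponding entry of its image
under f is 2 f(x)/(1 + x). Dominating the matrix by a diagonal one with entry 1 + δ bounds this by
f(1 + δ) ≤ 1 + δ. -/
theorem le_fSLD_of_pos (hf : IsStandardMonotone f) {x : ℝ} (hx : 0 < x) : f x ≤ (1 + x) / 2 := by
  rcases eq_or_ne x 1 with h1 | h1
  · rw [h1, hf.one]; norm_num
  have hab : x ≠ 1 / x := by
    intro h
    rw [eq_div_iff hx.ne'] at h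
    have : (x - 1) * (x + 1) = 0 := by linear_combination h
    rcases mul_eq_zero.1 this with h | h
    · exact h1 (by linarith)
    · linarith
  -- The off-diagonal entry is fixed by requiring determinant 1 with diagonal 1 and x + 1/x - 1.
  set d := (x - 1) / Real.sqrt x with hd
  have hd2 : d ^ 2 = x + 1 / x - 2 := by
    rw [hd, div_pow, Real.sq_sqrt hx.le]
    field_simp
    ring
  have key : ∀ δ : ℝ, 0 < δ → 2 * f x / (1 + x) ≤ 1 + δ := by
    intro δ hδ
    -- The term d²/δ makes the difference of the two matrices positive semidefinite; the extra 1 + δ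
    -- keeps the eigenvalues D and 1 + δ distinct, as the interpolation formula requires.
    set D := x + 1 / x - 1 + d ^ 2 / δ + (1 + δ) with hD
    have hpos : 0 < x + 1 / x - 1 + d ^ 2 / δ := by
      have : 0 ≤ d ^ 2 / δ := by positivity
      nlinarith [sq_nonneg d]
    have hX := posSemidef_symMatrix (p := 1) (q := d) (r := x + 1 / x - 1) one_pos (by linarith)
    have hYX : (symMatrix (1 + δ) 0 D - symMatrix 1 d (x + 1 / x - 1)).PosSemidef := by
      have h : symMatrix (1 + δ) 0 D - symMatrix 1 d (x + 1 / x - 1)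
          = symMatrix δ (-d) (d ^ 2 / δ + (1 + δ)) := by
        ext i j
        fin_cases i <;> fin_cases j <;> simp [symMatrix, hD]
        ring
      rw [h]
      refine posSemidef_symMatrix hδ ?_
      have : δ * (d ^ 2 / δ + (1 + δ)) = d ^ 2 + δ * (1 + δ) := by field_simp
      rw [this, neg_sq]
      nlinarith
    have h := (hf.mono 2 _ _ hX hYX).diag_nonneg (i := 0)
    rw [Matrix.sub_apply, cfc_symMatrix_zero_zero f (a := 1 + δ) (b := D) (by linarith) rfl (by ring),
      cfc_symMatrix_zero_zero f hab (by ring) (by rw [hd2]; field_simp; ring),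
      ← Complex.ofReal_sub, Complex.zero_le_real, sub_self, mul_zero, zero_add] at h
    have h2 : (f x - f (1 / x)) / (x - 1 / x) * (1 - x) + f x = 2 * f x / (1 + x) := by
      have h3 := hf.symm x hx
      have h4 : x - 1 / x ≠ 0 := sub_ne_zero.2 hab
      have h5 : x - 1 / x = (x - 1) * (1 + x) / x := by field_simp; ring
      have h6 : f (1 / x) = f x / x := by rw [eq_div_iff hx.ne', mul_comm]; exact h3.symm
      have h7 : x - 1 ≠ 0 := sub_ne_zero.2 h1
      rw [h5, h6]
      field_simp
      ring
    rw [h2] at h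
    linarith [hf.le_self (y := 1 + δ) (by linarith)]
  have := le_of_forall_pos_le_add key
  rw [div_le_iff₀ (by linarith)] at this
  linarith

theorem le_fSLD (hf : IsStandardMonotone f) {x : ℝ} (hx : 0 ≤ x) : f x ≤ (1 + x) / 2 := by
  rcases hx.eq_or_lt with rfl | h
  · refine le_of_forall_pos_le_add fun δ hδ => ?_
    have h1 := hf.mono_of_le le_rfl hδ.le
    have h2 := hf.le_fSLD_of_pos hδ
    linarith
  · exact hf.le_fSLD_of_pos h

theorem zero_le_half (hf : IsStandardMonotone f) : f 0 ≤ 1 / 2 := by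
  simpa using hf.le_fSLD le_rfl

theorem pos_of_pos (hf : IsStandardMonotone f) {x : ℝ} (hx : 0 < x) : 0 < f x := by
  rcases le_total 1 x with h | h
  · have := hf.mono_of_le zero_le_one h
    rw [hf.one] at this
    linarith
  · have := hf.mono_of_le zero_le_one ((one_le_div hx).2 h)
    rw [hf.one] at this
    rw [hf.symm x hx]
    nlinarith

theorem fMean_le (hf : IsStandardMonotone f) {p q : ℝ} (hp : 0 ≤ p) (hq : 0 ≤ q) : fMean f p q ≤ (p + q) / 2 := by
  rw [fMean]
  split_ifs with h
  · rw [h]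
    nlinarith [hf.zero_le_half]
  · have hq' : 0 < q := lt_of_le_of_ne hq (Ne.symm h)
    have h1 := mul_le_mul_of_nonneg_left (hf.le_fSLD (div_nonneg hp hq)) hq
    refine h1.trans (le_of_eq ?_)
    field_simp
    ring

theorem fMean_pos (hf : IsStandardMonotone f) (h0 : 0 < f 0) {p q : ℝ} (hp : 0 ≤ p) (hq : 0 ≤ q) (hpq : p ≠ q) :
    0 < fMean f p q := by
  rw [fMean]
  split_ifs with h
  · rw [h] at hpq
    exact mul_pos (lt_of_le_of_ne hp (Ne.symm hpq)) h0
  · have hq' : 0 < q := lt_of_le_of_ne hq (Ne.symm h)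
    refine mul_pos hq' ?_
    rcases hp.eq_or_lt with rfl | hp'
    · simpa using h0
    · exact hf.pos_of_pos (div_pos hp' hq')

end IsStandardMonotone

theorem fMean_fSLD (p q : ℝ) : fMean fSLD p q = (p + q) / 2 := by
  rw [fMean, fSLD, fSLD]
  split_ifs with h
  · rw [h]; ring
  · field_simp
    ring

/-- The SLD skew information is minimal, up to normalization. -/
theorem ofReal_mul_skewInfo_fSLD_le {H : Type} [NormedAddCommGroup H] [InnerProductSpace ℂ H]
    {f : ℝ → ℝ} (hf : IsStandardMonotone f) (ρ : State H) (A : H →ₗ.[ℂ] H) :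
    ENNReal.ofReal (2 * f 0) * skewInfo fSLD ρ A ≤ skewInfo f ρ A := by
  rcases (hf.nonneg 0 le_rfl).eq_or_lt with h0 | h0
  · simp [← h0]
  rw [skewInfo, skewInfo]
  split_ifs with h
  swap
  · exact le_top
  have hc : ENNReal.ofReal (2 * f 0) * ENNReal.ofReal (fSLD 0 / 2) = ENNReal.ofReal (f 0 / 2) := by
    rw [← ENNReal.ofReal_mul (by positivity)]
    congr 1
    rw [fSLD]
    ring
  rw [← mul_assoc, hc]
  refine mul_le_mul_right (ENNReal.tsum_le_tsum fun i => ENNReal.tsum_le_tsum fun j =>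
    ENNReal.ofReal_le_ofReal (mul_le_mul_of_nonneg_right ?_ (sq_nonneg _))) _
  rw [fMean_fSLD]
  rcases eq_or_ne (ρ.prob i) (ρ.prob j) with hij | hij
  · simp [hij]
  · exact div_le_div_of_nonneg_left (sq_nonneg _)
      (hf.fMean_pos h0 (ρ.prob_nonneg i) (ρ.prob_nonneg j) hij)
      (hf.fMean_le (ρ.prob_nonneg i) (ρ.prob_nonneg j))

end Monotone

/-! ### The uncertainty relation for the SLD skew information. -/

section CauchySchwarz

/-- Hölder for the counting measure; in [0, ∞] the inequality also covers divergent sums. -/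
theorem ENNReal_tsum_mul_sq_le {κ : Type} (u v : κ → ℝ≥0∞) :
    (∑' z, u z * v z) ^ 2 ≤ (∑' z, u z ^ 2) * ∑' z, v z ^ 2 := by
  let _ : MeasurableSpace κ := ⊤
  have h := ENNReal.lintegral_mul_le_Lp_mul_Lq (MeasureTheory.Measure.count (α := κ))
    Real.HolderConjugate.two_two (f := u) (g := v) measurable_from_top.aemeasurable
    measurable_from_top.aemeasurable
  simp only [MeasureTheory.lintegral_count, Pi.mul_apply, ENNReal.rpow_two] at h
  calc _ ≤ ((∑' z, u z ^ 2) ^ (1 / 2 : ℝ) * (∑' z, v z ^ 2) ^ (1 / 2 : ℝ)) ^ 2 := by gcongr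
    _ = _ := by
      rw [mul_pow, ← ENNReal.rpow_two, ← ENNReal.rpow_two, ← ENNReal.rpow_mul, ← ENNReal.rpow_mul]
      norm_num

end CauchySchwarz

section Uncertainty

variable {κ H : Type} [NormedAddCommGroup H] [InnerProductSpace ℂ H] [CompleteSpace H]

/-- The finite-rank form of the uncertainty relation, for a weight `w` that varies less than `p`. -/
theorem ofReal_sq_tsum_weight_le (b : HilbertBasis κ ℂ H) {p : κ → ℝ} (hp : ∀ x, 0 ≤ p x)
    {N : H →L[ℂ] H} (hN : IsSelfAdjoint N) {α : κ → κ → ℂ}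
    (hα : ∀ x y, α y x = starRingEnd ℂ (α x y)) {a : κ → H}
    (ha : ∀ x, p x ≠ 0 → ∀ y, inner ℂ (b y) (a x) = α y x) {w : κ → ℝ}
    (hwf : w.support.Finite) (hw : ∀ x y, |w x - w y| ≤ |p x - p y|)
    (hwp : ∀ x, w x ≠ 0 → p x ≠ 0) :
    ENNReal.ofReal ((2 * ∑' x, w x * (inner ℂ (a x) (N (b x))).im) ^ 2)
      ≤ (∑' x, ∑' y, ENNReal.ofReal ((p x - p y) ^ 2 / ((p x + p y) / 2) * ‖α x y‖ ^ 2))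
        * ∑' x, ENNReal.ofReal (p x * ‖N (b x)‖ ^ 2) := by
  set n : κ → κ → ℂ := fun x y => inner ℂ (b y) (N (b x)) with hn
  have hnsymm : ∀ x y, n y x = starRingEnd ℂ (n x y) := by
    intro x y
    simp only [hn]
    rw [inner_conj_symm]
    exact ((ContinuousLinearMap.isSelfAdjoint_iff_isSymmetric.1 hN) (b x) (b y)).symm
  -- Both α and n are Hermitian, so c is antisymmetric. Hence twice the sum of w_x c_xy is the sum
  -- of (w_x - w_y) c_xy.
  set c : κ → κ → ℝ := fun x y => (α x y * n x y).im with hc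
  have hcanti : ∀ x y, c y x = -c x y := by
    intro x y
    simp only [hc]
    rw [hα, hnsymm, ← map_mul, Complex.conj_im]
  have hsumc : ∀ x, w x ≠ 0 → HasSum (fun y => α x y * n x y) (inner ℂ (a x) (N (b x))) := by
    intro x hx
    have h := b.hasSum_inner_mul_inner (a x) (N (b x))
    convert! h using 2 with y
    rw [← inner_conj_symm, ha x (hwp x hx), hα x y, Complex.conj_conj]
  have hg1 : ∀ x, HasSum (fun y => w x * c x y) (w x * (inner ℂ (a x) (N (b x))).im) := by
    intro x
    by_cases hx : w x = 0
    · simp [hx, hasSum_zero]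
    · exact ((hsumc x hx).mapL Complex.imCLM).mul_left (w x)
  -- Exchanging x and y needs absolute summability over pairs. For an unbounded charge this is
  -- ensured by the finite support of w, each row being summable.
  have hg2 : Summable fun z : κ × κ => w z.1 * c z.1 z.2 := by
    rw [← summable_norm_iff]
    refine (summable_prod_of_nonneg fun z => norm_nonneg _).2 ⟨fun x => ?_, ?_⟩
    · exact (hg1 x).summable.norm
    · refine summable_of_hasFiniteSupport (hwf.subset fun x hx => ?_)
      intro h0
      exact hx (by simp [h0])
  set S := ∑' x, w x * (inner ℂ (a x) (N (b x))).im with hS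
  have hgS : HasSum (fun z : κ × κ => w z.1 * c z.1 z.2) S := by
    rw [hS, (hg2.hasSum.prod_fiberwise hg1).tsum_eq]
    exact hg2.hasSum
  have hgS' : HasSum (fun z : κ × κ => w z.2 * c z.2 z.1) S :=
    (Equiv.prodComm κ κ).hasSum_iff.2 hgS
  have h2S : HasSum (fun z : κ × κ => (w z.1 - w z.2) * c z.1 z.2) (2 * S) := by
    have h := hgS.add hgS'
    rw [← two_mul] at h
    convert! h using 2 with z
    rw [hcanti z.1 z.2]
    ring
  -- The weight √m is divided out of the charge factor and multiplied into the noise factor, so that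
  -- Cauchy–Schwarz yields the SLD sum and the second moment. Where m = 0 both eigenvalues vanish
  -- and so does the term.
  let m : κ × κ → ℝ := fun z => (p z.1 + p z.2) / 2
  have hm : ∀ z, 0 ≤ m z := fun z => div_nonneg (add_nonneg (hp _) (hp _)) zero_le_two
  let u : κ × κ → ℝ := fun z => |p z.1 - p z.2| / Real.sqrt (m z) * ‖α z.1 z.2‖
  let v : κ × κ → ℝ := fun z => Real.sqrt (m z) * ‖n z.1 z.2‖
  have hu0 : ∀ z, 0 ≤ u z := fun z => by positivity
  have hv0 : ∀ z, 0 ≤ v z := fun z => by positivity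
  have hterm : ∀ z : κ × κ, |(w z.1 - w z.2) * c z.1 z.2| ≤ u z * v z := by
    intro z
    have h1 : |c z.1 z.2| ≤ ‖α z.1 z.2‖ * ‖n z.1 z.2‖ :=
      (Complex.abs_im_le_norm _).trans (norm_mul_le _ _)
    rw [abs_mul]
    refine (mul_le_mul (hw _ _) h1 (abs_nonneg _) (abs_nonneg _)).trans (le_of_eq ?_)
    rcases (hm z).eq_or_lt with h0 | h0
    · have h3 : p z.1 + p z.2 = 0 := by
        have : (p z.1 + p z.2) / 2 = 0 := h0.symm
        linarith
      have e1 : p z.1 = 0 := by linarith [hp z.1, hp z.2]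
      have e2 : p z.2 = 0 := by linarith [hp z.1, hp z.2]
      simp [u, e1, e2]
    · have h3 : Real.sqrt (m z) ≠ 0 := (Real.sqrt_pos.2 h0).ne'
      simp only [u, v]
      field_simp
  have hbound : ENNReal.ofReal |2 * S| ≤ ∑' z, ENNReal.ofReal (u z) * ENNReal.ofReal (v z) := by
    rw [← h2S.tsum_eq, ← Real.norm_eq_abs, ofReal_norm]
    refine enorm_tsum_le_tsum_enorm.trans (ENNReal.tsum_le_tsum fun z => ?_)
    rw [← ENNReal.ofReal_mul (hu0 z), ← ofReal_norm, Real.norm_eq_abs]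
    exact ENNReal.ofReal_le_ofReal (hterm z)
  have hu2 : ∑' z, ENNReal.ofReal (u z) ^ 2
      = ∑' x, ∑' y, ENNReal.ofReal ((p x - p y) ^ 2 / ((p x + p y) / 2) * ‖α x y‖ ^ 2) := by
    rw [← ENNReal.tsum_prod (f := fun x y =>
      ENNReal.ofReal ((p x - p y) ^ 2 / ((p x + p y) / 2) * ‖α x y‖ ^ 2))]
    refine tsum_congr fun z => ?_
    rw [← ENNReal.ofReal_pow (hu0 z)]
    simp only [u]
    rw [mul_pow, div_pow, sq_abs, Real.sq_sqrt (hm z)]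
  have hrow : ∀ x, ∑' y, ENNReal.ofReal (p x * ‖n x y‖ ^ 2)
      = ENNReal.ofReal (p x * ‖N (b x)‖ ^ 2) := by
    intro x
    simp only [ENNReal.ofReal_mul (hp x)]
    rw [ENNReal.tsum_mul_left, tsum_ofReal_norm_sq_inner]
  -- As ‖n‖ is symmetric, averaging p_x and p_y gives the same sum as p_x alone, which Parseval
  -- evaluates row by row.
  have hv2 : ∑' z, ENNReal.ofReal (v z) ^ 2 = ∑' x, ENNReal.ofReal (p x * ‖N (b x)‖ ^ 2) := by
    have h1 : ∀ z : κ × κ, ENNReal.ofReal (v z) ^ 2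
        = ENNReal.ofReal (1 / 2) * (ENNReal.ofReal (p z.1 * ‖n z.1 z.2‖ ^ 2)
          + ENNReal.ofReal (p z.2 * ‖n z.2 z.1‖ ^ 2)) := by
      intro z
      rw [← ENNReal.ofReal_pow (hv0 z), ← ENNReal.ofReal_add (mul_nonneg (hp _) (sq_nonneg _))
        (mul_nonneg (hp _) (sq_nonneg _)), ← ENNReal.ofReal_mul (by norm_num)]
      congr 1
      simp only [v]
      rw [mul_pow, Real.sq_sqrt (hm z), hnsymm z.1 z.2, RCLike.norm_conj]
      simp only [m]
      ring
    simp only [h1]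
    rw [ENNReal.tsum_mul_left, ENNReal.tsum_add,
      ENNReal.tsum_prod (f := fun x y => ENNReal.ofReal (p x * ‖n x y‖ ^ 2)),
      ENNReal.tsum_prod (f := fun x y => ENNReal.ofReal (p y * ‖n y x‖ ^ 2)),
      ENNReal.tsum_comm (f := fun x y => ENNReal.ofReal (p y * ‖n y x‖ ^ 2))]
    simp only [hrow]
    rw [← two_mul, ← mul_assoc, ← ENNReal.ofReal_ofNat, ← ENNReal.ofReal_mul (by norm_num)]
    norm_num
  calc ENNReal.ofReal ((2 * S) ^ 2) = ENNReal.ofReal |2 * S| ^ 2 := by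
        rw [← ENNReal.ofReal_pow (abs_nonneg _), sq_abs]
    _ ≤ (∑' z, ENNReal.ofReal (u z) * ENNReal.ofReal (v z)) ^ 2 := by gcongr
    _ ≤ _ := by
        rw [← hu2, ← hv2]
        exact ENNReal_tsum_mul_sq_le _ _

/-- The uncertainty relation for the symmetric logarithmic derivative skew information. -/
theorem ofReal_sq_tsum_le (b : HilbertBasis κ ℂ H) {p : κ → ℝ} (hp : ∀ x, 0 ≤ p x)
    (hps : Summable p) {N : H →L[ℂ] H} (hN : IsSelfAdjoint N) {α : κ → κ → ℂ}
    (hα : ∀ x y, α y x = starRingEnd ℂ (α x y)) {a : κ → H}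
    (ha : ∀ x, p x ≠ 0 → ∀ y, inner ℂ (b y) (a x) = α y x) {t : κ → ℝ} {c : ℝ}
    (ht : ∀ x, p x ≠ 0 → t x = (inner ℂ (a x) (N (b x))).im) (htc : ∀ x, |t x| ≤ c) :
    ENNReal.ofReal ((2 * ∑' x, p x * t x) ^ 2)
      ≤ (∑' x, ∑' y, ENNReal.ofReal ((p x - p y) ^ 2 / ((p x + p y) / 2) * ‖α x y‖ ^ 2))
        * ∑' x, ENNReal.ofReal (p x * ‖N (b x)‖ ^ 2) := by
  -- Soft thresholding of p: the result has finite support because p is summable, varies no more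
  -- than p since the positive part is 1-Lipschitz, and increases to p. The bound on t then allows
  -- dominated convergence.
  let w : ℕ → κ → ℝ := fun n x => max (p x - 1 / ((n : ℝ) + 1)) 0
  have hpos : ∀ n : ℕ, (0 : ℝ) < 1 / ((n : ℝ) + 1) := fun n => Nat.one_div_pos_of_nat
  have hwle : ∀ n x, w n x ≤ p x := fun n x => max_le (by linarith [hpos n]) (hp x)
  have hwp : ∀ n x, w n x ≠ 0 → p x ≠ 0 := by
    intro n x hx h0
    refine hx (le_antisymm ?_ (le_max_right _ _))
    exact (hwle n x).trans_eq h0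
  have hwf : ∀ n, (w n).support.Finite := by
    intro n
    have h := hps.tendsto_cofinite_zero.eventually_lt_const (hpos n)
    refine (Filter.eventually_cofinite.1 h).subset fun x hx => ?_
    intro h2
    exact hx (max_eq_right (by linarith))
  have hw : ∀ n x y, |w n x - w n y| ≤ |p x - p y| := by
    intro n x y
    refine (abs_max_sub_max_le_abs _ _ _).trans (le_of_eq ?_)
    congr 1
    ring
  have hlim : Filter.Tendsto (fun n => ∑' x, w n x * t x) Filter.atTop
      (𝓝 (∑' x, p x * t x)) := by
    refine tendsto_tsum_of_dominated_convergence (bound := fun x => p x * c) (hps.mul_right c)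
      (fun x => ?_) (Filter.Eventually.of_forall fun n x => ?_)
    · refine Filter.Tendsto.mul_const _ ?_
      have h := (tendsto_const_nhds (x := p x)).sub
        (tendsto_one_div_add_atTop_nhds_zero_nat (𝕜 := ℝ))
      have h2 := h.max (tendsto_const_nhds (x := (0 : ℝ)))
      rw [sub_zero, max_eq_left (hp x)] at h2
      exact h2
    · rw [norm_mul, Real.norm_of_nonneg (le_max_right _ _)]
      exact mul_le_mul (hwle n x) (htc x) (abs_nonneg _) (hp x)
  have hlim2 := ENNReal.tendsto_ofReal ((hlim.const_mul 2).pow 2)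
  refine le_of_tendsto' hlim2 fun n => ?_
  have h := ofReal_sq_tsum_weight_le b hp hN hα ha (hwf n) (hw n) (hwp n)
  have e : ∑' x, w n x * (inner ℂ (a x) (N (b x))).im = ∑' x, w n x * t x := by
    refine tsum_congr fun x => ?_
    by_cases hx : w n x = 0
    · rw [hx, zero_mul, zero_mul]
    · rw [ht x (hwp n x hx)]
  rw [e] at h
  exact h

end Uncertainty

/-! ### Product bases and matrix elements. -/

section JointBasis

variable {ι E : Type} [Fintype ι] [NormedAddCommGroup E] [InnerProductSpace ℂ E]

/-- For completeness, let ψ be orthogonal to all products. Contracting ψ with a basis vector of E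
gives a vector of the system orthogonal to every b_i, hence zero; so each component of ψ is
orthogonal to a basis of E. -/
theorem exists_hilbertBasis_tmul [CompleteSpace E] {κ μ : Type} (b : HilbertBasis κ ℂ (Sys ι))
    (e : HilbertBasis μ ℂ E) :
    ∃ B : HilbertBasis (κ × μ) ℂ (Joint ι E), ∀ x, B x = tmul (b x.1) (e x.2) := by
  classical
  have ho : Orthonormal ℂ fun x : κ × μ => tmul (b x.1) (e x.2) := by
    rw [orthonormal_iff_ite]
    rintro ⟨i, k⟩ ⟨j, l⟩
    rw [inner_tmul, orthonormal_iff_ite.1 b.orthonormal, orthonormal_iff_ite.1 e.orthonormal]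
    by_cases h1 : i = j <;> by_cases h2 : k = l <;> simp [h1, h2]
  refine ⟨HilbertBasis.mkOfOrthogonalEqBot ho ?_, fun x => by
    rw [HilbertBasis.coe_mkOfOrthogonalEqBot]⟩
  rw [Submodule.eq_bot_iff]
  intro ψ hψ
  have h1 : ∀ i k, inner ℂ (tmul (b i) (e k)) ψ = 0 := fun i k =>
    (Submodule.mem_orthogonal _ _).1 hψ _ (Submodule.subset_span ⟨(i, k), rfl⟩)
  have h2 : ∀ k, (WithLp.toLp 2 fun j => inner ℂ (e k) (ψ j) : Sys ι) = 0 := by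
    intro k
    have h3 := hasSum_norm_sq_inner b (WithLp.toLp 2 fun j => inner ℂ (e k) (ψ j) : Sys ι)
    have h4 : ∀ i, inner ℂ (b i) (WithLp.toLp 2 fun j => inner ℂ (e k) (ψ j) : Sys ι) = 0 := by
      intro i
      rw [← h1 i k]
      simp only [PiLp.inner_apply, tmul_apply, inner_smul_left, RCLike.inner_apply]
      exact Finset.sum_congr rfl fun j _ => mul_comm _ _
    simp only [h4, norm_zero, ne_eq, OfNat.ofNat_ne_zero, not_false_eq_true, zero_pow] at h3
    have h5 := h3.unique hasSum_zero
    exact norm_eq_zero.1 (pow_eq_zero_iff two_ne_zero |>.1 h5)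
  ext j
  have h6 := hasSum_norm_sq_inner e (ψ j)
  have h7 : ∀ k, inner ℂ (e k) (ψ j) = 0 := fun k => congrArg (fun v : Sys ι => v j) (h2 k)
  simp only [h7, norm_zero, ne_eq, OfNat.ofNat_ne_zero, not_false_eq_true, zero_pow] at h6
  exact norm_eq_zero.1 (pow_eq_zero_iff two_ne_zero |>.1 (h6.unique hasSum_zero))

end JointBasis

section MatrixElements

variable {H : Type} [NormedAddCommGroup H] [InnerProductSpace ℂ H]

theorem matrixElement_conj {A : H →ₗ.[ℂ] H}
    (hsymm : ∀ x y : A.domain, inner ℂ (A x) (y : H) = inner ℂ (x : H) (A y)) (x y : H) :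
    matrixElement A y x = starRingEnd ℂ (matrixElement A x y) := by
  by_cases hx : x ∈ A.domain
  · rw [matrixElement_of_right_mem y ⟨x, hx⟩, matrixElement_of_left_mem hsymm ⟨x, hx⟩,
      inner_conj_symm]
  · by_cases hy : y ∈ A.domain
    · rw [matrixElement_of_left_mem hsymm ⟨y, hy⟩, matrixElement_of_right_mem x ⟨y, hy⟩,
        inner_conj_symm]
    · simp [matrixElement, hx, hy]

theorem symmetric_of_isSelfAdjoint [CompleteSpace H] {A : H →ₗ.[ℂ] H} (hA : IsSelfAdjoint A)
    (x y : A.domain) : inner ℂ (A x) (y : H) = inner ℂ (x : H) (A y) := by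
  have h := LinearPMap.adjoint_isFormalAdjoint hA.dense_domain
  rw [LinearPMap.isSelfAdjoint_def.1 hA] at h
  exact h x y

variable {ι : Type} [Fintype ι] [DecidableEq ι]

theorem mem_sysOp_domain (A : Matrix ι ι ℂ) (x : Sys ι) : x ∈ (sysOp A).domain :=
  Submodule.mem_top

theorem matrixElement_sysOp (A : Matrix ι ι ℂ) (x y : Sys ι) :
    matrixElement (sysOp A) x y = inner ℂ x (Matrix.toEuclideanCLM (𝕜 := ℂ) A y) :=
  matrixElement_of_right_mem x (⟨y, mem_sysOp_domain A y⟩ : (sysOp A).domain)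

theorem isSelfAdjoint_toEuclideanCLM {A : Matrix ι ι ℂ} (hA : A.IsHermitian) :
    IsSelfAdjoint (Matrix.toEuclideanCLM (𝕜 := ℂ) A) := by
  have h := (Matrix.toEuclideanCLM (n := ι) (𝕜 := ℂ)).map_star' A
  rw [isSelfAdjoint_iff]
  refine h.symm.trans ?_
  rw [Matrix.star_eq_conjTranspose, hA.eq]
  rfl

theorem inner_toEuclideanCLM {A : Matrix ι ι ℂ} (hA : A.IsHermitian) (x y : Sys ι) :
    inner ℂ (Matrix.toEuclideanCLM (𝕜 := ℂ) A x) y = inner ℂ x (Matrix.toEuclideanCLM (𝕜 := ℂ) A y) :=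
  ContinuousLinearMap.isSelfAdjoint_iff_isSymmetric.1 (isSelfAdjoint_toEuclideanCLM hA) x y

theorem sysOp_symmetric {A : Matrix ι ι ℂ} (hA : A.IsHermitian) (x y : (sysOp A).domain) :
    inner ℂ (sysOp A x) (y : Sys ι) = inner ℂ (x : Sys ι) (sysOp A y) :=
  inner_toEuclideanCLM hA x y

theorem inner_commutator {A B : Matrix ι ι ℂ} (hA : A.IsHermitian) (hB : B.IsHermitian)
    (s : Sys ι) : inner ℂ s (Matrix.toEuclideanCLM (𝕜 := ℂ) (A * B - B * A) s)
      = 2 * Complex.I * ((inner ℂ (Matrix.toEuclideanCLM (𝕜 := ℂ) A s)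
          (Matrix.toEuclideanCLM (𝕜 := ℂ) B s)).im : ℝ) := by
  rw [map_sub, map_mul, map_mul, sub_apply, inner_sub_right, mul_apply_eq_comp, mul_apply_eq_comp,
    ← inner_toEuclideanCLM hA s, ← inner_toEuclideanCLM hB s (Matrix.toEuclideanCLM (𝕜 := ℂ) A s),
    ← inner_conj_symm (Matrix.toEuclideanCLM (𝕜 := ℂ) B s), Complex.sub_conj]
  push_cast
  ring

end MatrixElements

/-! ### Subadditivity of the SLD skew information. -/

section Additivity

variable {ι E : Type} [Fintype ι] [DecidableEq ι] [NormedAddCommGroup E] [InnerProductSpace ℂ E]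

open Classical in
/-- Matrix elements of `A ⊗ 1 + 1 ⊗ H` in a product basis. -/
def sumElement (ρ : State (Sys ι)) (σ : State E) (A : Matrix ι ι ℂ) (H : E →ₗ.[ℂ] E)
    (x y : ρ.idx × σ.idx) : ℂ :=
  (if x.2 = y.2 then matrixElement (sysOp A) (ρ.basis x.1) (ρ.basis y.1) else 0)
    + if x.1 = y.1 then matrixElement H (σ.basis x.2) (σ.basis y.2) else 0

/-- The prefactor f(0)/2 is 1/4 for `fSLD`. Off the domain the right-hand side is ∞ by convention,
hence an inequality. -/
theorem tsum_le_four_mul_skewInfo {H : Type} [NormedAddCommGroup H] [InnerProductSpace ℂ H]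
    (ρ : State H) (A : H →ₗ.[ℂ] H) :
    ∑' i, ∑' j, ENNReal.ofReal ((ρ.prob i - ρ.prob j) ^ 2 / ((ρ.prob i + ρ.prob j) / 2)
        * ‖matrixElement A (ρ.basis i) (ρ.basis j)‖ ^ 2) ≤ 4 * skewInfo fSLD ρ A := by
  rw [skewInfo]
  split_ifs with h
  · simp only [fMean_fSLD]
    rw [← mul_assoc, ← ENNReal.ofReal_ofNat, ← ENNReal.ofReal_mul (by norm_num)]
    have : (4 : ℝ) * (fSLD 0 / 2) = 1 := by rw [fSLD]; norm_num
    rw [this, ENNReal.ofReal_one, one_mul]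
  · rw [ENNReal.mul_top (by norm_num)]
    exact le_top

theorem State.tsum_ofReal_prob {H : Type} [NormedAddCommGroup H] [InnerProductSpace ℂ H]
    (ρ : State H) : ∑' k, ENNReal.ofReal (ρ.prob k) = 1 := by
  rw [← ENNReal.ofReal_tsum_of_nonneg ρ.prob_nonneg ρ.prob_sum.summable, ρ.prob_sum.tsum_eq,
    ENNReal.ofReal_one]

/-- Tracing out the factor on which the operator acts as the identity. -/
theorem tsum_tsum_ite_snd {κ μ : Type} [DecidableEq μ] (q : μ → ℝ≥0∞) (hq : ∑' k, q k = 1)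
    (T : κ → κ → ℝ≥0∞) :
    ∑' x : κ × μ, ∑' y : κ × μ, (if y.2 = x.2 then q x.2 * T x.1 y.1 else 0)
      = ∑' i, ∑' j, T i j := by
  have h : ∀ x : κ × μ, (∑' y : κ × μ, if y.2 = x.2 then q x.2 * T x.1 y.1 else 0)
      = q x.2 * ∑' j, T x.1 j := by
    intro x
    rw [ENNReal.tsum_prod (f := fun j l => if l = x.2 then q x.2 * T x.1 j else 0)]
    simp only [tsum_ite_eq, ENNReal.tsum_mul_left]
  simp only [h]
  rw [ENNReal.tsum_prod (f := fun i k => q k * ∑' j, T i j)]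
  simp only [ENNReal.tsum_mul_right, hq, one_mul]

theorem tsum_tsum_ite_fst {κ μ : Type} [DecidableEq κ] (r : κ → ℝ≥0∞) (hr : ∑' i, r i = 1)
    (R : μ → μ → ℝ≥0∞) :
    ∑' x : κ × μ, ∑' y : κ × μ, (if y.1 = x.1 then r x.1 * R x.2 y.2 else 0)
      = ∑' k, ∑' l, R k l := by
  have h : ∀ x : κ × μ, (∑' y : κ × μ, if y.1 = x.1 then r x.1 * R x.2 y.2 else 0)
      = r x.1 * ∑' l, R x.2 l := by
    intro x
    rw [ENNReal.tsum_prod (f := fun j l => if j = x.1 then r x.1 * R x.2 l else 0),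
      ENNReal.tsum_comm]
    simp only [tsum_ite_eq, ENNReal.tsum_mul_left]
  simp only [h]
  rw [ENNReal.tsum_prod (f := fun i k => r i * ∑' l, R k l)]
  simp only [ENNReal.tsum_mul_left]
  rw [ENNReal.tsum_mul_right, hr, one_mul]

/-- Homogeneity of degree one lets the common eigenvalue of the idle factor come out; for q = 0 both
sides are 0 by 0/0 = 0. -/
theorem ofReal_sq_div_scale {q : ℝ} (hq : 0 ≤ q) (a b c : ℝ) :
    ENNReal.ofReal ((a * q - b * q) ^ 2 / ((a * q + b * q) / 2) * c)
      = ENNReal.ofReal q * ENNReal.ofReal ((a - b) ^ 2 / ((a + b) / 2) * c) := by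
  rw [← ENNReal.ofReal_mul hq]
  congr 1
  rcases hq.eq_or_lt with rfl | hq
  · simp
  · rw [← sub_mul, ← add_mul, mul_pow, mul_div_right_comm (a + b), sq q, ← mul_assoc,
      mul_div_mul_right _ _ hq.ne']
    ring

open Classical in
-- No cross terms arise: the two summands of the matrix element are both present only on the
-- diagonal, where the eigenvalue difference vanishes.
theorem sumElement_term_le (ρ : State (Sys ι)) (σ : State E) (A : Matrix ι ι ℂ) (H : E →ₗ.[ℂ] E)
    (x y : ρ.idx × σ.idx) :
    ENNReal.ofReal ((ρ.prob x.1 * σ.prob x.2 - ρ.prob y.1 * σ.prob y.2) ^ 2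
        / ((ρ.prob x.1 * σ.prob x.2 + ρ.prob y.1 * σ.prob y.2) / 2)
        * ‖sumElement ρ σ A H x y‖ ^ 2)
      ≤ (if y.2 = x.2 then ENNReal.ofReal (σ.prob x.2) * ENNReal.ofReal
            ((ρ.prob x.1 - ρ.prob y.1) ^ 2 / ((ρ.prob x.1 + ρ.prob y.1) / 2)
              * ‖matrixElement (sysOp A) (ρ.basis x.1) (ρ.basis y.1)‖ ^ 2) else 0)
        + if y.1 = x.1 then ENNReal.ofReal (ρ.prob x.1) * ENNReal.ofReal
            ((σ.prob x.2 - σ.prob y.2) ^ 2 / ((σ.prob x.2 + σ.prob y.2) / 2)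
              * ‖matrixElement H (σ.basis x.2) (σ.basis y.2)‖ ^ 2) else 0 := by
  obtain ⟨i, k⟩ := x
  obtain ⟨j, l⟩ := y
  dsimp only
  by_cases hkl : l = k
  · subst hkl
    by_cases hij : j = i
    · subst hij
      rw [sub_self, zero_pow two_ne_zero, zero_div, zero_mul, ENNReal.ofReal_zero]
      exact zero_le
    · rw [if_pos rfl, if_neg hij, add_zero, ofReal_sq_div_scale (σ.prob_nonneg l), sumElement,
        if_pos rfl, if_neg (Ne.symm hij), add_zero]
  · by_cases hij : j = i
    · subst hij
      rw [if_pos rfl, if_neg hkl, zero_add, mul_comm (ρ.prob j), mul_comm (ρ.prob j),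
        ofReal_sq_div_scale (ρ.prob_nonneg j), sumElement, if_pos rfl, if_neg (Ne.symm hkl),
        zero_add]
    · rw [sumElement, if_neg (Ne.symm hkl), if_neg (Ne.symm hij), add_zero, norm_zero,
        zero_pow two_ne_zero, mul_zero, ENNReal.ofReal_zero]
      exact zero_le

/-- Subadditivity of the skew information on product states. -/
theorem tsum_sumElement_le (ρ : State (Sys ι)) (σ : State E) (A : Matrix ι ι ℂ) (H : E →ₗ.[ℂ] E) :
    ∑' x : ρ.idx × σ.idx, ∑' y : ρ.idx × σ.idx,
      ENNReal.ofReal ((ρ.prob x.1 * σ.prob x.2 - ρ.prob y.1 * σ.prob y.2) ^ 2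
        / ((ρ.prob x.1 * σ.prob x.2 + ρ.prob y.1 * σ.prob y.2) / 2)
        * ‖sumElement ρ σ A H x y‖ ^ 2)
      ≤ 4 * (skewInfo fSLD ρ (sysOp A) + skewInfo fSLD σ H) := by
  classical
  refine (ENNReal.tsum_le_tsum fun x => ENNReal.tsum_le_tsum fun y =>
    sumElement_term_le ρ σ A H x y).trans ?_
  simp only [ENNReal.tsum_add]
  rw [tsum_tsum_ite_snd (fun k => ENNReal.ofReal (σ.prob k)) σ.tsum_ofReal_prob (fun i j =>
      ENNReal.ofReal ((ρ.prob i - ρ.prob j) ^ 2 / ((ρ.prob i + ρ.prob j) / 2)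
        * ‖matrixElement (sysOp A) (ρ.basis i) (ρ.basis j)‖ ^ 2)),
    tsum_tsum_ite_fst (fun i => ENNReal.ofReal (ρ.prob i)) ρ.tsum_ofReal_prob (fun k l =>
      ENNReal.ofReal ((σ.prob k - σ.prob l) ^ 2 / ((σ.prob k + σ.prob l) / 2)
        * ‖matrixElement H (σ.basis k) (σ.basis l)‖ ^ 2)), mul_add]
  exact add_le_add (tsum_le_four_mul_skewInfo ρ (sysOp A)) (tsum_le_four_mul_skewInfo σ H)

end Additivity

/-! ### The joint group and its generator. -/

section Conservation

variable {ι E : Type} [Fintype ι] [DecidableEq ι] [NormedAddCommGroup E] [InnerProductSpace ℂ E]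
  {A : Matrix ι ι ℂ}

theorem jointGroup_zero (hA : A.IsHermitian) {U : ℝ → E →L[ℂ] E} (hU : U 0 = 1) :
    jointGroup A U 0 = 1 := by
  rw [jointGroup_eq_controlled hA, hU]
  simp only [Complex.ofReal_zero, mul_zero, neg_zero, zero_mul, Complex.exp_zero, one_smul]
  rw [controlled_const, tensorOp_one]

variable [CompleteSpace E]

theorem smul_mem_unitary {H : Type} [NormedAddCommGroup H] [InnerProductSpace ℂ H]
    [CompleteSpace H] {U : H →L[ℂ] H} (hU : U ∈ unitary (H →L[ℂ] H)) {c : ℂ} (hc : ‖c‖ = 1) :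
    c • U ∈ unitary (H →L[ℂ] H) := by
  have h : star c * c = 1 := by
    rw [Complex.star_def, ← Complex.normSq_eq_conj_mul_self, Complex.normSq_eq_norm_sq, hc]
    simp
  have hs : star (c • U) = star c • star U := star_smul c U
  constructor
  · rw [hs, smul_mul_smul_comm, h, one_smul, Unitary.star_mul_self_of_mem hU]
  · rw [hs, smul_mul_smul_comm, mul_comm, h, one_smul, Unitary.mul_star_self_of_mem hU]

theorem star_jointGroup_mul_tensorOp_one (hA : A.IsHermitian) {U : ℝ → E →L[ℂ] E} {M : E →L[ℂ] E}
    {g : ℝ} (hU : U g ∈ unitary (E →L[ℂ] E)) (hM : M * U g = U g * M) :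
    star (jointGroup A U g) * tensorOp 1 M * jointGroup A U g = tensorOp 1 M := by
  rw [jointGroup_eq_controlled hA, controlled_star, ← controlled_const hA M, controlled_mul,
    controlled_mul]
  congr 1
  ext1 i
  have hu := smul_mem_unitary hU (norm_phase g (hA.eigenvalues i))
  rw [mul_assoc, mul_smul_comm, hM, ← smul_mul_assoc, ← mul_assoc,
    Unitary.star_mul_self_of_mem hu, one_mul]

/-- Identifies the total charge on product vectors as the generator, so that invariance under the
group can be differentiated without defining A_S + A_E as an unbounded operator. -/
theorem hasDerivAt_jointGroup (hA : A.IsHermitian) {H : E →ₗ.[ℂ] E} {U : ℝ → E →L[ℂ] E}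
    (hU : IsExpGroup H U) (s : Sys ι) (e : H.domain) :
    HasDerivAt (fun g => jointGroup A U g (tmul s (e : E)))
      (-(Complex.I • (tmul (Matrix.toEuclideanCLM (𝕜 := ℂ) A s) (e : E) + tmul s (H e)))) 0 := by
  have hU0 : U 0 = 1 := (⟨hU.unitary, hU.add⟩ : IsUnitaryRep U).zero
  have hform : ∀ g, jointGroup A U g (tmul s (e : E))
      = ∑ i, tmulL (Matrix.toEuclideanCLM (𝕜 := ℂ) (eigProj hA i) s)
        (Complex.exp (-(Complex.I * g) * (hA.eigenvalues i : ℝ)) • U g (e : E)) := by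
    intro g
    rw [jointGroup_eq_controlled hA, controlled]
    simp only [_root_.sum_apply, tensorOp_tmul, tmulL_apply, _root_.smul_apply]
  have hphase : ∀ a : ℝ, HasDerivAt (fun g : ℝ => Complex.exp (-(Complex.I * g) * a))
      (-(Complex.I * a)) 0 := by
    intro a
    have h1 : HasDerivAt (fun g : ℝ => -(Complex.I * g) * a) (-(Complex.I * a)) 0 := by
      have h2 := ((Complex.ofRealCLM.hasDerivAt (x := 0)).const_mul (-(Complex.I * a)))
      convert! h2 using 1
      · ext t
        simp only [Complex.ofRealCLM_apply]
        ring
      · simp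
    simpa using h1.cexp
  simp only [hform]
  have hd : ∀ i, HasDerivAt (fun g : ℝ => tmulL (Matrix.toEuclideanCLM (𝕜 := ℂ) (eigProj hA i) s)
        (Complex.exp (-(Complex.I * g) * (hA.eigenvalues i : ℝ)) • U g (e : E)))
      (tmulL (Matrix.toEuclideanCLM (𝕜 := ℂ) (eigProj hA i) s)
        (-(Complex.I • (((hA.eigenvalues i : ℝ) : ℂ) • (e : E) + H e)))) 0 := by
    intro i
    have h1 := (hphase (hA.eigenvalues i)).smul (hU.deriv e)
    have h2 := ((tmulL (E := E) (Matrix.toEuclideanCLM (𝕜 := ℂ) (eigProj hA i) s)).restrictScalars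
      ℝ).hasFDerivAt.comp_hasDerivAt 0 h1
    convert! h2 using 1
    rw [hU0]
    simp only [Complex.ofReal_zero, mul_zero, neg_zero, zero_mul, Complex.exp_zero, one_smul,
      one_apply_eq_self, ContinuousLinearMap.coe_restrictScalars']
    congr 1
    rw [smul_add, smul_smul, neg_add, neg_smul]
    abel
  have hsum := HasDerivAt.fun_sum (u := Finset.univ) fun i _ => hd i
  convert! hsum using 1
  simp only [tmulL_apply, map_neg, map_smul, map_add]
  rw [Finset.sum_neg_distrib, ← Finset.smul_sum, Finset.sum_add_distrib]
  have e1 : ∀ x : E, ∑ i, tmul (Matrix.toEuclideanCLM (𝕜 := ℂ) (eigProj hA i) s) x = tmul s x := by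
    intro x
    calc _ = tensorOp (∑ i, eigProj hA i) 1 (tmul s x) := by
          rw [tensorOp_sum_left, _root_.sum_apply]
          simp only [tensorOp_tmul, one_apply_eq_self]
      _ = _ := by rw [sum_eigProj, tensorOp_one, one_apply_eq_self]
  have e2 : ∀ x : E, ∑ i, ((hA.eigenvalues i : ℝ) : ℂ) •
      tmul (Matrix.toEuclideanCLM (𝕜 := ℂ) (eigProj hA i) s) x
      = tmul (Matrix.toEuclideanCLM (𝕜 := ℂ) A s) x := by
    intro x
    calc _ = tensorOp (∑ i, ((hA.eigenvalues i : ℝ) : ℂ) • eigProj hA i) 1 (tmul s x) := by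
          rw [tensorOp_sum_left, _root_.sum_apply]
          simp only [tensorOp_smul_left, _root_.smul_apply, tensorOp_tmul, one_apply_eq_self]
      _ = _ := by rw [sum_eigenvalue_smul_eigProj, tensorOp_tmul, one_apply_eq_self]
  rw [e1, e2]

end Conservation

/-! ### The improved Wigner–Araki–Yanase–Ozawa inequality. -/

namespace Implementation

variable {ι : Type} [Fintype ι] [DecidableEq ι] {A B : Matrix ι ι ℂ}

theorem isSelfAdjoint_dual_probe (K : Implementation A) :
    IsSelfAdjoint (K.Φ (tensorOp 1 K.M)) := by
  refine K.Φ_channel.isSelfAdjoint ?_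
  rw [isSelfAdjoint_iff, tensorOp_star, star_one, K.M_selfAdjoint.star_eq]

theorem isSelfAdjoint_noise (K : Implementation A) (hB : B.IsHermitian) :
    IsSelfAdjoint (tensorOp B 1 - K.Φ (tensorOp 1 K.M)) := by
  rw [isSelfAdjoint_iff, clm_star_sub, tensorOp_star, star_one, Matrix.star_eq_conjTranspose,
    hB.eq, K.isSelfAdjoint_dual_probe.star_eq]

theorem dual_probe_invariant (K : Implementation A) (hA : A.IsHermitian) (g : ℝ) :
    star (jointGroup A K.U g) * K.Φ (tensorOp 1 K.M) * jointGroup A K.U g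
      = K.Φ (tensorOp 1 K.M) := by
  rw [K.Φ_covariant, star_jointGroup_mul_tensorOp_one hA (K.U_exp.unitary g) (K.M_comm g)]

/-- The dual probe observable commutes weakly with the total conserved quantity. -/
theorem inner_dual_probe_im (K : Implementation A) (hA : A.IsHermitian) (s : Sys ι)
    (e : K.A.domain) :
    (inner ℂ (tmul (Matrix.toEuclideanCLM (𝕜 := ℂ) A s) (e : K.E) + tmul s (K.A e))
      (K.Φ (tensorOp 1 K.M) (tmul s (e : K.E)))).im = 0 := by
  set a := tmul (Matrix.toEuclideanCLM (𝕜 := ℂ) A s) (e : K.E) + tmul s (K.A e) with ha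
  set R := K.Φ (tensorOp 1 K.M) with hR
  set x := tmul s (e : K.E) with hx
  have hsa : ∀ φ ψ, inner ℂ (R φ) ψ = inner ℂ φ (R ψ) :=
    ContinuousLinearMap.isSelfAdjoint_iff_isSymmetric.1 K.isSelfAdjoint_dual_probe
  have hU0 : K.U 0 = 1 := (⟨K.U_exp.unitary, K.U_exp.add⟩ : IsUnitaryRep K.U).zero
  have hD := hasDerivAt_jointGroup hA K.U_exp s e
  have hRD := (R.restrictScalars ℝ).hasFDerivAt.comp_hasDerivAt 0 hD
  have hI := hD.inner ℂ hRD
  -- The expectation of R along the orbit of the joint group is constant. Its derivative at 0 must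
  -- vanish, which says that ⟨a, R x⟩ is real.
  have hconst : ∀ g, inner ℂ (jointGroup A K.U g x) (R (jointGroup A K.U g x)) = inner ℂ x (R x) := by
    intro g
    conv_rhs => rw [hR, ← K.dual_probe_invariant hA g, ← hR]
    rw [mul_assoc, mul_apply_eq_comp, ContinuousLinearMap.star_eq_adjoint,
      ContinuousLinearMap.adjoint_inner_right, mul_apply_eq_comp]
  have hI2 : HasDerivAt (fun g => inner ℂ (jointGroup A K.U g x) (R (jointGroup A K.U g x))) 0 0 := by
    simp only [hconst]
    exact hasDerivAt_const _ _
  have h0 := hI.unique hI2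
  rw [jointGroup_zero hA hU0] at h0
  simp only [Function.comp, one_apply_eq_self, ContinuousLinearMap.coe_restrictScalars', map_neg,
    map_smul, inner_neg_right, inner_neg_left, inner_smul_left, inner_smul_right,
    jointGroup_zero hA hU0] at h0
  rw [← ha, ← hx, ← hsa, Complex.conj_I] at h0
  have h1 : inner ℂ (R x) a = inner ℂ a (R x) := by
    have h2 : Complex.I * (inner ℂ (R x) a - inner ℂ a (R x)) = 0 := by
      linear_combination -h0
    rcases mul_eq_zero.1 h2 with h | h
    · exact absurd h Complex.I_ne_zero
    · exact sub_eq_zero.1 h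
  rw [← Complex.conj_eq_iff_im, inner_conj_symm, h1]

/-- The two moments differ by Φ(M²) - Φ(M)², which is positive by Kadison's inequality; a lower
bound for the effective moment therefore serves both. -/
theorem re_noiseSq_effective_le (K : Implementation A) (hB : B.IsHermitian) (m : NoiseMoment)
    (ψ : Joint ι K.E) :
    ‖(tensorOp B 1 - K.Φ (tensorOp 1 K.M) : Joint ι K.E →L[ℂ] Joint ι K.E) ψ‖ ^ 2
      ≤ (inner ℂ ψ (K.noiseSq B m ψ)).re := by
  rw [← re_inner_mul_self_of_isSelfAdjoint (K.isSelfAdjoint_noise hB)]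
  cases m with
  | effective => exact le_rfl
  | dilated =>
    have hsa := K.isSelfAdjoint_dual_probe
    have hM : IsSelfAdjoint (tensorOp (1 : Matrix ι ι ℂ) K.M) := by
      rw [isSelfAdjoint_iff, tensorOp_star, star_one, K.M_selfAdjoint.star_eq]
    have h1 := K.Φ_channel.norm_sq_le hM ψ
    rw [← re_inner_mul_self_of_isSelfAdjoint hsa] at h1
    rw [← sub_mul_sub_self_eq]
    simp only [noiseSq]
    rw [add_apply, add_apply, inner_add_right, inner_add_right, Complex.add_re, Complex.add_re]
    linarith

/-- The improved Wigner–Araki–Yanase–Ozawa inequality. -/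
theorem errorSq_lower_bound (K : Implementation A) (hA : A.IsHermitian) (hB : B.IsHermitian)
    (m : NoiseMoment) (ρS : State (Sys ι)) :
    ENNReal.ofReal (‖ρS.expect (Matrix.toEuclideanCLM (𝕜 := ℂ) (A * B - B * A))‖ ^ 2)
        / (4 * (skewInfo fSLD ρS (sysOp A) + skewInfo fSLD K.ρ K.A))
      ≤ ENNReal.ofReal (K.errorSq B m ρS) := by
  classical
  by_cases hdom : ∀ k, K.ρ.prob k ≠ 0 → K.ρ.basis k ∈ K.A.domain
  swap
  -- With an infinite denominator the quotient is 0.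
  · have h : skewInfo fSLD K.ρ K.A = ⊤ := by rw [skewInfo, if_neg hdom]
    rw [h, add_top, ENNReal.mul_top (by norm_num), ENNReal.div_top]
    exact zero_le
  refine ENNReal.div_le_of_le_mul ?_
  set N := tensorOp B 1 - K.Φ (tensorOp 1 K.M) with hN
  obtain ⟨b, hb⟩ := exists_hilbertBasis_tmul ρS.basis K.ρ.basis
  have hsymm := symmetric_of_isSelfAdjoint K.A_selfAdjoint
  let p : ρS.idx × K.ρ.idx → ℝ := fun x => ρS.prob x.1 * K.ρ.prob x.2
  have hp : ∀ x, 0 ≤ p x := fun x => mul_nonneg (ρS.prob_nonneg _) (K.ρ.prob_nonneg _)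
  have hp2 : ∀ x, p x ≠ 0 → K.ρ.basis x.2 ∈ K.A.domain := fun x hx =>
    hdom _ (right_ne_zero_of_mul hx)
  -- Half the modulus, up to sign, of the expectation of [A, B]; it depends on the system index only
  -- and is bounded, as the limiting argument requires.
  let τ : ρS.idx → ℝ := fun i => (inner ℂ (Matrix.toEuclideanCLM (𝕜 := ℂ) A (ρS.basis i))
    (Matrix.toEuclideanCLM (𝕜 := ℂ) B (ρS.basis i))).im
  -- The total charge applied to a product eigenvector. The default 0 is taken only where the weight
  -- p vanishes.
  let a : ρS.idx × K.ρ.idx → Joint ι K.E := fun x =>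
    if h : K.ρ.basis x.2 ∈ K.A.domain then
      tmul (Matrix.toEuclideanCLM (𝕜 := ℂ) A (ρS.basis x.1)) (K.ρ.basis x.2)
        + tmul (ρS.basis x.1) (K.A ⟨K.ρ.basis x.2, h⟩)
    else 0
  have hα : ∀ x y, sumElement ρS K.ρ A K.A y x
      = starRingEnd ℂ (sumElement ρS K.ρ A K.A x y) := by
    intro x y
    simp only [sumElement, map_add, apply_ite (starRingEnd ℂ), map_zero,
      ← matrixElement_conj hsymm, ← matrixElement_conj (sysOp_symmetric hA), eq_comm]
  have ha : ∀ x, p x ≠ 0 → ∀ y, inner ℂ (b y) (a x) = sumElement ρS K.ρ A K.A y x := by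
    intro x hx y
    have h := hp2 x hx
    simp only [a]
    rw [dif_pos h, hb, inner_add_right, inner_tmul, inner_tmul, sumElement, matrixElement_sysOp,
      matrixElement_of_right_mem _ ⟨_, h⟩, orthonormal_iff_ite.1 ρS.basis.orthonormal,
      orthonormal_iff_ite.1 K.ρ.basis.orthonormal, mul_ite, mul_one, mul_zero, ite_mul, one_mul,
      zero_mul]
  -- R drops out by `inner_dual_probe_im`, and the A_E term against B is a product of two real
  -- expectations; only the pairing of A s with B s has an imaginary part.
  have ht : ∀ x, p x ≠ 0 → τ x.1 = (inner ℂ (a x) (N (b x))).im := by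
    intro x hx
    have h := hp2 x hx
    have h1 := K.inner_dual_probe_im hA (ρS.basis x.1) ⟨_, h⟩
    have h2 : (inner ℂ (ρS.basis x.1) (Matrix.toEuclideanCLM (𝕜 := ℂ) B (ρS.basis x.1))).im = 0 := by
      rw [← Complex.conj_eq_iff_im, inner_conj_symm, inner_toEuclideanCLM hB]
    have h3 : (inner ℂ (K.A ⟨_, h⟩) (K.ρ.basis x.2)).im = 0 := by
      rw [hsymm ⟨_, h⟩ ⟨_, h⟩]
      exact inner_self_im_eq_zero_of_symmetric hsymm ⟨_, h⟩
    have h4 : inner ℂ (K.ρ.basis x.2) (K.ρ.basis x.2) = (1 : ℂ) := by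
      rw [orthonormal_iff_ite.1 K.ρ.basis.orthonormal, if_pos rfl]
    simp only [a, τ]
    rw [dif_pos h, hb, hN, sub_apply, inner_sub_right, Complex.sub_im, h1, sub_zero, tensorOp_tmul,
      one_apply_eq_self, inner_add_left, inner_tmul, inner_tmul, Complex.add_im, h4, mul_one,
      Complex.mul_im, h2, h3]
    ring
  have htc : ∀ x : ρS.idx × K.ρ.idx, |τ x.1| ≤ opNorm A * opNorm B := by
    intro x
    have hn := ρS.basis.orthonormal.1 x.1
    refine (Complex.abs_im_le_norm _).trans ((norm_inner_le_norm _ _).trans ?_)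
    refine mul_le_mul ?_ ?_ (norm_nonneg _) (opNorm_nonneg A)
    · refine (ContinuousLinearMap.le_opNorm _ _).trans_eq ?_
      rw [hn, mul_one, opNorm]
    · refine (ContinuousLinearMap.le_opNorm _ _).trans_eq ?_
      rw [hn, mul_one, opNorm]
  have key := ofReal_sq_tsum_le b hp (hasSum_prob_mul ρS K.ρ).summable (K.isSelfAdjoint_noise hB)
    hα ha ht htc
  have herr : ∑' x, ENNReal.ofReal (p x * ‖N (b x)‖ ^ 2) ≤ ENNReal.ofReal (K.errorSq B m ρS) := by
    have h1 := hasSum_expectProd_re ρS K.ρ (K.noiseSq B m)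
    have h2 : ∀ x, p x * ‖N (b x)‖ ^ 2 ≤ p x * (inner ℂ (tmul (ρS.basis x.1) (K.ρ.basis x.2))
        (K.noiseSq B m (tmul (ρS.basis x.1) (K.ρ.basis x.2)))).re := by
      intro x
      rw [hb]
      exact mul_le_mul_of_nonneg_left (K.re_noiseSq_effective_le hB m _) (hp x)
    have h3 : ∀ x, 0 ≤ p x * (inner ℂ (tmul (ρS.basis x.1) (K.ρ.basis x.2))
        (K.noiseSq B m (tmul (ρS.basis x.1) (K.ρ.basis x.2)))).re := fun x =>
      (mul_nonneg (hp x) (sq_nonneg _)).trans (h2 x)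
    rw [errorSq, ← h1.tsum_eq, ENNReal.ofReal_tsum_of_nonneg h3 h1.summable]
    exact ENNReal.tsum_le_tsum fun x => ENNReal.ofReal_le_ofReal (h2 x)
  have htrace : ‖ρS.expect (Matrix.toEuclideanCLM (𝕜 := ℂ) (A * B - B * A))‖ ^ 2
      = (2 * ∑' x, p x * τ x.1) ^ 2 := by
    have hτs : Summable fun i => ρS.prob i * τ i := by
      refine Summable.of_norm_bounded (ρS.prob_sum.summable.mul_right (opNorm A * opNorm B))
        fun i => ?_
      obtain ⟨k⟩ : Nonempty K.ρ.idx := by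
        by_contra hne
        rw [not_nonempty_iff] at hne
        exact zero_ne_one (hasSum_empty.unique K.ρ.prob_sum)
      rw [norm_mul, Real.norm_of_nonneg (ρS.prob_nonneg i)]
      exact mul_le_mul_of_nonneg_left (htc (i, k)) (ρS.prob_nonneg i)
    have h1 : ∑' x, p x * τ x.1 = ∑' i, ρS.prob i * τ i := by
      have hpt : Summable fun x => p x * τ x.1 := by
        refine Summable.of_norm_bounded
          ((hasSum_prob_mul ρS K.ρ).summable.mul_right (opNorm A * opNorm B)) fun x => ?_
        rw [norm_mul, Real.norm_of_nonneg (hp x)]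
        exact mul_le_mul_of_nonneg_left (htc x) (hp x)
      refine (hpt.hasSum.prod_fiberwise fun i => ?_).tsum_eq.symm
      have h2 := (K.ρ.prob_sum.mul_left (ρS.prob i)).mul_right (τ i)
      rwa [mul_one] at h2
    have h2 : ρS.expect (Matrix.toEuclideanCLM (𝕜 := ℂ) (A * B - B * A))
        = 2 * Complex.I * ((∑' i, ρS.prob i * τ i : ℝ) : ℂ) := by
      rw [State.expect, Complex.ofReal_tsum, ← tsum_mul_left]
      refine tsum_congr fun i => ?_
      rw [inner_commutator hA hB]
      simp only [τ]
      push_cast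
      ring
    rw [h2, h1, norm_mul, norm_mul, Complex.norm_I, Complex.norm_real, mul_one, Complex.norm_ofNat,
      mul_pow, mul_pow, Real.norm_eq_abs, sq_abs]
  rw [htrace, mul_comm (ENNReal.ofReal (K.errorSq B m ρS))]
  exact key.trans (mul_le_mul' (tsum_sumElement_le ρS K.ρ A K.A) herr)

end Implementation

/-- Polarization for a skew-adjoint operator: with y the multiple of T x of length ‖x‖, the forms at
x + iy and x - iy differ by 4‖x‖‖T x‖ in modulus. The parallelogram law bounds that by 4c‖x‖². -/
theorem norm_le_of_quadratic_form_le {H : Type} [NormedAddCommGroup H] [InnerProductSpace ℂ H]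
    {T : H →L[ℂ] H} (hT : ∀ x y, inner ℂ (T x) y = -inner ℂ x (T y)) {c : ℝ} (hc : 0 ≤ c)
    (h : ∀ x, ‖x‖ = 1 → ‖inner ℂ x (T x)‖ ≤ c) : ‖T‖ ≤ c := by
  have h2 : ∀ x, ‖inner ℂ x (T x)‖ ≤ c * ‖x‖ ^ 2 := by
    intro x
    by_cases hx : x = 0
    · simp [hx]
    · have hx' : ‖x‖ ≠ 0 := norm_ne_zero_iff.2 hx
      have h3 := h (((‖x‖⁻¹ : ℝ) : ℂ) • x) (by
        rw [norm_smul, Complex.norm_real, norm_inv, norm_norm, inv_mul_cancel₀ hx'])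
      rw [map_smul, inner_smul_left, inner_smul_right, norm_mul, norm_mul, RCLike.norm_conj,
        Complex.norm_real, norm_inv, norm_norm, ← mul_assoc, ← sq, inv_pow,
        inv_mul_le_iff₀ (by positivity)] at h3
      linarith
  refine ContinuousLinearMap.opNorm_le_bound _ hc fun x => ?_
  by_cases hx : x = 0
  · simp [hx]
  by_cases hTx : T x = 0
  · rw [hTx, norm_zero]; positivity
  have hx' : 0 < ‖x‖ := norm_pos_iff.2 hx
  have hTx' : 0 < ‖T x‖ := norm_pos_iff.2 hTx
  set y : H := ((‖x‖ / ‖T x‖ : ℝ) : ℂ) • T x with hy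
  have hyn : ‖y‖ = ‖x‖ := by
    rw [hy, norm_smul, Complex.norm_real, Real.norm_of_nonneg (by positivity)]
    field_simp
  have hyT : inner ℂ y (T x) = ((‖x‖ * ‖T x‖ : ℝ) : ℂ) := by
    rw [hy, inner_smul_left, inner_self_eq_norm_sq_to_K, Complex.conj_ofReal]
    have : ((‖x‖ / ‖T x‖) * ‖T x‖ ^ 2 : ℝ) = ‖x‖ * ‖T x‖ := by field_simp
    rw [← this]
    push_cast
    rfl
  have hxT : inner ℂ x (T y) = -((‖x‖ * ‖T x‖ : ℝ) : ℂ) := by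
    have h3 := hT x y
    rw [← inner_conj_symm, hyT, Complex.conj_ofReal] at h3
    rw [h3, neg_neg]
  have e1 : inner ℂ (x + Complex.I • y) (T (x + Complex.I • y))
      - inner ℂ (x - Complex.I • y) (T (x - Complex.I • y))
      = -(4 * Complex.I * ((‖x‖ * ‖T x‖ : ℝ) : ℂ)) := by
    simp only [map_add, map_sub, map_smul, inner_add_left, inner_add_right, inner_sub_left,
      inner_sub_right, inner_smul_left, inner_smul_right, Complex.conj_I, hyT, hxT]
    ring
  have e2 : ‖x + Complex.I • y‖ ^ 2 + ‖x - Complex.I • y‖ ^ 2 = 4 * ‖x‖ ^ 2 := by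
    have h4 := parallelogram_law_with_norm ℂ x (Complex.I • y)
    rw [norm_smul Complex.I y, Complex.norm_I, one_mul, hyn] at h4
    linarith
  have e3 : 4 * (‖x‖ * ‖T x‖) ≤ c * (4 * ‖x‖ ^ 2) := by
    calc 4 * (‖x‖ * ‖T x‖) = ‖-(4 * Complex.I * ((‖x‖ * ‖T x‖ : ℝ) : ℂ))‖ := by
          rw [norm_neg, norm_mul, norm_mul, Complex.norm_I, Complex.norm_real,
            Real.norm_of_nonneg (by positivity), Complex.norm_ofNat, mul_one]
      _ ≤ c * ‖x + Complex.I • y‖ ^ 2 + c * ‖x - Complex.I • y‖ ^ 2 := by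
          rw [← e1]
          exact (norm_sub_le _ _).trans (add_le_add (h2 _) (h2 _))
      _ = _ := by rw [← mul_add, e2]
  have e4 : ‖x‖ * ‖T x‖ ≤ ‖x‖ * (c * ‖x‖) := by nlinarith
  exact le_of_mul_le_mul_left e4 hx'

/-! ### Bounds on the worst-case cost. -/

section Bounds

variable {ι : Type} [Fintype ι] [DecidableEq ι] {A B : Matrix ι ι ℂ}

open scoped MatrixOrder Matrix.Norms.L2Operator in
theorem exists_eq_star_mul_self (hA : A.PosSemidef) : ∃ C : Matrix ι ι ℂ, A = star C * C :=
  CStarAlgebra.nonneg_iff_eq_star_mul_self.1 hA.nonneg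

/-- The variance of a positive semidefinite matrix is at most a quarter of its squared norm. -/
theorem variance_le_of_posSemidef (hA : A.PosSemidef) (s : Sys ι) :
    ‖Matrix.toEuclideanCLM (𝕜 := ℂ) A s‖ ^ 2
        - ‖inner ℂ s (Matrix.toEuclideanCLM (𝕜 := ℂ) A s)‖ ^ 2 ≤ opNorm A ^ 2 / 4 := by
  obtain ⟨C, hC⟩ := exists_eq_star_mul_self hA
  set T := Matrix.toEuclideanCLM (n := ι) (𝕜 := ℂ) C with hT
  have hstar : star T = Matrix.toEuclideanCLM (n := ι) (𝕜 := ℂ) (star C) :=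
    ((Matrix.toEuclideanCLM (n := ι) (𝕜 := ℂ)).map_star' C).symm
  have hAT : Matrix.toEuclideanCLM (n := ι) (𝕜 := ℂ) A = star T * T := by
    rw [hC, map_mul, hstar]
  have hnorm : opNorm A = ‖T‖ * ‖T‖ := by
    rw [opNorm, hAT]
    exact ContinuousLinearMap.norm_adjoint_comp_self T
  have h1 : ‖Matrix.toEuclideanCLM (𝕜 := ℂ) A s‖ ≤ ‖T‖ * ‖T s‖ := by
    rw [hAT, mul_apply_eq_comp]
    exact (ContinuousLinearMap.le_opNorm _ _).trans_eq
      (congrArg (· * ‖T s‖) (ContinuousLinearMap.adjoint.norm_map T))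
  have h2 : inner ℂ s (Matrix.toEuclideanCLM (𝕜 := ℂ) A s) = ((‖T s‖ ^ 2 : ℝ) : ℂ) := by
    rw [hAT, mul_apply_eq_comp, ContinuousLinearMap.star_eq_adjoint,
      ContinuousLinearMap.adjoint_inner_right, inner_self_eq_norm_sq_to_K]
    push_cast
    rfl
  rw [h2, Complex.norm_real, Real.norm_of_nonneg (sq_nonneg _), hnorm]
  -- This is A² ≤ ‖A‖ A. With t = ⟨s, A s⟩ the variance is at most ‖A‖ t - t², whose maximum is
  -- ‖A‖²/4.
  have h3 : ‖Matrix.toEuclideanCLM (𝕜 := ℂ) A s‖ ^ 2 ≤ ‖T‖ ^ 2 * ‖T s‖ ^ 2 := by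
    rw [← mul_pow]
    exact pow_le_pow_left₀ (norm_nonneg _) h1 2
  nlinarith [sq_nonneg (‖T‖ ^ 2 / 2 - ‖T s‖ ^ 2)]

/-- The trade-off between the worst-case error and the SLD skew information of the environment. -/
theorem sq_opNorm_commutator_le (hA : A.PosSemidef) (hB : B.IsHermitian) {m : NoiseMoment} {ε : ℝ}
    (hε : 0 < ε) (K : Implementation A) (hK : K.worstError B m ≤ ENNReal.ofReal ε) {J : ℝ}
    (hJ0 : 0 ≤ J) (hJ : skewInfo fSLD K.ρ K.A = ENNReal.ofReal J) :
    opNorm (A * B - B * A) ≤ ε * Real.sqrt (opNorm A ^ 2 + 4 * J) := by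
  refine norm_le_of_quadratic_form_le ?_ (by positivity) fun s hs => ?_
  · intro x y
    simp only [map_sub, map_mul, sub_apply, mul_apply_eq_comp, inner_sub_left, inner_sub_right,
      inner_toEuclideanCLM hA.1, inner_toEuclideanCLM hB]
    ring
  obtain ⟨ρ, k, hk, hρ⟩ := exists_isPureAt hs
  have h1 := K.errorSq_lower_bound hA.1 hB m ρ
  have hexp : ρ.expect (Matrix.toEuclideanCLM (𝕜 := ℂ) (A * B - B * A))
      = inner ℂ s (Matrix.toEuclideanCLM (𝕜 := ℂ) (A * B - B * A) s) := by
    rw [State.expect, tsum_eq_single k fun j hj => by rw [hρ.zero j hj]; simp, hρ.one, hk]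
    simp
  have herr : K.errorSq B m ρ ≤ ε ^ 2 := by
    have h2 := (le_iSup (fun ρ => ENNReal.ofReal (Real.sqrt (K.errorSq B m ρ))) ρ).trans hK
    rw [ENNReal.ofReal_le_ofReal_iff hε.le] at h2
    exact (Real.sqrt_le_left hε.le).1 h2
  have hskew : skewInfo fSLD ρ (sysOp A) ≤ ENNReal.ofReal (opNorm A ^ 2 / 4) := by
    refine (skewInfo_le_of_isPureAt (by norm_num [fSLD]) hρ (sysOp_symmetric hA.1)
      ⟨s, mem_sysOp_domain A s⟩ hk).trans (ENNReal.ofReal_le_ofReal ?_)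
    exact variance_le_of_posSemidef hA s
  have hden : 4 * (skewInfo fSLD ρ (sysOp A) + skewInfo fSLD K.ρ K.A)
      ≤ ENNReal.ofReal (opNorm A ^ 2 + 4 * J) := by
    have e : opNorm A ^ 2 + 4 * J = 4 * (opNorm A ^ 2 / 4 + J) := by ring
    rw [e, ENNReal.ofReal_mul (by norm_num), ENNReal.ofReal_add (by positivity) hJ0, hJ,
      ENNReal.ofReal_ofNat]
    gcongr
  set d := ‖inner ℂ s (Matrix.toEuclideanCLM (𝕜 := ℂ) (A * B - B * A) s)‖ with hd
  have h3 : ENNReal.ofReal (d ^ 2) ≤ ENNReal.ofReal (ε ^ 2 * (opNorm A ^ 2 + 4 * J)) := by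
    rw [hexp] at h1
    rw [ENNReal.ofReal_mul (sq_nonneg _)]
    -- Division by 0 in [0, ∞] gives ∞ unless the numerator is 0; the error is finite, so the
    -- numerator vanishes.
    by_cases h0 : 4 * (skewInfo fSLD ρ (sysOp A) + skewInfo fSLD K.ρ K.A) = 0
    · have h4 : ENNReal.ofReal (d ^ 2) = 0 := by
        by_contra hne
        rw [h0, ENNReal.div_zero hne] at h1
        exact ENNReal.ofReal_ne_top (top_le_iff.1 h1)
      rw [h4]
      exact zero_le
    · have ht := ne_top_of_le_ne_top ENNReal.ofReal_ne_top hden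
      rw [ENNReal.div_le_iff h0 ht] at h1
      exact h1.trans (mul_le_mul' (ENNReal.ofReal_le_ofReal herr) hden)
  rw [ENNReal.ofReal_le_ofReal_iff (by positivity)] at h3
  rw [← Real.sqrt_sq hε.le, ← Real.sqrt_mul (sq_nonneg _)]
  exact Real.le_sqrt_of_sq_le h3

theorem ENNReal_ofReal_sq_rpow_half {r : ℝ} (hr : 0 ≤ r) :
    ENNReal.ofReal (r ^ 2) ^ (1 / 2 : ℝ) = ENNReal.ofReal r := by
  rw [ENNReal.ofReal_rpow_of_nonneg (sq_nonneg r) (by norm_num), ← Real.sqrt_eq_rpow,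
    Real.sqrt_sq hr]

/-- The trade-off gives ‖[A, B]‖/ε ≤ ‖A‖ + 2√J for the SLD information J. Multiplying by √(f(0)/2) ≤
1/2 absorbs the ‖A‖ term into ‖A‖/2 and leaves the square root of 2 f(0) J, which I^f dominates. A
nonpositive left side, as for f(0) = 0, is trivial. -/
theorem le_sqrt_cost (hA : A.PosSemidef) (hB : B.IsHermitian) (m : NoiseMoment) {f : ℝ → ℝ}
    (hf : IsStandardMonotone f) {ε : ℝ} (hε : 0 < ε) :
    ENNReal.ofReal (Real.sqrt (f 0 / 2) * opNorm (A * B - B * A) / ε - opNorm A / 2)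
      ≤ cost f A B m ε ^ (1 / 2 : ℝ) := by
  set l := Real.sqrt (f 0 / 2) * opNorm (A * B - B * A) / ε - opNorm A / 2 with hl
  rcases le_or_gt l 0 with hl0 | hl0
  · rw [ENNReal.ofReal_of_nonpos hl0]
    exact zero_le
  rw [← ENNReal_ofReal_sq_rpow_half hl0.le]
  refine ENNReal.rpow_le_rpow (le_iInf₂ fun K hK => ?_) (by norm_num)
  refine le_trans ?_ (ofReal_mul_skewInfo_fSLD_le hf K.ρ K.A)
  have hA0 := opNorm_nonneg A
  have hf0 : 0 < f 0 := by
    refine lt_of_le_of_ne (hf.nonneg 0 le_rfl) fun h => ?_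
    rw [hl, ← h] at hl0
    simp only [zero_div, Real.sqrt_zero, zero_mul] at hl0
    linarith
  by_cases htop : skewInfo fSLD K.ρ K.A = ⊤
  · rw [htop, ENNReal.mul_top (by simpa using hf0)]
    exact le_top
  set J := (skewInfo fSLD K.ρ K.A).toReal with hJ
  have hJ0 : 0 ≤ J := ENNReal.toReal_nonneg
  have hJe : skewInfo fSLD K.ρ K.A = ENNReal.ofReal J := (ENNReal.ofReal_toReal htop).symm
  have h1 := sq_opNorm_commutator_le hA hB hε K hK hJ0 hJe
  rw [hJe, ← ENNReal.ofReal_mul (by positivity)]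
  refine ENNReal.ofReal_le_ofReal ?_
  have h2 : Real.sqrt (opNorm A ^ 2 + 4 * J) ≤ opNorm A + 2 * Real.sqrt J := by
    refine Real.sqrt_le_iff.2 ⟨by positivity, ?_⟩
    nlinarith [Real.sq_sqrt hJ0, mul_nonneg hA0 (Real.sqrt_nonneg J)]
  have h3 : Real.sqrt (f 0 / 2) ≤ 1 / 2 := by
    refine Real.sqrt_le_iff.2 ⟨by norm_num, ?_⟩
    linarith [hf.zero_le_half]
  have h4 : opNorm (A * B - B * A) / ε ≤ opNorm A + 2 * Real.sqrt J := by
    rw [div_le_iff₀ hε]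
    nlinarith
  have h5 : l ≤ 2 * (Real.sqrt (f 0 / 2) * Real.sqrt J) := by
    rw [hl, mul_div_assoc]
    have h6 := mul_le_mul_of_nonneg_left h4 (Real.sqrt_nonneg (f 0 / 2))
    nlinarith [mul_le_mul_of_nonneg_right h3 hA0]
  calc l ^ 2 ≤ (2 * (Real.sqrt (f 0 / 2) * Real.sqrt J)) ^ 2 := pow_le_pow_left₀ hl0.le h5 2
    _ = 2 * f 0 * J := by
      rw [mul_pow, mul_pow, Real.sq_sqrt (by positivity), Real.sq_sqrt hJ0]
      ring

/-- The frame width ‖[A, B]‖/(2ε) would do, except that it must be positive; adding δ > 0 covers a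
vanishing commutator, and δ is arbitrary. -/
theorem sqrt_cost_le [Nonempty ι] (hA : A.IsHermitian) (hB : B.IsHermitian) (m : NoiseMoment)
    {f : ℝ → ℝ} (hf : 0 ≤ f 0) {ε : ℝ} (hε : 0 < ε) :
    cost f A B m ε ^ (1 / 2 : ℝ) ≤ ENNReal.ofReal (opNorm (A * B - B * A) / (2 * ε)) := by
  have hD := opNorm_nonneg (A * B - B * A)
  refine ENNReal.le_of_forall_pos_le_add fun δ hδ _ => ?_
  have hδ' : (0 : ℝ) < δ := hδ
  have hr : 0 < opNorm (A * B - B * A) / (2 * ε) + δ := by positivity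
  have h1 := cost_le hA hB hf m (ε := ε) hr (by
    have : 2 * (opNorm (A * B - B * A) / (2 * ε) + δ) * ε
        = opNorm (A * B - B * A) + 2 * δ * ε := by field_simp
    rw [this]
    have : 0 ≤ 2 * (δ : ℝ) * ε := by positivity
    linarith)
  have h2 := ENNReal.rpow_le_rpow h1 (z := 1 / 2) (by norm_num)
  rw [ENNReal_ofReal_sq_rpow_half hr.le, ENNReal.ofReal_add (by positivity) hδ'.le,
    ENNReal.ofReal_coe_nnreal] at h2
  exact h2

end Bounds

end SkewCost

end

/-! ### Assembly of the three parts. -/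

theorem mainTheorem5 {ι : Type} [Fintype ι] [DecidableEq ι] [Nonempty ι]
    (A B : Matrix ι ι ℂ) (hA : A.PosSemidef) (hB : B.IsHermitian) (m : SkewCost.NoiseMoment) :
    (∀ f : ℝ → ℝ, SkewCost.IsStandardMonotone f → ∀ ε : ℝ, 0 < ε →
      ENNReal.ofReal (Real.sqrt (f 0 / 2) * SkewCost.opNorm (A * B - B * A) / ε
          - SkewCost.opNorm A / 2)
        ≤ SkewCost.cost f A B m ε ^ (1 / 2 : ℝ) ∧
      (8 * SkewCost.opNorm A * ε ≤ SkewCost.opNorm (A * B - B * A) →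
        SkewCost.cost f A B m ε ^ (1 / 2 : ℝ)
          ≤ ENNReal.ofReal (SkewCost.opNorm (A * B - B * A) / (2 * ε) + SkewCost.opNorm A))) ∧
    (∀ f : ℝ → ℝ, SkewCost.IsStandardMonotone f → f 0 = 1 / 2 →
      ∀ᶠ ε : ℝ in 𝓝[>] 0, SkewCost.cost f A B m ε ≠ ⊤ ∧
        |Real.sqrt (SkewCost.cost f A B m ε).toReal
            - SkewCost.opNorm (A * B - B * A) / (2 * ε)| ≤ SkewCost.opNorm A) ∧
    (∀ (K : SkewCost.Implementation A) (ρS : SkewCost.State (SkewCost.Sys ι)),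
      ENNReal.ofReal (‖ρS.expect (Matrix.toEuclideanCLM (𝕜 := ℂ) (A * B - B * A))‖ ^ 2)
          / (4 * (SkewCost.skewInfo SkewCost.fSLD ρS (SkewCost.sysOp A)
            + SkewCost.skewInfo SkewCost.fSLD K.ρ K.A))
        ≤ ENNReal.ofReal (K.errorSq B m ρS)) := by
  have hA0 := SkewCost.opNorm_nonneg A
  refine ⟨fun f hf ε hε => ⟨SkewCost.le_sqrt_cost hA hB m hf hε, fun _ => ?_⟩,
    fun f hf hf0 => ?_, fun K ρS => K.errorSq_lower_bound hA.1 hB m ρS⟩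
  · exact (SkewCost.sqrt_cost_le hA.1 hB m (hf.nonneg 0 le_rfl) hε).trans
      (ENNReal.ofReal_le_ofReal (by linarith))
  · filter_upwards [self_mem_nhdsWithin] with ε hε
    have hε' : 0 < ε := hε
    have hup := SkewCost.sqrt_cost_le hA.1 hB m (hf.nonneg 0 le_rfl) hε'
    have hlow := SkewCost.le_sqrt_cost hA hB m hf hε'
    -- At f(0) = 1/2 both bounds share the leading term ‖[A, B]‖/(2ε), so the root of the cost lies
    -- between this term minus ‖A‖/2 and the term itself.
    have hs : Real.sqrt (f 0 / 2) = 1 / 2 := by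
      rw [hf0, Real.sqrt_eq_iff_mul_self_eq (by norm_num) (by norm_num)]
      norm_num
    have hD := SkewCost.opNorm_nonneg (A * B - B * A)
    have hfin : SkewCost.cost f A B m ε ≠ ⊤ := by
      intro h
      rw [h, ENNReal.top_rpow_of_pos (by norm_num)] at hup
      exact ENNReal.ofReal_ne_top (top_le_iff.1 hup)
    have hsqrt : SkewCost.cost f A B m ε ^ (1 / 2 : ℝ)
        = ENNReal.ofReal (Real.sqrt (SkewCost.cost f A B m ε).toReal) := by
      rw [Real.sqrt_eq_rpow, ← ENNReal.ofReal_rpow_of_nonneg ENNReal.toReal_nonneg (by norm_num),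
        ENNReal.ofReal_toReal hfin]
    rw [hsqrt, ENNReal.ofReal_le_ofReal_iff (by positivity)] at hup
    rw [hsqrt, ENNReal.ofReal_le_ofReal_iff (Real.sqrt_nonneg _), hs] at hlow
    have e : 1 / 2 * SkewCost.opNorm (A * B - B * A) / ε
        = SkewCost.opNorm (A * B - B * A) / (2 * ε) := by field_simp
    rw [e] at hlow
    refine ⟨hfin, abs_le.2 ⟨by linarith, by linarith⟩⟩
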